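/- Conventions. A partition is identified with its Young diagram; $|\lambda|$ is its number of boxes, and $(b)^a$ denotes the rectangular partition with $a$ rows and $b$ columns. A *set-valued tableau* $T$ of shape $\lambda$ is a filling of the boxes of $\lambda$ with finite non-empty sets of positive integers such that the largest integer in any box is at most the smallest integer in the box to its right and strictly smaller than the smallest integer in the box below it; $x^T$ is the monomial in which the exponent of $x_i$ is the number of boxes of $T$ containing $i$, and $|T|$ is its degree. The *stable Grothendieck polynomial* of $\lambda$ is the power series $G_\lambda=\sum_T(-1)^{|T|-|\lambda|}x^T$ in $x_1,x_2,\dots$, summed over all set-valued tableaux $T$ of shape $\lambda$. The integers $c^\nu_{\lambda\mu}$ are the structure constants of the (linearly independent) $G_\lambda$, that is, $G_\lambda\cdot G_\mu=\sum_\nu c^\nu_{\lambda\mu}G_\nu$, a finite sum. For partitions $\lambda,\mu,\nu$ put $d^\nu_{\lambda\mu}=c^{\rho}_{R\,\nu}$, where $R$ is the smallest rectangular partition containing $\lambda$ and $\mu$ (any other rectangular partition containing both gives the same value) and $\rho=(R+\mu,\lambda)$ is obtained by attaching $\lambda$ to the bottom side and $\mu$ to the right side of $R$. The *word* $w(T)$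 is the sequence of the integers in the boxes of $T$, the rows being read from bottom to top, each row from left to right, and the integers within a box in increasing order. For $\sigma=(\sigma_1,\dots,\sigma_l)$ put $u(\sigma)=(l^{\sigma_l},\dots,2^{\sigma_2},1^{\sigma_1})$. A word of positive integers is a *reverse lattice word* if every occurrence of an integer $i\ge 2$ is followed by more occurrences of $i-1$ than of $i$; it has *content* $\mu$ if each $i\geq 1$ occurs exactly $\mu_i$ times. A *rook-strip* is a set of boxes with at most one box in any row or column. **Proposition.** Let $m_{11},m_{12},m_{23},m_{33}$ be non-negative integers, let $\lambda,\mu,\nu$ be partitions, and define $$c_{\lambda,\mu,\nu}=\sum_{\sigma,\tau}d^{(m_{33})^{m_{12}}}_{\lambda,\sigma}\;d^{(m_{11})^{m_{23}}}_{\tau,\nu}\;c^{\mu}_{\sigma\tau},$$ the sum being over all partitions $\sigma$ and $\tau$. Only finitely many terms of this sum are non-zero, and $c_{\lambda,\mu,\nu}$ is equal to $(-1)^{|\lambda|+|\mu|+|\nu|-m_{33}m_{12}-m_{11}m_{23}}$ times the (finite) number of pairs $(\sigma,T)$ of a partition $\sigma$ contained in the rectangle $(m_{33})^{m_{12}}$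 and a set-valued tableau $T$ whose shape is a partition contained in $(m_{11})^{m_{23}}$, satisfying the following conditions. 1. $\lambda$ is contained in $(m_{33})^{m_{12}}$, and if $\sigma$ is placed in the upper-left corner of the rectangle $(m_{33})^{m_{12}}$ and the 180 degree rotation of $\lambda$ in its lower-right corner, then their union is the whole rectangle and their overlap is a rook-strip. 2. $\nu$ is contained in $(m_{11})^{m_{23}}$, and if the shape of $T$ is placed in the upper-left corner of the rectangle $(m_{11})^{m_{23}}$ and the 180 degree rotation of $\nu$ in its lower-right corner, then their union is the whole rectangle and their overlap is a rook-strip. 3. The composition $w(T)u(\sigma)$ is a reverse lattice word with content $\mu$. -/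

import Mathlib

namespace StableGrothendieck

/-- A set-valued tableau of shape `lam`: the boxes `(i, j)` (row `i`, column `j`, both counted
from `0`) are filled with finite non-empty sets of positive integers, the largest integer in a box
being at most the smallest one in the box to its right and less than the smallest one in the box
below it. Outside of `lam` the filling is set to `∅`, so that tableaux with the same entries are
equal. -/
@[ext]
structure SetValuedTableau (lam : YoungDiagram) where
  entry : ℕ → ℕ → Finset ℕ+
  nonempty : ∀ {i j : ℕ}, (i, j) ∈ lam → (entry i j).Nonempty
  row_weak : ∀ {i j : ℕ}, (i, j + 1) ∈ lam →
    ∀ a ∈ entry i j, ∀ b ∈ entry i (j + 1), a ≤ b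
  col_strict : ∀ {i j : ℕ}, (i + 1, j) ∈ lam →
    ∀ a ∈ entry i j, ∀ b ∈ entry (i + 1) j, a < b
  outside : ∀ {i j : ℕ}, (i, j) ∉ lam → entry i j = ∅

namespace SetValuedTableau

variable {lam : YoungDiagram}

/-- The exponent vector of the monomial `x ^ T`: the exponent of `x k` is the number of boxes of
`T` that contain `k`. Its degree is `|T|`. -/
noncomputable def weight (T : SetValuedTableau lam) : ℕ+ →₀ ℕ :=
  ∑ c ∈ lam.cells, ∑ k ∈ T.entry c.1 c.2, Finsupp.single k 1

/-- The word of `T`: the rows are read from bottom to top, each row from left to right, and the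
integers in one box in increasing order. -/
def word (T : SetValuedTableau lam) : List ℕ+ :=
  (List.range (lam.colLen 0)).reverse.flatMap fun i =>
    (List.range (lam.rowLen i)).flatMap fun j => (T.entry i j).sort (· ≤ ·)

end SetValuedTableau

/-- The single stable Grothendieck polynomial
`G_lam = ∑_T (-1) ^ (|T| - |lam|) x ^ T` in the variables `x 1, x 2, …`, given by its coefficients
(only finitely many tableaux have a given weight). -/
noncomputable def stableG (lam : YoungDiagram) : MvPowerSeries ℕ+ ℤ := fun a =>
  ((((a.degree : ℤ) - (lam.card : ℤ)).negOnePow : ℤˣ) : ℤ) *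
    (Nat.card {T : SetValuedTableau lam // T.weight = a} : ℤ)

/-- `f` is an expansion of the product `G_lam * G_mu` as a finite `ℤ`-linear combination of stable
Grothendieck polynomials of partitions. -/
def IsProductExpansion (lam mu : YoungDiagram) (f : YoungDiagram →₀ ℤ) : Prop :=
  stableG lam * stableG mu = f.sum fun nu a => a • stableG nu

open Classical in
/-- The structure constant `c^nu_{lam, mu}`: the coefficient of `G_nu` in the expansion of
`G_lam * G_mu`. (The expansion exists, and it is unique since the `G_nu` are linearly
independent.) -/
noncomputable def mulCoeff (lam mu nu : YoungDiagram) : ℤ :=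
  if h : ∃ f, IsProductExpansion lam mu f then h.choose nu else 0

/-- The rectangular partition `(b)^a` with `a` rows and `b` columns. -/
def rect (a b : ℕ) : YoungDiagram where
  cells := Finset.range a ×ˢ Finset.range b
  isLowerSet := by
    rintro ⟨i, j⟩ ⟨i', j'⟩ h hm
    have h1 : i' ≤ i := h.1
    have h2 : j' ≤ j := h.2
    simp only [Finset.coe_product, Finset.coe_range, Set.mem_prod, Set.mem_Iio] at hm ⊢
    omega

/-- For `lam` and `mu` contained in the rectangle `R = (b)^a`, the partition `(R + mu, lam)`
obtained by attaching `lam` to the bottom side and `mu` to the right side of `R`. -/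
def attach (a b : ℕ) (lam mu : YoungDiagram) (hl : lam ≤ rect a b) (hm : mu ≤ rect a b) :
    YoungDiagram where
  cells := (rect a b).cells ∪ mu.cells.image (fun c => (c.1, b + c.2)) ∪
    lam.cells.image (fun c => (a + c.1, c.2))
  isLowerSet := by
    have hl' : ∀ c : ℕ × ℕ, c ∈ lam.cells → c.2 < b := fun c hc => by
      have := YoungDiagram.cells_subset_iff.2 hl hc
      simp only [rect, Finset.mem_product, Finset.mem_range] at this
      exact this.2
    have hm' : ∀ c : ℕ × ℕ, c ∈ mu.cells → c.1 < a := fun c hc => by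
      have := YoungDiagram.cells_subset_iff.2 hm hc
      simp only [rect, Finset.mem_product, Finset.mem_range] at this
      exact this.1
    rintro ⟨i, j⟩ ⟨i', j'⟩ h hmem
    have h1 : i' ≤ i := h.1
    have h2 : j' ≤ j := h.2
    simp only [Finset.mem_coe, Finset.mem_union, Finset.mem_image, rect, Finset.mem_product,
      Finset.mem_range, Prod.mk.injEq, Prod.exists] at hmem ⊢
    rcases hmem with (hr | ⟨p, q, hpq, rfl, rfl⟩) | ⟨p, q, hpq, rfl, rfl⟩
    · left; left; omega
    · have hp := hm' _ hpq
      simp only at hp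
      by_cases hj : j' < b
      · left; left; omega
      · refine Or.inl (Or.inr ⟨i', j' - b, ?_, rfl, by omega⟩)
        exact mu.up_left_mem h1 (by omega) hpq
    · have hq := hl' _ hpq
      simp only at hq
      by_cases hi : i' < a
      · left; left; omega
      · refine Or.inr ⟨i' - a, j', ?_, by omega, rfl⟩
        exact lam.up_left_mem (by omega) h2 hpq

/-- The number of rows of the smallest rectangle that contains `lam` and `mu`. -/
def hullRows (lam mu : YoungDiagram) : ℕ := max (lam.colLen 0) (mu.colLen 0)

/-- The number of columns of the smallest rectangle that contains `lam` and `mu`. -/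
def hullCols (lam mu : YoungDiagram) : ℕ := max (lam.rowLen 0) (mu.rowLen 0)

theorem le_rect_of_le (lam : YoungDiagram) (a b : ℕ) (ha : lam.colLen 0 ≤ a)
    (hb : lam.rowLen 0 ≤ b) : lam ≤ rect a b := by
  rw [← YoungDiagram.cells_subset_iff]
  rintro ⟨i, j⟩ h
  have h1 : i < lam.colLen 0 :=
    YoungDiagram.mem_iff_lt_colLen.1 (lam.up_left_mem le_rfl (Nat.zero_le j) h)
  have h2 : j < lam.rowLen 0 :=
    YoungDiagram.mem_iff_lt_rowLen.1 (lam.up_left_mem (Nat.zero_le i) le_rfl h)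
  simp only [rect, Finset.mem_product, Finset.mem_range]
  omega

/-- The coproduct coefficient `d^nu_{lam, mu} = c^rho_{R, nu}`, where `rho = (R + mu, lam)`, for
the smallest rectangle `R` that contains `lam` and `mu`. (Every rectangle containing `lam` and `mu`
gives the same value.) -/
noncomputable def coprodCoeff (nu lam mu : YoungDiagram) : ℤ :=
  mulCoeff (rect (hullRows lam mu) (hullCols lam mu)) nu
    (attach (hullRows lam mu) (hullCols lam mu) lam mu
      (le_rect_of_le _ _ _ (le_max_left _ _) (le_max_left _ _))
      (le_rect_of_le _ _ _ (le_max_right _ _) (le_max_right _ _)))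

/-- The term of the pair `(sigma, tau)` in the sum that defines `c_{lam, mu, nu}`. -/
noncomputable def inboundTerm (m11 m12 m23 m33 : ℕ) (lam mu nu : YoungDiagram)
    (p : YoungDiagram × YoungDiagram) : ℤ :=
  coprodCoeff (rect m12 m33) lam p.1 * coprodCoeff (rect m23 m11) p.2 nu * mulCoeff p.1 p.2 mu

/-- The coefficient `c_{lam, mu, nu}` of the inbound quiver of type `A_3`: the sum over all pairs
of partitions `(sigma, tau)`, only finitely many of which contribute. -/
noncomputable def inboundCoeff (m11 m12 m23 m33 : ℕ) (lam mu nu : YoungDiagram) : ℤ :=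
  ∑ᶠ p : YoungDiagram × YoungDiagram, inboundTerm m11 m12 m23 m33 lam mu nu p

/-- The boxes occupied by the 180 degree rotation of `lam`, placed in the lower-right corner of the
rectangle `(b)^a`; used only for `lam` contained in this rectangle. -/
def rotated (a b : ℕ) (lam : YoungDiagram) : Finset (ℕ × ℕ) :=
  lam.cells.image fun c => (a - 1 - c.1, b - 1 - c.2)

/-- A rook-strip: a set of boxes with at most one box in any row or column. -/
def IsRookStrip (s : Finset (ℕ × ℕ)) : Prop :=
  ∀ c ∈ s, ∀ d ∈ s, c.1 = d.1 ∨ c.2 = d.2 → c = d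

/-- Both partitions are contained in the rectangle `(b)^a`, and if `sigma` is placed in its
upper-left corner and the 180 degree rotation of `lam` in its lower-right corner, then their union
is the whole rectangle and their overlap is a rook-strip. -/
def RookComplementary (a b : ℕ) (sigma lam : YoungDiagram) : Prop :=
  sigma ≤ rect a b ∧ lam ≤ rect a b ∧
    sigma.cells ∪ rotated a b lam = (rect a b).cells ∧
    IsRookStrip (sigma.cells ∩ rotated a b lam)

/-- The word `u(mu) = (l^{mu_l}, …, 2^{mu_2}, 1^{mu_1})`. -/
def rowWord (mu : YoungDiagram) : List ℕ+ :=
  (List.range (mu.colLen 0)).reverse.flatMap fun i => List.replicate (mu.rowLen i) i.succPNat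

/-- A reverse lattice word: every occurrence of an integer `i + 1 ≥ 2` is followed by more
occurrences of `i` than of `i + 1`. -/
def IsReverseLattice (w : List ℕ+) : Prop :=
  ∀ (i : ℕ+) (u v : List ℕ+), w = u ++ (i + 1) :: v → v.count (i + 1) < v.count i

/-- The word `w` has content `mu`: each `i ≥ 1` occurs `mu_i` times (rows of Young diagrams are
counted from `0`). -/
def HasContent (w : List ℕ+) (mu : YoungDiagram) : Prop :=
  ∀ i : ℕ, w.count i.succPNat = mu.rowLen i

/-- The pairs `(sigma, T)` of a partition `sigma` and a set-valued tableau `T` (of some shape) that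
are counted by `c_{lam, mu, nu}`. -/
def inboundPairs (m11 m12 m23 m33 : ℕ) (lam mu nu : YoungDiagram) :
    Set (YoungDiagram × (tau : YoungDiagram) × SetValuedTableau tau) :=
  {p | RookComplementary m12 m33 p.1 lam ∧ RookComplementary m23 m11 p.2.1 nu ∧
    IsReverseLattice (p.2.2.word ++ rowWord p.1) ∧ HasContent (p.2.2.word ++ rowWord p.1) mu}

end StableGrothendieck

/-!
# The coefficients of the inbound quiver of type `A_3`

The coefficient is a sum of products of two coproduct coefficients of rectangles and one structure
constant of the stable Grothendieck polynomials. The coproduct coefficients are structure constants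
too, so the proof rests on a Littlewood-Richardson rule (`mulCoeff_eq`): up to sign,
`c^nu_{lam, mu}` is the number of set-valued tableaux `T` of shape `lam` such that `w(T) u(mu)` is
a reverse lattice word of content `nu`.

The rule is proved in `n` variables by cancellation against the alternating polynomials
`alternant n f`, the antisymmetrizations of `x ^ (f + δ) ∏ (1 - x_j) ^ j`, where `δ` is the
staircase; all variables are replaced by their negatives in monomials, so that no other signs occur.
Stable Grothendieck polynomials are symmetric by a Bender-Knuth involution `bk`. Hence multiplying
`alternant n mu` by the polynomial of `lam` gives the sum of the alternants of `mu + x^T` over all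
tableaux `T` of shape `lam`. Those `T` that violate the lattice condition are grouped by the last
letter `v + 1` in the word, in a box of row `r`, that violates it. Within a group, toggling the
letter `v` in the leftmost box of row `r` that contains `v + 1` splits off a factor `1 - x_v`.
Together with `∏ (1 - x_j) ^ j` this factor is symmetric in `x_v` and `x_{v+1}`, and the
Bender-Knuth involution on the part of `T` that precedes the violating letter shows that the
remaining sum is symmetric as well, so that its antisymmetrization vanishes (`sum_violators`). This
leaves the lattice tableaux (`grothendieck_mul_alternant`). For `mu = ∅` there is just one of them,
which gives the bialternant formula `grothendieck_mul_alternant_zero`. The bialternant formula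
reduces products of stable Grothendieck polynomials to products with alternants, and it also gives
their linear independence, by comparing leading coefficients of alternants.

For a rectangle, the tableaux in the rule for a coproduct coefficient are rigid: with `p` the number
of rows of the enclosing rectangle, letters less than `p` (counted from zero) have to be equal to
the index of their row, and the other letters are determined by the height of their box in the
column. The boxes with letters of the first kind form `sigma`, those with letters of the second kind
the rotation of `lam`, and the tableau exists precisely if these cover the rectangle and overlap in
a rook-strip (`coprodCoeff_rect`). The sum that defines the coefficient then runs over the pairs of
partitions satisfying the conditions on shapes, and each structure constant in it counts the
tableaux satisfying the condition on words.
-/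

namespace StableGrothendieck

/-! ### Fillings with letters counted from zero -/

/-- A filling of the quarter plane by finite sets of letters. Letters are natural numbers, the
letter `k` standing for the positive integer `k + 1`. -/
abbrev Filling := ℕ → ℕ → Finset ℕ

/-- The filling `E` is a set-valued tableau of shape `lam` (and empty outside of `lam`). -/
structure IsTableau (lam : YoungDiagram) (E : Filling) : Prop where
  nonempty : ∀ {i j : ℕ}, (i, j) ∈ lam → (E i j).Nonempty
  row_weak : ∀ {i j : ℕ}, (i, j + 1) ∈ lam → ∀ a ∈ E i j, ∀ b ∈ E i (j + 1), a ≤ b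
  col_strict : ∀ {i j : ℕ}, (i + 1, j) ∈ lam → ∀ a ∈ E i j, ∀ b ∈ E (i + 1) j, a < b
  outside : ∀ {i j : ℕ}, (i, j) ∉ lam → E i j = ∅

namespace IsTableau

variable {lam : YoungDiagram} {E : Filling}

theorem mem_shape (h : IsTableau lam E) {i j k : ℕ} (hk : k ∈ E i j) : (i, j) ∈ lam := by
  by_contra hc
  rw [h.outside hc] at hk
  simp at hk

theorem row_le (h : IsTableau lam E) {i j j' a b : ℕ} (hj : j < j') (ha : a ∈ E i j)
    (hb : b ∈ E i j') : a ≤ b := by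
  induction j', hj using Nat.le_induction generalizing b with
  | base => exact h.row_weak (h.mem_shape hb) a ha b hb
  | succ m hm ih =>
    obtain ⟨c, hc⟩ := h.nonempty (lam.up_left_mem le_rfl (Nat.le_succ m) (h.mem_shape hb))
    exact (ih hc).trans (h.row_weak (h.mem_shape hb) c hc b hb)

theorem col_lt (h : IsTableau lam E) {i i' j a b : ℕ} (hi : i < i') (ha : a ∈ E i j)
    (hb : b ∈ E i' j) : a < b := by
  induction i', hi using Nat.le_induction generalizing b with
  | base => exact h.col_strict (h.mem_shape hb) a ha b hb
  | succ m hm ih =>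
    obtain ⟨c, hc⟩ := h.nonempty (lam.up_left_mem (Nat.le_succ m) le_rfl (h.mem_shape hb))
    exact (ih hc).trans (h.col_strict (h.mem_shape hb) c hc b hb)

theorem row_index_le (h : IsTableau lam E) {i j k : ℕ} (hk : k ∈ E i j) : i ≤ k := by
  induction i generalizing k with
  | zero => exact Nat.zero_le _
  | succ i ih =>
    obtain ⟨c, hc⟩ := h.nonempty (lam.up_left_mem (Nat.le_succ i) le_rfl (h.mem_shape hk))
    have := ih hc
    have := h.col_strict (h.mem_shape hk) c hc k hk
    omega

end IsTableau

/-- The number of boxes of `lam` that contain the letter `k`. -/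
def cnt (lam : YoungDiagram) (E : Filling) (k : ℕ) : ℕ :=
  (lam.cells.filter fun c => k ∈ E c.1 c.2).card

/-- The number of boxes containing the letter `k` that are read strictly after the box `(r, j)`
in the row reading word: the boxes in higher rows, and those to the right in row `r`. -/
def cntAfter (lam : YoungDiagram) (E : Filling) (r j k : ℕ) : ℕ :=
  (lam.cells.filter fun c => k ∈ E c.1 c.2 ∧ (c.1 < r ∨ c.1 = r ∧ j < c.2)).card

theorem finite_tableaux (lam : YoungDiagram) (n : ℕ) :
    {E : Filling | IsTableau lam E ∧ ∀ i j, ∀ k ∈ E i j, k < n}.Finite := by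
  let F : {E : Filling | IsTableau lam E ∧ ∀ i j, ∀ k ∈ E i j, k < n} →
      (lam.cells → (Finset.range n).powerset) := fun E c =>
    ⟨E.1 c.1.1 c.1.2, by
      rw [Finset.mem_powerset]
      intro k hk
      exact Finset.mem_range.2 (E.2.2 _ _ k hk)⟩
  have hF : Function.Injective F := by
    rintro ⟨E, hE, hE'⟩ ⟨E₂, hE₂, hE₂'⟩ h
    refine Subtype.ext (funext fun i => funext fun j => ?_)
    by_cases hij : (i, j) ∈ lam
    · exact congrArg Subtype.val (congrFun h ⟨(i, j), hij⟩)
    · exact (hE.outside hij).trans (hE₂.outside hij).symm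
  exact Set.finite_coe_iff.1 (Finite.of_injective F hF)

/-- The finite set of all set-valued tableaux of shape `lam` with letters less than `n`. -/
noncomputable def tabs (lam : YoungDiagram) (n : ℕ) : Finset Filling :=
  (finite_tableaux lam n).toFinset

theorem mem_tabs {lam : YoungDiagram} {n : ℕ} {E : Filling} :
    E ∈ tabs lam n ↔ IsTableau lam E ∧ ∀ i j, ∀ k ∈ E i j, k < n := by
  simp [tabs]

/-! ### Reversal of an interval of natural numbers -/

/-- The reversal `j ↦ min s + max s - j` of a finite set `s` of natural numbers; it preserves `s`
when `s` is an interval. -/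
noncomputable def reflect (s : Finset ℕ) (j : ℕ) : ℕ := sInf (s : Set ℕ) + s.sup id - j

theorem sInf_le_of_mem {s : Finset ℕ} {j : ℕ} (hj : j ∈ s) : sInf (s : Set ℕ) ≤ j :=
  Nat.sInf_le (Finset.mem_coe.2 hj)

theorem le_sup_of_mem {s : Finset ℕ} {j : ℕ} (hj : j ∈ s) : j ≤ s.sup id :=
  Finset.le_sup (f := id) hj

theorem reflect_mem {s : Finset ℕ} (hs : ∀ a ∈ s, ∀ c ∈ s, ∀ b, a < b → b < c → b ∈ s) {j : ℕ}
    (hj : j ∈ s) : reflect s j ∈ s := by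
  have h1 : sInf (s : Set ℕ) ∈ s := Finset.mem_coe.1 (Nat.sInf_mem ⟨j, hj⟩)
  have h2 : s.sup id ∈ s := by
    obtain ⟨x, hx, hx'⟩ := Finset.exists_mem_eq_sup s ⟨j, hj⟩ id
    rw [hx']; exact hx
  have h3 := sInf_le_of_mem hj
  have h4 := le_sup_of_mem hj
  unfold reflect
  rcases Nat.eq_or_lt_of_le h3 with h | h
  · rwa [h, Nat.add_sub_cancel_left]
  rcases Nat.eq_or_lt_of_le h4 with h' | h'
  · rw [← h', Nat.add_sub_cancel_right]; exact h1
  · exact hs _ h1 _ h2 _ (by omega) (by omega)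

theorem reflect_reflect {s : Finset ℕ} {j : ℕ} (hj : j ∈ s) : reflect s (reflect s j) = j := by
  have h3 := sInf_le_of_mem hj
  have h4 := le_sup_of_mem hj
  unfold reflect
  omega

theorem reflect_lt {s : Finset ℕ} {j j' : ℕ} (hj : j ∈ s) (hj' : j' ∈ s) (h : j < j') :
    reflect s j' < reflect s j := by
  have h3 := sInf_le_of_mem hj
  have h4 := le_sup_of_mem hj'
  unfold reflect
  omega

/-! ### A Bender-Knuth involution for set-valued tableaux -/

/-- The box `(i, j)` of `E` contains `v` or `v + 1`. -/
def Active (E : Filling) (v i j : ℕ) : Prop := v ∈ E i j ∨ v + 1 ∈ E i j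

/-- The box `(i, j)` contains `v` or `v + 1`, but its upper and lower neighbours do not. -/
def Free (E : Filling) (v i j : ℕ) : Prop :=
  Active E v i j ∧ ¬ Active E v (i + 1) j ∧ ∀ i', i = i' + 1 → ¬ Active E v i' j

/-- The boxes that come before the box `(r, c)` in the row reading order. -/
def Before (r c i j : ℕ) : Prop := r < i ∨ i = r ∧ j < c

open Classical in
/-- The columns of the free boxes in row `i` before `(r, c)`. -/
noncomputable def run (lam : YoungDiagram) (v r c : ℕ) (E : Filling) (i : ℕ) : Finset ℕ :=
  (Finset.range (lam.rowLen i)).filter fun j => Free E v i j ∧ Before r c i j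

open Classical in
/-- The Bender-Knuth involution for the letters `v` and `v + 1`, applied to the part of `E` before
the box `(r, c)`: in each row, the sequence of the intersections of the free boxes with
`{v, v + 1}` is reversed, and `v` and `v + 1` are exchanged in it. -/
noncomputable def bk (lam : YoungDiagram) (v r c : ℕ) (E : Filling) : Filling := fun i j =>
  if j ∈ run lam v r c E i then
    ((E i j).filter fun k => k ≠ v ∧ k ≠ v + 1) ∪
      ((E i (reflect (run lam v r c E i) j)).filter fun k => k = v ∨ k = v + 1).image
        (Equiv.swap v (v + 1))
  else E i j

section BenderKnuth

variable {lam : YoungDiagram} {v r c : ℕ} {E : Filling}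

theorem mem_run (h : IsTableau lam E) {i j : ℕ} :
    j ∈ run lam v r c E i ↔ Free E v i j ∧ Before r c i j := by
  classical
  simp only [run, Finset.mem_filter, Finset.mem_range, and_iff_right_iff_imp]
  rintro ⟨⟨hf | hf, -⟩, -⟩ <;> exact YoungDiagram.mem_iff_lt_rowLen.1 (h.mem_shape hf)

theorem bk_of_notMem {i j : ℕ} (hj : j ∉ run lam v r c E i) :
    bk lam v r c E i j = E i j := by
  classical
  simp [bk, hj]

theorem mem_bk {i j k : ℕ} (hj : j ∈ run lam v r c E i) :
    k ∈ bk lam v r c E i j ↔ (k ≠ v ∧ k ≠ v + 1 ∧ k ∈ E i j) ∨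
      (k = v ∧ v + 1 ∈ E i (reflect (run lam v r c E i) j)) ∨
      (k = v + 1 ∧ v ∈ E i (reflect (run lam v r c E i) j)) := by
  classical
  simp only [bk, hj, if_true, Finset.mem_union, Finset.mem_filter, Finset.mem_image]
  constructor
  · rintro (⟨h1, h2, h3⟩ | ⟨m, ⟨hm, rfl | rfl⟩, rfl⟩)
    · exact Or.inl ⟨h2, h3, h1⟩
    · rw [Equiv.swap_apply_left]; exact Or.inr (Or.inr ⟨rfl, hm⟩)
    · rw [Equiv.swap_apply_right]; exact Or.inr (Or.inl ⟨rfl, hm⟩)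
  · rintro (⟨h1, h2, h3⟩ | ⟨rfl, h⟩ | ⟨rfl, h⟩)
    · exact Or.inl ⟨h3, h1, h2⟩
    · exact Or.inr ⟨_, ⟨h, Or.inr rfl⟩, Equiv.swap_apply_right _ _⟩
    · exact Or.inr ⟨_, ⟨h, Or.inl rfl⟩, Equiv.swap_apply_left _ _⟩

theorem mem_bk_of_ne {i j k : ℕ} (h1 : k ≠ v) (h2 : k ≠ v + 1) :
    k ∈ bk lam v r c E i j ↔ k ∈ E i j := by
  by_cases hj : j ∈ run lam v r c E i
  · rw [mem_bk hj]
    tauto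
  · rw [bk_of_notMem hj]

theorem left_mem_bk {i j : ℕ} (hj : j ∈ run lam v r c E i) :
    v ∈ bk lam v r c E i j ↔ v + 1 ∈ E i (reflect (run lam v r c E i) j) := by
  rw [mem_bk hj]; simp

theorem right_mem_bk {i j : ℕ} (hj : j ∈ run lam v r c E i) :
    v + 1 ∈ bk lam v r c E i j ↔ v ∈ E i (reflect (run lam v r c E i) j) := by
  rw [mem_bk hj]; simp

theorem bk_of_not_before (h : IsTableau lam E) {i j : ℕ} (hb : ¬ Before r c i j) :
    bk lam v r c E i j = E i j :=
  bk_of_notMem fun hj => hb ((mem_run h).1 hj).2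

/-- If the box below an active box is active, the same holds for the active boxes further left in
the row. -/
theorem Active.below_of_left (h : IsTableau lam E) {i j j' : ℕ} (hjj : j' < j)
    (h2 : Active E v (i + 1) j) (h3 : Active E v i j') :
    Active E v (i + 1) j' := by
  have hmem : (i + 1, j) ∈ lam := h2.elim h.mem_shape h.mem_shape
  obtain ⟨e, he⟩ := h.nonempty (lam.up_left_mem le_rfl hjj.le hmem)
  have e1 : e ≤ v + 1 := by
    rcases h2 with h2 | h2 <;> have := h.row_le hjj he h2 <;> omega
  have e2 : v < e := by
    rcases h3 with h3 | h3 <;> have := h.col_lt (Nat.lt_succ_self i) h3 he <;> omega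
  right
  rwa [show v + 1 = e by omega]

/-- If the box above an active box is active, the same holds for the active boxes further right in
the row. -/
theorem Active.above_of_right (h : IsTableau lam E) {i j j' : ℕ} (hjj : j < j')
    (h2 : Active E v i j) (h3 : Active E v (i + 1) j') :
    Active E v i j' := by
  have hmem : (i + 1, j') ∈ lam := h3.elim h.mem_shape h.mem_shape
  obtain ⟨e, he⟩ := h.nonempty (lam.up_left_mem (Nat.le_succ i) le_rfl hmem)
  have e1 : v ≤ e := by
    rcases h2 with h2 | h2 <;> have := h.row_le hjj h2 he <;> omega
  have e2 : e < v + 1 := by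
    rcases h3 with h3 | h3 <;> have := h.col_lt (Nat.lt_succ_self i) he h3 <;> omega
  left
  rwa [show v = e by omega]

theorem run_convex (h : IsTableau lam E) {i : ℕ} :
    ∀ a ∈ run lam v r c E i, ∀ d ∈ run lam v r c E i, ∀ b, a < b → b < d →
      b ∈ run lam v r c E i := by
  intro a ha d hd b hab hbd
  rw [mem_run h] at ha hd ⊢
  obtain ⟨⟨ha1, ha2, ha3⟩, hab'⟩ := ha
  obtain ⟨⟨hd1, hd2, hd3⟩, hdb⟩ := hd
  have hmem : (i, d) ∈ lam := hd1.elim h.mem_shape h.mem_shape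
  have hact : Active E v i b := by
    obtain ⟨e, he⟩ := h.nonempty (lam.up_left_mem le_rfl hbd.le hmem)
    have e1 : v ≤ e := by
      rcases ha1 with h1 | h1 <;> have := h.row_le hab h1 he <;> omega
    have e2 : e ≤ v + 1 := by
      rcases hd1 with h1 | h1 <;> have := h.row_le hbd he h1 <;> omega
    rcases Nat.eq_or_lt_of_le e1 with rfl | e3
    · exact Or.inl he
    · right; rwa [show v + 1 = e by omega]
  refine ⟨⟨hact, fun hb => ha2 (Active.below_of_left h hab hb ha1), ?_⟩, ?_⟩
  · rintro i' rfl hb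
    exact hd3 i' rfl (Active.above_of_right h hbd hb hd1)
  · rcases hdb with hdb | hdb
    · exact Or.inl hdb
    · exact Or.inr ⟨hdb.1, hbd.trans hdb.2⟩

theorem reflect_run_mem (h : IsTableau lam E) {i j : ℕ} (hj : j ∈ run lam v r c E i) :
    reflect (run lam v r c E i) j ∈ run lam v r c E i :=
  reflect_mem (run_convex h) hj

theorem active_bk (h : IsTableau lam E) {i j : ℕ} :
    Active (bk lam v r c E) v i j ↔ Active E v i j := by
  by_cases hj : j ∈ run lam v r c E i
  · have h1 := ((mem_run h).1 hj).1.1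
    have h2 := ((mem_run h).1 (reflect_run_mem h hj)).1.1
    refine iff_of_true ?_ h1
    rw [Active, left_mem_bk hj, right_mem_bk hj]
    exact h2.symm
  · rw [Active, Active, bk_of_notMem hj]

theorem run_bk (h : IsTableau lam E) (i : ℕ) :
    run lam v r c (bk lam v r c E) i = run lam v r c E i := by
  classical
  unfold run
  refine Finset.filter_congr fun j _ => ?_
  simp only [Free, active_bk h]

theorem bk_bk (h : IsTableau lam E) : bk lam v r c (bk lam v r c E) = E := by
  funext i j
  by_cases hj : j ∈ run lam v r c E i
  · have hj' : j ∈ run lam v r c (bk lam v r c E) i := by rwa [run_bk h]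
    have hf := reflect_run_mem h hj
    ext k
    by_cases h1 : k = v
    · subst h1
      rw [left_mem_bk hj', run_bk h, right_mem_bk hf, reflect_reflect hj]
    by_cases h2 : k = v + 1
    · subst h2
      rw [right_mem_bk hj', run_bk h, left_mem_bk hf, reflect_reflect hj]
    rw [mem_bk_of_ne h1 h2, mem_bk_of_ne h1 h2]
  · rw [bk_of_notMem (by rwa [run_bk h]), bk_of_notMem hj]

theorem bk_nonempty (h : IsTableau lam E) {i j : ℕ} (hij : (i, j) ∈ lam) :
    (bk lam v r c E i j).Nonempty := by
  obtain ⟨k, hk⟩ := h.nonempty hij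
  by_cases h1 : k = v ∨ k = v + 1
  · have : Active E v i j := by rcases h1 with rfl | rfl <;> [exact Or.inl hk; exact Or.inr hk]
    rcases (active_bk h).2 this with h2 | h2 <;> exact ⟨_, h2⟩
  · push Not at h1
    exact ⟨k, (mem_bk_of_ne h1.1 h1.2).2 hk⟩

theorem exists_mem_of_mem_bk {i j k : ℕ} (hk : k ∈ bk lam v r c E i j) :
    k ∈ E i j ∨ (k = v ∨ k = v + 1) ∧ j ∈ run lam v r c E i := by
  by_cases hj : j ∈ run lam v r c E i
  · rw [mem_bk hj] at hk
    tauto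
  · rw [bk_of_notMem hj] at hk
    exact Or.inl hk

theorem bk_isTableau (h : IsTableau lam E) (hcut : ∀ j, c ≤ j → v ∉ E r j) :
    IsTableau lam (bk lam v r c E) := by
  refine ⟨fun hij => bk_nonempty h hij, ?_, ?_, ?_⟩
  · intro i j hmem a ha b hb
    have hmem' : (i, j) ∈ lam := lam.up_left_mem le_rfl (Nat.le_succ j) hmem
    by_cases hj : j ∈ run lam v r c E i <;> by_cases hj' : j + 1 ∈ run lam v r c E i
    · have hlt := reflect_lt hj hj' (Nat.lt_succ_self j)
      rw [mem_bk hj] at ha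
      rw [mem_bk hj'] at hb
      have h1 := ((mem_run h).1 hj).1.1
      have h2 := ((mem_run h).1 hj').1.1
      rcases ha with ⟨a1, a2, ha⟩ | ⟨rfl, ha⟩ | ⟨rfl, ha⟩
      · have : a ≤ v + 1 := by
          rcases h2 with h2 | h2 <;> have := h.row_weak hmem a ha _ h2 <;> omega
        rcases hb with ⟨b1, b2, hb⟩ | ⟨rfl, hb⟩ | ⟨rfl, hb⟩
        · exact h.row_weak hmem a ha b hb
        · omega
        · omega
      · rcases hb with ⟨b1, b2, hb⟩ | ⟨rfl, hb⟩ | ⟨rfl, hb⟩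
        · rcases h1 with h1 | h1 <;> have := h.row_weak hmem _ h1 b hb <;> omega
        · omega
        · omega
      · rcases hb with ⟨b1, b2, hb⟩ | ⟨rfl, hb⟩ | ⟨rfl, hb⟩
        · rcases h1 with h1 | h1 <;> have := h.row_weak hmem _ h1 b hb <;> omega
        · have := h.row_le hlt hb ha
          omega
        · omega
    · rw [mem_bk hj] at ha
      rw [bk_of_notMem hj'] at hb
      obtain ⟨hfr, hbef⟩ := (mem_run h).1 hj
      have h1 := hfr.1
      rcases ha with ⟨a1, a2, ha⟩ | ⟨rfl, ha⟩ | ⟨rfl, ha⟩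
      · exact h.row_weak hmem a ha b hb
      · rcases h1 with h1 | h1 <;> have := h.row_weak hmem _ h1 b hb <;> omega
      · have hvb : v ≤ b := by
          rcases h1 with h1 | h1 <;> have := h.row_weak hmem _ h1 b hb <;> omega
        by_contra hlt
        obtain rfl : b = v := by omega
        by_cases hbef' : Before r c i (j + 1)
        · refine hj' ((mem_run h).2 ⟨⟨Or.inl hb, fun hB => ?_, ?_⟩, hbef'⟩)
          · exact hfr.2.1 (Active.below_of_left h (Nat.lt_succ_self j) hB h1)
          · rintro i' rfl hA
            rcases hA with hA | hA <;> have := h.col_lt (Nat.lt_succ_self i') hA hb <;> omega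
        · have hi : i = r ∧ c ≤ j + 1 := by
            unfold Before at hbef hbef'
            omega
          obtain ⟨rfl, hc⟩ := hi
          exact hcut _ hc hb
    · rw [bk_of_notMem hj] at ha
      rw [mem_bk hj'] at hb
      obtain ⟨hfr, hbef⟩ := (mem_run h).1 hj'
      have h1 := hfr.1
      rcases hb with ⟨b1, b2, hb⟩ | ⟨rfl, hb⟩ | ⟨rfl, hb⟩
      · exact h.row_weak hmem a ha b hb
      · have hvb : a ≤ b + 1 := by
          rcases h1 with h1 | h1 <;> have := h.row_weak hmem _ ha _ h1 <;> omega
        by_contra hlt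
        obtain rfl : a = b + 1 := by omega
        refine hj ((mem_run h).2 ⟨⟨Or.inr ha, fun hB => ?_, ?_⟩, ?_⟩)
        · rcases hB with hA | hA <;> have := h.col_lt (Nat.lt_succ_self i) ha hA <;> omega
        · rintro i' rfl hA
          exact hfr.2.2 i' rfl (Active.above_of_right h (Nat.lt_succ_self j) hA h1)
        · unfold Before at hbef ⊢
          omega
      · rcases h1 with h1 | h1 <;> have := h.row_weak hmem _ ha _ h1 <;> omega
    · rw [bk_of_notMem hj] at ha
      rw [bk_of_notMem hj'] at hb
      exact h.row_weak hmem a ha b hb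
  · intro i j hmem a ha b hb
    rcases exists_mem_of_mem_bk ha with ha | ⟨ha, hj⟩
    · rcases exists_mem_of_mem_bk hb with hb | ⟨hb, hj'⟩
      · exact h.col_strict hmem a ha b hb
      · obtain ⟨⟨h1, -, h2⟩, -⟩ := (mem_run h).1 hj'
        have h3 := h2 i rfl
        have h4 : a ≠ v := fun hh => h3 (Or.inl (hh ▸ ha))
        rcases h1 with h1 | h1 <;> have := h.col_strict hmem a ha _ h1 <;> omega
    · obtain ⟨⟨h1, h2, -⟩, -⟩ := (mem_run h).1 hj
      have hb' : b ∈ E (i + 1) j := by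
        rcases exists_mem_of_mem_bk hb with hb | ⟨hb, hj'⟩
        · exact hb
        · exact absurd ((mem_run h).1 hj').1.1 h2
      have h4 : b ≠ v + 1 := fun hh => h2 (Or.inr (hh ▸ hb'))
      rcases h1 with h1 | h1 <;> have := h.col_strict hmem _ h1 b hb' <;> omega
  · intro i j hij
    rw [bk_of_notMem, h.outside hij]
    intro hj
    rcases ((mem_run h).1 hj).1.1 with h1 | h1 <;> exact hij (h.mem_shape h1)

end BenderKnuth

open Classical in
/-- The number of boxes before `(r, c)` in the row reading order that contain the letter `k`. -/
noncomputable def cntBefore (lam : YoungDiagram) (E : Filling) (r c k : ℕ) : ℕ :=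
  (lam.cells.filter fun x => k ∈ E x.1 x.2 ∧ Before r c x.1 x.2).card

open Classical in
/-- The number of boxes not before `(r, c)` in the row reading order that contain the
letter `k`. -/
noncomputable def cntFrom (lam : YoungDiagram) (E : Filling) (r c k : ℕ) : ℕ :=
  (lam.cells.filter fun x => k ∈ E x.1 x.2 ∧ ¬ Before r c x.1 x.2).card

theorem cnt_eq_add (lam : YoungDiagram) (E : Filling) (r c k : ℕ) :
    cnt lam E k = cntBefore lam E r c k + cntFrom lam E r c k := by
  classical
  rw [cnt, cntBefore, cntFrom, ← Finset.filter_filter, ← Finset.filter_filter,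
    Finset.card_filter_add_card_filter_not]

section BenderKnuth

variable {lam : YoungDiagram} {v r c : ℕ} {E : Filling}

theorem not_free_left (h : IsTableau lam E) {i j : ℕ} (hj : j ∉ run lam v r c E i)
    (hb : Before r c i j) (hv : v ∈ E i j) : v + 1 ∈ E (i + 1) j := by
  by_contra hc
  refine hj ((mem_run h).2 ⟨⟨Or.inl hv, ?_, ?_⟩, hb⟩)
  · rintro (hA | hA)
    · exact absurd (h.col_lt (Nat.lt_succ_self i) hv hA) (lt_irrefl _)
    · exact hc hA
  · rintro i' rfl (hA | hA) <;> have := h.col_lt (Nat.lt_succ_self i') hA hv <;> omega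

theorem not_free_right (h : IsTableau lam E) {i j : ℕ} (hj : j ∉ run lam v r c E i)
    (hb : Before r c i j) (hv : v + 1 ∈ E i j) : ∃ i', i = i' + 1 ∧ v ∈ E i' j := by
  by_contra! hc
  refine hj ((mem_run h).2 ⟨⟨Or.inr hv, ?_, ?_⟩, hb⟩)
  · rintro (hA | hA) <;> have := h.col_lt (Nat.lt_succ_self i) hv hA <;> omega
  · rintro i' rfl (hA | hA)
    · exact hc i' rfl hA
    · exact absurd (h.col_lt (Nat.lt_succ_self i') hA hv) (lt_irrefl _)

theorem before_of_before_succ (hcut : ∀ j, c ≤ j → v ∉ E r j)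
    (habove : ∀ i', r = i' + 1 → ∀ j < c, ∀ a ∈ E i' j, a < v) {i j : ℕ}
    (hb : Before r c (i + 1) j) (hv : v ∈ E i j) : Before r c i j := by
  rcases hb with hb | ⟨rfl, hb⟩
  · by_contra hc
    obtain ⟨rfl, hj⟩ : i = r ∧ c ≤ j := by
      unfold Before at hc
      omega
    exact hcut j hj hv
  · exact absurd (habove i rfl j hb v hv) (lt_irrefl _)

theorem cntBefore_bk_left (h : IsTableau lam E) (hcut : ∀ j, c ≤ j → v ∉ E r j)
    (habove : ∀ i', r = i' + 1 → ∀ j < c, ∀ a ∈ E i' j, a < v) :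
    cntBefore lam (bk lam v r c E) r c v = cntBefore lam E r c (v + 1) := by
  classical
  unfold cntBefore
  -- A box of `bk E` containing `v` corresponds to its mirror image if it is free, and to the box
  -- below it otherwise.
  have before_reflect : ∀ {i j}, j ∈ run lam v r c E i →
      Before r c i (reflect (run lam v r c E i) j) := fun hj =>
    ((mem_run h).1 (reflect_run_mem h hj)).2
  refine Finset.card_bij' 
    (fun x _ => if x.2 ∈ run lam v r c E x.1 then (x.1, reflect (run lam v r c E x.1) x.2)
      else (x.1 + 1, x.2))
    (fun x _ => if x.2 ∈ run lam v r c E x.1 then (x.1, reflect (run lam v r c E x.1) x.2)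
      else (x.1 - 1, x.2)) ?_ ?_ ?_ ?_
  · rintro ⟨i, j⟩ hx
    obtain ⟨-, hv, hb⟩ := Finset.mem_filter.1 hx
    simp only at hv hb
    by_cases hj : j ∈ run lam v r c E i
    · rw [left_mem_bk hj] at hv
      simp only [hj, if_true]
      exact Finset.mem_filter.2 ⟨h.mem_shape hv, hv, before_reflect hj⟩
    · rw [bk_of_notMem hj] at hv
      simp only [hj, if_false]
      have := not_free_left h hj hb hv
      refine Finset.mem_filter.2 ⟨h.mem_shape this, this, ?_⟩
      simp only [Before] at hb ⊢
      omega
  · rintro ⟨i, j⟩ hx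
    obtain ⟨-, hv, hb⟩ := Finset.mem_filter.1 hx
    simp only at hv hb
    by_cases hj : j ∈ run lam v r c E i
    · have hf := reflect_run_mem h hj
      have hv' : v ∈ bk lam v r c E i (reflect (run lam v r c E i) j) := by
        rwa [left_mem_bk hf, reflect_reflect hj]
      simp only [hj, if_true]
      exact Finset.mem_filter.2
        ⟨((mem_run h).1 hf).1.1.elim h.mem_shape h.mem_shape, hv', before_reflect hj⟩
    · obtain ⟨i', rfl, hi'⟩ := not_free_right h hj hb hv
      simp only [hj, if_false, Nat.add_sub_cancel]
      have hb' := before_of_before_succ hcut habove hb hi'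
      have hj' : j ∉ run lam v r c E i' := fun hc => ((mem_run h).1 hc).1.2.1 (Or.inr hv)
      exact Finset.mem_filter.2 ⟨h.mem_shape hi', by simpa only [bk_of_notMem hj'] using hi', hb'⟩
  · rintro ⟨i, j⟩ hx
    obtain ⟨-, hv, hb⟩ := Finset.mem_filter.1 hx
    simp only at hv hb
    by_cases hj : j ∈ run lam v r c E i
    · simp only [hj, if_true, reflect_run_mem h hj, reflect_reflect hj]
    · rw [bk_of_notMem hj] at hv
      have := not_free_left h hj hb hv
      have hj' : j ∉ run lam v r c E (i + 1) := fun hc =>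
        ((mem_run h).1 hc).1.2.2 i rfl (Or.inl hv)
      simp only [hj, hj', if_false, Nat.add_sub_cancel]
  · rintro ⟨i, j⟩ hx
    obtain ⟨-, hv, hb⟩ := Finset.mem_filter.1 hx
    simp only at hv hb
    by_cases hj : j ∈ run lam v r c E i
    · simp only [hj, if_true, reflect_run_mem h hj, reflect_reflect hj]
    · obtain ⟨i', rfl, hi'⟩ := not_free_right h hj hb hv
      have hj' : j ∉ run lam v r c E i' := fun hc => ((mem_run h).1 hc).1.2.1 (Or.inr hv)
      simp only [hj, hj', if_false, Nat.add_sub_cancel]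

theorem cntBefore_bk_right (h : IsTableau lam E) (hcut : ∀ j, c ≤ j → v ∉ E r j)
    (habove : ∀ i', r = i' + 1 → ∀ j < c, ∀ a ∈ E i' j, a < v) :
    cntBefore lam (bk lam v r c E) r c (v + 1) = cntBefore lam E r c v := by
  have h1 : ∀ j, c ≤ j → v ∉ bk lam v r c E r j := fun j hj ha => by
    rw [bk_of_not_before h (by unfold Before; omega)] at ha
    exact hcut j hj ha
  have h2 : ∀ i', r = i' + 1 → ∀ j < c, ∀ a ∈ bk lam v r c E i' j, a < v :=
    fun i' hi' j hj a ha => by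
      rw [bk_of_not_before h (by unfold Before; omega)] at ha
      exact habove i' hi' j hj a ha
  have := cntBefore_bk_left (bk_isTableau h hcut) h1 h2
  rw [bk_bk h] at this
  exact this.symm

theorem cntBefore_bk_of_ne {k : ℕ} (h1 : k ≠ v) (h2 : k ≠ v + 1) :
    cntBefore lam (bk lam v r c E) r c k = cntBefore lam E r c k := by
  classical
  unfold cntBefore
  simp only [mem_bk_of_ne h1 h2]

theorem cntFrom_congr {E' : Filling} {r c k : ℕ}
    (hE : ∀ i j, ¬ Before r c i j → (k ∈ E' i j ↔ k ∈ E i j)) :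
    cntFrom lam E' r c k = cntFrom lam E r c k := by
  classical
  unfold cntFrom
  congr 1
  refine Finset.filter_congr fun x _ => ?_
  constructor
  · exact fun hx => ⟨(hE _ _ hx.2).1 hx.1, hx.2⟩
  · exact fun hx => ⟨(hE _ _ hx.2).2 hx.1, hx.2⟩

theorem cntFrom_bk (h : IsTableau lam E) (k : ℕ) :
    cntFrom lam (bk lam v r c E) r c k = cntFrom lam E r c k :=
  cntFrom_congr fun _ _ hb => by rw [bk_of_not_before h hb]

/-- If `v` and `v + 1` complement each other in the part of the tableau that is left fixed, the
Bender-Knuth involution permutes the total weight by the transposition of `v` and `v + 1`. -/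
theorem cnt_bk_add (h : IsTableau lam E) (hcut : ∀ j, c ≤ j → v ∉ E r j)
    (habove : ∀ i', r = i' + 1 → ∀ j < c, ∀ a ∈ E i' j, a < v) (f : ℕ → ℕ)
    (hf : cntFrom lam E r c v + f v = cntFrom lam E r c (v + 1) + f (v + 1)) (k : ℕ) :
    cnt lam (bk lam v r c E) k + f k =
      cnt lam E (Equiv.swap v (v + 1) k) + f (Equiv.swap v (v + 1) k) := by
  simp only [cnt_eq_add lam _ r c, cntFrom_bk h]
  by_cases h1 : k = v
  · subst h1
    rw [cntBefore_bk_left h hcut habove, Equiv.swap_apply_left]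
    omega
  by_cases h2 : k = v + 1
  · subst h2
    rw [cntBefore_bk_right h hcut habove, Equiv.swap_apply_right]
    omega
  rw [Equiv.swap_apply_of_ne_of_ne h1 h2, cntBefore_bk_of_ne h1 h2]

end BenderKnuth

/-! ### Lattice tableaux and the first violation of the lattice condition -/

/-- The lattice condition for an occurrence of the letter `v + 1` in the box `(r, j)`, in the row
reading word followed by the word `u(mu)`: the letters after it include more `v` than `v + 1`. -/
def LatticeAt (lam mu : YoungDiagram) (E : Filling) (r j v : ℕ) : Prop :=
  mu.rowLen (v + 1) + cntAfter lam E r j (v + 1) < mu.rowLen v + cntAfter lam E r j v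

/-- The row reading word of `E`, followed by `u(mu)`, is a reverse lattice word. -/
def IsLattice (lam mu : YoungDiagram) (E : Filling) : Prop :=
  ∀ r j v, v + 1 ∈ E r j → LatticeAt lam mu E r j v

/-- The occurrence of the letter `v' + 1` in the box `(r', j')` is read after that of `v + 1` in
the box `(r, j)`. -/
def LaterThan (r j v r' j' v' : ℕ) : Prop :=
  (r' < r ∨ r' = r ∧ j < j') ∨ r' = r ∧ j' = j ∧ v < v'

/-- The letter `v + 1` in the box `(r, j)` is the last one in the word that violates the lattice
condition. -/
def IsViolation (lam mu : YoungDiagram) (E : Filling) (t : ℕ × ℕ × ℕ) : Prop :=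
  t.2.2 + 1 ∈ E t.1 t.2.1 ∧ ¬ LatticeAt lam mu E t.1 t.2.1 t.2.2 ∧
    ∀ r' j' v', LaterThan t.1 t.2.1 t.2.2 r' j' v' → v' + 1 ∈ E r' j' →
      LatticeAt lam mu E r' j' v'

section Violation

variable {lam mu : YoungDiagram} {E E' : Filling} {r j v : ℕ}

theorem IsViolation.unique {t t' : ℕ × ℕ × ℕ} (h : IsViolation lam mu E t)
    (h' : IsViolation lam mu E t') : t = t' := by
  obtain ⟨r, j, v⟩ := t
  obtain ⟨r', j', v'⟩ := t'
  by_contra hne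
  have : LaterThan r j v r' j' v' ∨ LaterThan r' j' v' r j v := by
    simp only [Prod.mk.injEq] at hne
    unfold LaterThan
    omega
  rcases this with h1 | h1
  · exact h'.2.1 (h.2.2 _ _ _ h1 h'.1)
  · exact h.2.1 (h'.2.2 _ _ _ h1 h.1)

theorem exists_violation (h : IsTableau lam E) (hE : ¬ IsLattice lam mu E) :
    ∃ t, IsViolation lam mu E t := by
  classical
  set S : Set (ℕ ×ₗ (ℕ ×ₗ ℕ)ᵒᵈ) := {x | ∃ r j v, x = toLex (r, OrderDual.toDual (toLex (j, v))) ∧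
    v + 1 ∈ E r j ∧ ¬ LatticeAt lam mu E r j v} with hS
  have hfin : S.Finite := by
    refine Set.Finite.subset (Finset.finite_toSet (lam.cells.biUnion fun c =>
      (E c.1 c.2).image fun v => toLex (c.1, OrderDual.toDual (toLex (c.2, v - 1))))) ?_
    rintro x ⟨r, j, v, rfl, h1, -⟩
    simp only [Finset.coe_biUnion, Set.mem_iUnion, Finset.mem_coe, Finset.mem_image]
    exact ⟨(r, j), h.mem_shape h1, v + 1, h1, by simp⟩
  have hne : S.Nonempty := by
    unfold IsLattice at hE
    push Not at hE
    obtain ⟨r, j, v, h1, h2⟩ := hE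
    exact ⟨_, r, j, v, rfl, h1, h2⟩
  obtain ⟨x, ⟨r, j, v, rfl, h1, h2⟩, hx⟩ := Set.exists_min_image S id hfin hne
  refine ⟨(r, j, v), h1, h2, ?_⟩
  intro r' j' v' hlt hv'
  by_contra hc
  have := hx _ ⟨r', j', v', rfl, hv', hc⟩
  simp only [id, Prod.Lex.toLex_le_toLex, OrderDual.toDual_le_toDual] at this
  simp only [LaterThan] at hlt
  omega

theorem cntAfter_congr {k : ℕ} (hE : ∀ i' j', i' < r ∨ i' = r ∧ j < j' → E' i' j' = E i' j') :
    cntAfter lam E' r j k = cntAfter lam E r j k := by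
  unfold cntAfter
  congr 1
  refine Finset.filter_congr fun x _ => ?_
  constructor <;> rintro ⟨h1, h2⟩
  · exact ⟨by rwa [hE _ _ h2] at h1, h2⟩
  · exact ⟨by rwa [hE _ _ h2], h2⟩

/-- A violation only depends on the part of the tableau that is read from there on. -/
theorem IsViolation.congr (h : IsViolation lam mu E (r, j, v))
    (hE : ∀ i' j', i' < r ∨ i' = r ∧ j < j' → E' i' j' = E i' j')
    (hE' : ∀ k, v < k → (k ∈ E' r j ↔ k ∈ E r j)) : IsViolation lam mu E' (r, j, v) := by
  obtain ⟨h1, h2, h3⟩ := h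
  simp only at h1 h2 h3
  have hlat : ∀ {v}, LatticeAt lam mu E' r j v ↔ LatticeAt lam mu E r j v := by
    intro v
    simp only [LatticeAt, cntAfter_congr hE]
  refine ⟨(hE' _ (Nat.lt_succ_self v)).2 h1, fun hc => h2 (hlat.1 hc), ?_⟩
  intro r' j' v' hl hv'
  simp only at hl
  rcases hl with hl | ⟨rfl, rfl, hl⟩
  · have hE₂ : ∀ i'' j'', i'' < r' ∨ i'' = r' ∧ j' < j'' → E' i'' j'' = E i'' j'' :=
      fun i'' j'' hlt => hE i'' j'' (by omega)
    have := h3 r' j' v' (Or.inl hl) (by rwa [hE r' j' hl] at hv')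
    simpa only [LatticeAt, cntAfter_congr hE₂] using this
  · exact hlat.2 (h3 _ _ _ (Or.inr ⟨rfl, rfl, hl⟩) ((hE' _ (by omega)).1 hv'))

/-- If the lattice condition holds for all `v + 1` after the box `(r, j)`, then the part of the
word after this box has at least as many `v` as `v + 1`. -/
theorem balance (hE : ∀ r' j', r' < r ∨ r' = r ∧ j < j' → v + 1 ∈ E r' j' →
      LatticeAt lam mu E r' j' v) :
    mu.rowLen (v + 1) + cntAfter lam E r j (v + 1) ≤ mu.rowLen v + cntAfter lam E r j v := by
  set s := lam.cells.filter fun c => v + 1 ∈ E c.1 c.2 ∧ (c.1 < r ∨ c.1 = r ∧ j < c.2) with hs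
  rcases s.eq_empty_or_nonempty with h0 | hne
  · have h1 : cntAfter lam E r j (v + 1) = 0 := by
      rw [cntAfter, ← hs, h0, Finset.card_empty]
    have := mu.rowLen_anti v (v + 1) (Nat.le_succ v)
    omega
  · obtain ⟨x, hx, hmax⟩ := Finset.exists_max_image s
      (fun c => (toLex (c.1, OrderDual.toDual c.2) : ℕ ×ₗ ℕᵒᵈ)) hne
    obtain ⟨-, hx1, hx2⟩ := Finset.mem_filter.1 hx
    have h1 := hE _ _ hx2 hx1
    have h2 : cntAfter lam E r j (v + 1) ≤ cntAfter lam E x.1 x.2 (v + 1) + 1 := by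
      unfold cntAfter
      rw [← hs]
      refine (Finset.card_le_card ?_).trans (Finset.card_insert_le x _)
      intro y hy
      obtain ⟨hy0, hy1, hy2⟩ := Finset.mem_filter.1 hy
      have := hmax y hy
      simp only [Prod.Lex.toLex_le_toLex, OrderDual.toDual_le_toDual] at this
      rw [Finset.mem_insert]
      by_cases hxy : y = x
      · exact Or.inl hxy
      · refine Or.inr (Finset.mem_filter.2 ⟨hy0, hy1, ?_⟩)
        have : ¬ (y.1 = x.1 ∧ y.2 = x.2) := fun hc => hxy (Prod.ext hc.1 hc.2)
        omega
    have h3 : cntAfter lam E x.1 x.2 v ≤ cntAfter lam E r j v := by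
      unfold cntAfter
      refine Finset.card_le_card (Finset.monotone_filter_right _ ?_)
      rintro y - ⟨hy1, hy2⟩
      exact ⟨hy1, by omega⟩
    unfold LatticeAt at h1
    omega

theorem IsViolation.eq (h : IsViolation lam mu E (r, j, v)) :
    mu.rowLen (v + 1) + cntAfter lam E r j (v + 1) = mu.rowLen v + cntAfter lam E r j v := by
  have h1 := balance (lam := lam) (mu := mu) (E := E) (r := r) (j := j) (v := v)
    fun r' j' hl hv => h.2.2 _ _ _ (Or.inl hl) hv
  have h2 := h.2.1
  simp only [LatticeAt] at h2
  omega

/-- A violating letter `v + 1` has no `v` above it: otherwise, each letter `v + 1` in its row from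
its box on would have a `v` above it, and the lattice condition would be inherited from row `r`. -/
theorem IsViolation.left_notMem_above (h : IsTableau lam E)
    (hv : IsViolation lam mu E (r + 1, j, v)) : v ∉ E r j := by
  intro hmem
  obtain ⟨hv1, hv2, hv3⟩ := hv
  simp only [LatticeAt] at hv1 hv2 hv3
  -- `e` is the last column of row `r` that contains `v`
  obtain ⟨e, he, hmax⟩ := Finset.exists_max_image
    ((Finset.range (lam.rowLen r)).filter fun x => v ∈ E r x) id
    ⟨j, Finset.mem_filter.2 ⟨Finset.mem_range.2
      (YoungDiagram.mem_iff_lt_rowLen.1 (h.mem_shape hmem)), hmem⟩⟩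
  obtain ⟨-, he⟩ := Finset.mem_filter.1 he
  have hmax' : ∀ x, v ∈ E r x → x ≤ e := fun x hx => hmax x (Finset.mem_filter.2
    ⟨Finset.mem_range.2 (YoungDiagram.mem_iff_lt_rowLen.1 (h.mem_shape hx)), hx⟩)
  have hje := hmax' j hmem
  have hmid : ∀ x, j ≤ x → x ≤ e → v ∈ E r x := by
    intro x h1 h2
    rcases Nat.eq_or_lt_of_le h1 with rfl | h1
    · exact hmem
    rcases Nat.eq_or_lt_of_le h2 with rfl | h2
    · exact he
    obtain ⟨b, hb⟩ := h.nonempty (lam.up_left_mem le_rfl h2.le (h.mem_shape he))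
    have := h.row_le h1 hmem hb
    have := h.row_le h2 hb he
    rwa [show v = b by omega]
  have hA : mu.rowLen (v + 1) + cntAfter lam E r e (v + 1) + (if v + 1 ∈ E r e then 1 else 0) ≤
      mu.rowLen v + cntAfter lam E r e v := by
    split_ifs with hve
    · exact hv3 r e v (Or.inl (Or.inl (Nat.lt_succ_self r))) hve
    · exact balance fun r' j' hl hv' => hv3 r' j' v (Or.inl (by omega)) hv'
  have hB : cntAfter lam E (r + 1) j (v + 1) ≤
      cntAfter lam E r e (v + 1) + (if v + 1 ∈ E r e then 1 else 0) + (e - j) := by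
    have hsub : (lam.cells.filter fun c => v + 1 ∈ E c.1 c.2 ∧
        (c.1 < r + 1 ∨ c.1 = r + 1 ∧ j < c.2)) ⊆
        ((lam.cells.filter fun c => v + 1 ∈ E c.1 c.2 ∧ (c.1 < r ∨ c.1 = r ∧ e < c.2)) ∪
          (if v + 1 ∈ E r e then {(r, e)} else ∅)) ∪ ({r + 1} ×ˢ Finset.Ioc j e) := by
      rintro ⟨x, y⟩ hxy
      obtain ⟨hc, h1, h2⟩ := Finset.mem_filter.1 hxy
      simp only at h1 h2
      rw [Finset.mem_union, Finset.mem_union]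
      rcases h2 with h2 | ⟨rfl, h2⟩
      · by_cases hx : x < r
        · exact Or.inl (Or.inl (Finset.mem_filter.2 ⟨hc, h1, Or.inl hx⟩))
        obtain rfl : x = r := by omega
        rcases lt_trichotomy y e with hy | rfl | hy
        · have := h.row_le hy h1 he
          omega
        · left; right
          simp [h1]
        · exact Or.inl (Or.inl (Finset.mem_filter.2 ⟨hc, h1, Or.inr ⟨rfl, hy⟩⟩))
      · right
        refine Finset.mem_product.2 ⟨Finset.mem_singleton_self _, Finset.mem_Ioc.2 ⟨h2, ?_⟩⟩
        have hin := lam.up_left_mem (Nat.le_succ r) le_rfl (h.mem_shape h1)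
        obtain ⟨b, hb⟩ := h.nonempty hin
        have := h.row_le h2 hmem hb
        have := h.col_lt (Nat.lt_succ_self r) hb h1
        exact hmax' _ (by rwa [show v = b by omega])
    refine (Finset.card_le_card hsub).trans ((Finset.card_union_le _ _).trans ?_)
    refine Nat.add_le_add ((Finset.card_union_le _ _).trans (Nat.add_le_add le_rfl ?_)) ?_
    · split_ifs <;> simp
    · simp
  have hC : cntAfter lam E r e v + (e + 1 - j) ≤ cntAfter lam E (r + 1) j v := by
    have hdisj : Disjoint (lam.cells.filter fun c => v ∈ E c.1 c.2 ∧ (c.1 < r ∨ c.1 = r ∧ e < c.2))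
        ({r} ×ˢ Finset.Icc j e) := by
      rw [Finset.disjoint_left]
      rintro ⟨x, y⟩ h1 h2
      obtain ⟨-, -, h1⟩ := Finset.mem_filter.1 h1
      obtain ⟨h2, h3⟩ := Finset.mem_product.1 h2
      rw [Finset.mem_singleton] at h2
      rw [Finset.mem_Icc] at h3
      simp only at h1 h2 h3
      omega
    have hcard : (({r} : Finset ℕ) ×ˢ Finset.Icc j e).card = e + 1 - j := by simp
    rw [cntAfter, ← hcard, ← Finset.card_union_of_disjoint hdisj]
    refine Finset.card_le_card ?_
    rintro ⟨x, y⟩ hxy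
    rcases Finset.mem_union.1 hxy with h1 | h1
    · obtain ⟨hc, h1, h2⟩ := Finset.mem_filter.1 h1
      simp only at h1 h2
      exact Finset.mem_filter.2 ⟨hc, h1, Or.inl (by simp only; omega)⟩
    · obtain ⟨h2, h3⟩ := Finset.mem_product.1 h1
      rw [Finset.mem_singleton] at h2
      rw [Finset.mem_Icc] at h3
      simp only at h2 h3
      subst h2
      have := hmid y h3.1 h3.2
      exact Finset.mem_filter.2 ⟨h.mem_shape this, this, Or.inl (Nat.lt_succ_self _)⟩
  omega

/-- Above the last violation of the lattice condition, for the letter `v + 1`, there are only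
letters less than `v`. -/
theorem IsViolation.above_lt (h : IsTableau lam E) (hv : IsViolation lam mu E (r, j, v)) :
    ∀ i', r = i' + 1 → ∀ j', j' ≤ j → ∀ a ∈ E i' j', a < v := by
  rintro r rfl j' hj' a ha
  have hmem : (r, j) ∈ lam := lam.up_left_mem (Nat.le_succ r) le_rfl (h.mem_shape hv.1)
  have key : ∀ b ∈ E r j, b < v := by
    intro b hb
    have h1 := h.col_lt (Nat.lt_succ_self r) hb hv.1
    have h2 : b ≠ v := fun hc => hv.left_notMem_above h (hc ▸ hb)
    simp only at h1
    omega
  rcases Nat.eq_or_lt_of_le hj' with rfl | hlt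
  · exact key a ha
  · obtain ⟨b, hb⟩ := h.nonempty hmem
    exact (h.row_le hlt ha hb).trans_lt (key b hb)

theorem cntFrom_eq (h : IsTableau lam E) (r j k : ℕ) :
    cntFrom lam E r j k = cntAfter lam E r j k + if k ∈ E r j then 1 else 0 := by
  classical
  have : (lam.cells.filter fun x => k ∈ E x.1 x.2 ∧ ¬ Before r j x.1 x.2) =
      (lam.cells.filter fun c => k ∈ E c.1 c.2 ∧ (c.1 < r ∨ c.1 = r ∧ j < c.2)) ∪
        if k ∈ E r j then {(r, j)} else ∅ := by
    ext ⟨x, y⟩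
    rw [Finset.mem_union, Finset.mem_filter, Finset.mem_filter]
    simp only [Before]
    constructor
    · rintro ⟨h1, h2, h3⟩
      by_cases hxy : x = r ∧ y = j
      · obtain ⟨rfl, rfl⟩ := hxy
        simp [h2]
      · exact Or.inl ⟨h1, h2, by omega⟩
    · rintro (⟨h1, h2, h3⟩ | h1)
      · exact ⟨h1, h2, by omega⟩
      · split_ifs at h1 with hk
        · rw [Finset.mem_singleton, Prod.mk.injEq] at h1
          obtain ⟨rfl, rfl⟩ := h1
          exact ⟨h.mem_shape hk, hk, by omega⟩
        · simp at h1
  rw [cntFrom, this, Finset.card_union_of_disjoint, cntAfter]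
  · split_ifs <;> simp
  · split_ifs
    · simp
    · simp

end Violation

open MvPolynomial

/-! ### Alternating sums in finitely many variables -/

section Alternating

variable {n : ℕ}

/-- The signed monomial `∏ (-x_k) ^ f k`. -/
noncomputable def signedMonomial (n : ℕ) (f : ℕ → ℕ) : MvPolynomial (Fin n) ℤ :=
  ∏ k : Fin n, (-X k) ^ f k

/-- The factor `∏ (1 - x_j) ^ j` of the summands of the determinant formula for stable Grothendieck
polynomials. -/
noncomputable def baseFactor (n : ℕ) : MvPolynomial (Fin n) ℤ :=
  ∏ j : Fin n, (1 - X j) ^ (j : ℕ)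

/-- The antisymmetrization `∑_w sgn(w) w(f)`. -/
noncomputable def alternate (f : MvPolynomial (Fin n) ℤ) : MvPolynomial (Fin n) ℤ :=
  ∑ w : Equiv.Perm (Fin n), ((Equiv.Perm.sign w : ℤˣ) : ℤ) • rename w f

/-- The staircase exponents `n - 1, n - 2, …, 0`. -/
def staircase (n k : ℕ) : ℕ := n - 1 - k

/-- The alternating polynomial `∑_w sgn(w) w(∏ (-x_j) ^ (f j + n - 1 - j) (1 - x_j) ^ j)`. -/
noncomputable def alternant (n : ℕ) (f : ℕ → ℕ) : MvPolynomial (Fin n) ℤ :=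
  alternate (signedMonomial n (f + staircase n) * baseFactor n)

theorem signedMonomial_add (f g : ℕ → ℕ) :
    signedMonomial n (f + g) = signedMonomial n f * signedMonomial n g := by
  simp only [signedMonomial, Pi.add_apply, pow_add, Finset.prod_mul_distrib]

theorem alternate_sum {ι : Type*} (s : Finset ι) (f : ι → MvPolynomial (Fin n) ℤ) :
    alternate (∑ i ∈ s, f i) = ∑ i ∈ s, alternate (f i) := by
  simp only [alternate, map_sum, Finset.smul_sum]
  exact Finset.sum_comm

theorem alternate_mul {g : MvPolynomial (Fin n) ℤ} (hg : ∀ w : Equiv.Perm (Fin n), rename w g = g)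
    (f : MvPolynomial (Fin n) ℤ) : alternate (g * f) = g * alternate f := by
  simp only [alternate, map_mul, hg, Finset.mul_sum, mul_smul_comm]

theorem alternate_eq_zero {a b : Fin n} (hab : a ≠ b) {f : MvPolynomial (Fin n) ℤ}
    (hf : rename (Equiv.swap a b) f = f) : alternate f = 0 := by
  have h : alternate f = -alternate f := by
    conv_lhs => rw [alternate, ← Equiv.sum_comp (Equiv.mulRight (Equiv.swap a b))]
    rw [alternate, ← Finset.sum_neg_distrib]
    refine Finset.sum_congr rfl fun w _ => ?_
    have : rename (w * Equiv.swap a b) f = rename w f := by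
      rw [Equiv.Perm.coe_mul, ← rename_rename, hf]
    simp only [Equiv.coe_mulRight, this, Equiv.Perm.sign_mul, Equiv.Perm.sign_swap hab]
    simp
  exact self_eq_neg.1 h

theorem coe_swap {a b : Fin n} (j : Fin n) :
    ((Equiv.swap a b j : Fin n) : ℕ) = Equiv.swap (a : ℕ) (b : ℕ) (j : ℕ) := by
  simp only [Equiv.swap_apply_def, Fin.ext_iff]
  split_ifs <;> rfl

theorem rename_signedMonomial (a b : Fin n) (f : ℕ → ℕ) :
    rename (Equiv.swap a b) (signedMonomial n f) =
      signedMonomial n (fun k => f (Equiv.swap (a : ℕ) (b : ℕ) k)) := by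
  simp only [signedMonomial, map_prod, map_pow, map_neg, rename_X]
  rw [← Equiv.prod_comp (Equiv.swap a b)]
  simp only [Equiv.swap_apply_self, coe_swap]

/-- The staircase and the exponents of `baseFactor` change in opposite directions, so that one more
factor `1 - x_v` makes the latter symmetric in `x_v` and `x_{v+1}`. -/
theorem rename_baseFactor {a b : Fin n} (hab : (b : ℕ) = a + 1) :
    rename (Equiv.swap a b) ((1 - X a) * baseFactor n) = (1 - X a) * baseFactor n := by
  have h : (1 - X a) * baseFactor n =
      ∏ j : Fin n, (1 - X j : MvPolynomial (Fin n) ℤ) ^ ((j : ℕ) + if j = a then 1 else 0) := by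
    simp only [pow_add, Finset.prod_mul_distrib, baseFactor]
    rw [mul_comm]
    congr 1
    simp only [pow_ite, pow_one, pow_zero]
    rw [Finset.prod_ite_eq' Finset.univ a]
    simp
  rw [h]
  simp only [map_prod, map_pow, map_sub, map_one, rename_X]
  rw [← Equiv.prod_comp (Equiv.swap a b)]
  refine Finset.prod_congr rfl fun j _ => ?_
  rw [Equiv.swap_apply_self]
  congr 1
  have hne : a ≠ b := fun hc => by rw [hc] at hab; omega
  by_cases h1 : j = a
  · subst h1
    rw [Equiv.swap_apply_left, if_neg hne.symm, if_pos rfl, hab]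
  by_cases h2 : j = b
  · subst h2
    rw [Equiv.swap_apply_right, if_neg hne.symm, if_pos rfl, hab]
  rw [Equiv.swap_apply_of_ne_of_ne h1 h2]

end Alternating

/-! ### Symmetry of stable Grothendieck polynomials -/

/-- The stable Grothendieck polynomial in `n` variables, with the signs of all variables changed
and without the sign `(-1) ^ |lam|`. -/
noncomputable def grothendieck (n : ℕ) (lam : YoungDiagram) : MvPolynomial (Fin n) ℤ :=
  ∑ E ∈ tabs lam n, signedMonomial n (cnt lam E)

theorem bk_mem_tabs {lam : YoungDiagram} {n v r c : ℕ} {E : Filling} (hE : E ∈ tabs lam n)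
    (hv : v + 1 < n) (hcut : ∀ j, c ≤ j → v ∉ E r j) :
    bk lam v r c E ∈ tabs lam n := by
  rw [mem_tabs] at hE ⊢
  refine ⟨bk_isTableau hE.1 hcut, fun i j k hk => ?_⟩
  rcases exists_mem_of_mem_bk hk with hk | ⟨rfl | rfl, -⟩
  · exact hE.2 i j k hk
  · omega
  · omega

theorem rename_swap_grothendieck {n : ℕ} (lam : YoungDiagram) {a b : Fin n}
    (hab : (b : ℕ) = a + 1) :
    rename (Equiv.swap a b) (grothendieck n lam) = grothendieck n lam := by
  have hcut : ∀ E ∈ tabs lam n, ∀ j, lam.rowLen 0 ≤ j → (a : ℕ) ∉ E 0 j := by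
    intro E hE j hj hx
    have := YoungDiagram.mem_iff_lt_rowLen.1 ((mem_tabs.1 hE).1.mem_shape hx)
    omega
  have hfrom : ∀ E k, cntFrom lam E 0 (lam.rowLen 0) k = 0 := by
    classical
    intro E k
    rw [cntFrom, Finset.card_eq_zero, Finset.filter_eq_empty_iff]
    rintro ⟨x, y⟩ hx ⟨-, h⟩
    refine h ?_
    rcases Nat.eq_zero_or_pos x with rfl | hx'
    · exact Or.inr ⟨rfl, YoungDiagram.mem_iff_lt_rowLen.1 hx⟩
    · exact Or.inl hx'
  have hbn : (a : ℕ) + 1 < n := hab ▸ b.2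
  unfold grothendieck
  rw [map_sum]
  refine Finset.sum_nbij' (bk lam a 0 (lam.rowLen 0)) (bk lam a 0 (lam.rowLen 0))
    (fun E hE => bk_mem_tabs hE hbn (hcut E hE)) (fun E hE => bk_mem_tabs hE hbn (hcut E hE))
    (fun E hE => bk_bk (mem_tabs.1 hE).1) (fun E hE => bk_bk (mem_tabs.1 hE).1) fun E hE => ?_
  rw [rename_signedMonomial]
  congr 1
  funext k
  have := cnt_bk_add (mem_tabs.1 hE).1 (hcut E hE) (by simp) (fun _ => 0)
    (by rw [hfrom, hfrom]) k
  simp only [Nat.add_zero] at this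
  rw [this, hab]

theorem rename_grothendieck {n : ℕ} (lam : YoungDiagram) (w : Equiv.Perm (Fin n)) :
    rename w (grothendieck n lam) = grothendieck n lam := by
  cases n with
  | zero =>
    rw [Subsingleton.elim w 1, Equiv.Perm.coe_one, rename_id]
    rfl
  | succ m =>
    have hw : w ∈ Submonoid.closure (Set.range fun i : Fin m => Equiv.swap i.castSucc i.succ) := by
      rw [Equiv.Perm.mclosure_swap_castSucc_succ]
      exact Submonoid.mem_top w
    induction hw using Submonoid.closure_induction with
    | mem x hx =>
      obtain ⟨i, rfl⟩ := hx
      exact rename_swap_grothendieck lam (by simp)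
    | one =>
      rw [Equiv.Perm.coe_one, rename_id]
      rfl
    | mul x y _ _ hx hy => rw [Equiv.Perm.coe_mul, ← rename_rename, hy, hx]

/-! ### Cancellation of the tableaux that violate the lattice condition -/

section Toggle

/-- The first column of row `r` that contains the letter `v + 1`. -/
noncomputable def firstCol (v r : ℕ) (E : Filling) : ℕ := sInf {j | v + 1 ∈ E r j}

/-- Add the letter `v` to the leftmost box of row `r` that contains `v + 1`, or remove it. -/
noncomputable def toggle (v r : ℕ) (E : Filling) : Filling := fun i j =>
  if i = r ∧ j = firstCol v r E then symmDiff (E i j) {v} else E i j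

variable {lam mu : YoungDiagram} {E : Filling} {r j v : ℕ}

theorem mem_toggle_of_ne {i j k : ℕ} (hk : k ≠ v) : k ∈ toggle v r E i j ↔ k ∈ E i j := by
  unfold toggle
  split_ifs
  · simp [Finset.mem_symmDiff, hk]
  · rfl

theorem toggle_of_ne {i j : ℕ} (h : ¬ (i = r ∧ j = firstCol v r E)) :
    toggle v r E i j = E i j := by
  simp [toggle, h]

theorem mem_toggle_self : v ∈ toggle v r E r (firstCol v r E) ↔ v ∉ E r (firstCol v r E) := by
  simp [toggle, Finset.mem_symmDiff]

theorem firstCol_toggle : firstCol v r (toggle v r E) = firstCol v r E := by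
  simp only [firstCol, mem_toggle_of_ne (Nat.succ_ne_self v)]

theorem toggle_toggle : toggle v r (toggle v r E) = E := by
  funext i j
  unfold toggle
  rw [show firstCol v r (fun i j => if i = r ∧ j = firstCol v r E then symmDiff (E i j) {v}
    else E i j) = firstCol v r E from firstCol_toggle]
  split_ifs
  · simp
  · rfl

theorem firstCol_mem (h : v + 1 ∈ E r j) : v + 1 ∈ E r (firstCol v r E) :=
  Nat.sInf_mem (s := {j | v + 1 ∈ E r j}) ⟨j, h⟩

theorem firstCol_le (h : v + 1 ∈ E r j) : firstCol v r E ≤ j :=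
  Nat.sInf_le (s := {j | v + 1 ∈ E r j}) h

theorem toggle_isTableau (h : IsTableau lam E) (hj : v + 1 ∈ E r j)
    (habove : ∀ i', r = i' + 1 → ∀ j', j' ≤ j → ∀ a ∈ E i' j', a < v) :
    IsTableau lam (toggle v r E) := by
  have h0 := firstCol_mem hj
  have hle := firstCol_le hj
  have hcases : ∀ {i j a}, a ∈ toggle v r E i j →
      a ∈ E i j ∨ i = r ∧ j = firstCol v r E ∧ a = v := by
    intro i j a ha
    by_cases hav : a = v
    · by_cases hij : i = r ∧ j = firstCol v r E
      · exact Or.inr ⟨hij.1, hij.2, hav⟩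
      · rw [toggle_of_ne hij] at ha
        exact Or.inl ha
    · exact Or.inl ((mem_toggle_of_ne hav).1 ha)
  refine ⟨?_, ?_, ?_, ?_⟩
  · intro i j hij
    by_cases hc : i = r ∧ j = firstCol v r E
    · exact ⟨v + 1, (mem_toggle_of_ne (Nat.succ_ne_self v)).2 (by rw [hc.1, hc.2]; exact h0)⟩
    · rw [toggle_of_ne hc]
      exact h.nonempty hij
  · intro i j hmem a ha b hb
    rcases hcases ha with ha₁ | ⟨rfl, rfl, rfl⟩ <;> rcases hcases hb with hb₁ | ⟨hi, hb, hbv⟩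
    · exact h.row_weak hmem a ha₁ b hb₁
    · subst hi hbv
      rw [hb] at hmem
      have h1 := h.row_le (Nat.lt_succ_self j) ha₁ (hb ▸ h0)
      have h2 : a ≠ b + 1 := by
        rintro rfl
        have := firstCol_le ha₁
        omega
      omega
    · have := h.row_weak hmem _ h0 b hb₁
      omega
    · exact hbv.ge
  · intro i j hmem a ha b hb
    rcases hcases ha with ha₁ | ⟨rfl, rfl, rfl⟩ <;> rcases hcases hb with hb₁ | ⟨hb', hj', hbv⟩
    · exact h.col_strict hmem a ha₁ b hb₁
    · subst hj' hbv
      exact habove i hb'.symm _ hle a ha₁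
    · have := h.col_strict hmem _ h0 b hb₁
      omega
    · omega
  · intro i j hij
    rw [toggle_of_ne, h.outside hij]
    rintro ⟨rfl, rfl⟩
    exact hij (h.mem_shape h0)

theorem cnt_toggle (h : IsTableau lam E) (hj : v + 1 ∈ E r j)
    (hnot : v ∉ E r (firstCol v r E)) :
    cnt lam (toggle v r E) = cnt lam E + Pi.single v 1 := by
  funext k
  by_cases hk : k = v
  · subst hk
    have : (lam.cells.filter fun c => k ∈ toggle k r E c.1 c.2) =
        insert (r, firstCol k r E) (lam.cells.filter fun c => k ∈ E c.1 c.2) := by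
      ext ⟨x, y⟩
      rw [Finset.mem_insert, Finset.mem_filter, Finset.mem_filter]
      by_cases hc : x = r ∧ y = firstCol k r E
      · obtain ⟨rfl, rfl⟩ := hc
        refine iff_of_true ⟨h.mem_shape (firstCol_mem hj), mem_toggle_self.2 hnot⟩ (Or.inl rfl)
      · simp only [toggle_of_ne hc, Prod.mk.injEq, hc, false_or]
    rw [cnt, this, Finset.card_insert_of_notMem, Pi.add_apply, Pi.single_eq_same, cnt]
    rw [Finset.mem_filter]
    exact fun hc => hnot hc.2
  · simp only [cnt, mem_toggle_of_ne hk, Pi.add_apply, Pi.single_eq_of_ne hk, Nat.add_zero]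

end Toggle

section Cancellation

variable {lam mu : YoungDiagram} {n : ℕ}

open Classical in
/-- The tableaux whose last violation of the lattice condition is `t`. -/
noncomputable def violators (lam mu : YoungDiagram) (n : ℕ) (t : ℕ × ℕ × ℕ) : Finset Filling :=
  (tabs lam n).filter fun E => IsViolation lam mu E t

open Classical in
/-- The tableaux whose last violation of the lattice condition is `(r, j, v)` and whose leftmost
box of row `r` with the letter `v + 1` does not contain `v`. -/
noncomputable def reduced (lam mu : YoungDiagram) (n r j v : ℕ) : Finset Filling :=
  (violators lam mu n (r, j, v)).filter fun E => v ∉ E r (firstCol v r E)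

variable {r j v : ℕ} {E : Filling}

theorem mem_violators {t : ℕ × ℕ × ℕ} :
    E ∈ violators lam mu n t ↔ E ∈ tabs lam n ∧ IsViolation lam mu E t := by
  classical
  rw [violators, Finset.mem_filter]

theorem mem_reduced : E ∈ reduced lam mu n r j v ↔
    E ∈ violators lam mu n (r, j, v) ∧ v ∉ E r (firstCol v r E) := by
  classical
  rw [reduced, Finset.mem_filter]

theorem toggle_mem_violators (hE : E ∈ violators lam mu n (r, j, v)) :
    toggle v r E ∈ violators lam mu n (r, j, v) := by
  rw [mem_violators, mem_tabs] at hE ⊢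
  obtain ⟨⟨hT, hlt⟩, hv⟩ := hE
  have hj : v + 1 ∈ E r j := hv.1
  have hle := firstCol_le hj
  refine ⟨⟨toggle_isTableau hT hj (hv.above_lt hT), ?_⟩, hv.congr ?_ ?_⟩
  · intro i' j' k hk
    by_cases hkv : k = v
    · have := hlt r j _ hj
      omega
    · exact hlt i' j' k ((mem_toggle_of_ne hkv).1 hk)
  · exact fun i' j' h => toggle_of_ne (by omega)
  · exact fun k hk => mem_toggle_of_ne (by omega)

/-- In a reduced tableau no box of row `r` contains both `v` and `v + 1`. -/
theorem reduced_not_both (hE : E ∈ reduced lam mu n r j v) {j' : ℕ}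
    (h : v + 1 ∈ E r j') : v ∉ E r j' := by
  rw [mem_reduced, mem_violators, mem_tabs] at hE
  obtain ⟨⟨⟨hT, -⟩, -⟩, hnot⟩ := hE
  rcases Nat.eq_or_lt_of_le (firstCol_le h) with heq | hlt
  · rwa [heq] at hnot
  · intro hv
    have := hT.row_le hlt (firstCol_mem h) hv
    omega

theorem reduced_cut (hE : E ∈ reduced lam mu n r j v) :
    ∀ j', j ≤ j' → v ∉ E r j' := by
  intro j' hjj hv'
  have hE' := hE
  rw [mem_reduced, mem_violators, mem_tabs] at hE'
  obtain ⟨⟨⟨hT, -⟩, hv⟩, -⟩ := hE'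
  have hj : v + 1 ∈ E r j := hv.1
  rcases Nat.eq_or_lt_of_le hjj with rfl | hlt
  · exact reduced_not_both hE hj hv'
  · have := hT.row_le hlt hj hv'
    omega

theorem reduced_above (hE : E ∈ reduced lam mu n r j v) :
    ∀ i', r = i' + 1 → ∀ j' < j, ∀ a ∈ E i' j', a < v := by
  rw [mem_reduced, mem_violators, mem_tabs] at hE
  exact fun i' hi j' hj' => hE.1.2.above_lt hE.1.1.1 i' hi j' hj'.le

theorem bk_mem_reduced (hE : E ∈ reduced lam mu n r j v) :
    bk lam v r j E ∈ reduced lam mu n r j v := by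
  have hcut := reduced_cut hE
  have hE' := hE
  rw [mem_reduced, mem_violators] at hE'
  obtain ⟨⟨hT, hv⟩, -⟩ := hE'
  have hTab := (mem_tabs.1 hT).1
  have hvn : v + 1 < n := (mem_tabs.1 hT).2 _ _ _ hv.1
  rw [mem_reduced, mem_violators]
  refine ⟨⟨bk_mem_tabs hT hvn hcut, hv.congr ?_ ?_⟩, ?_⟩
  · exact fun i' j' h => bk_of_not_before hTab (by unfold Before; omega)
  · exact fun k _ => by rw [bk_of_not_before hTab (by unfold Before; omega)]
  · have hmem : v + 1 ∈ bk lam v r j E r j := by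
      rw [bk_of_not_before hTab (by unfold Before; omega)]
      exact hv.1
    have h1 := firstCol_mem hmem
    set x := firstCol v r (bk lam v r j E)
    by_cases hx : x ∈ run lam v r j E r
    · rw [left_mem_bk hx]
      rw [right_mem_bk hx] at h1
      exact fun hc => reduced_not_both hE hc h1
    · rw [bk_of_notMem hx] at h1 ⊢
      exact reduced_not_both hE h1

theorem cnt_bk_reduced (hE : E ∈ reduced lam mu n r j v) (k : ℕ) :
    (cnt lam (bk lam v r j E) + (mu.rowLen + staircase n)) k =
      (cnt lam E + (mu.rowLen + staircase n)) (Equiv.swap v (v + 1) k) := by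
  have hE' := hE
  rw [mem_reduced, mem_violators] at hE'
  obtain ⟨⟨hT, hv⟩, -⟩ := hE'
  have hTab := (mem_tabs.1 hT).1
  have hvn : v + 1 < n := (mem_tabs.1 hT).2 _ _ _ hv.1
  have hj : v + 1 ∈ E r j := hv.1
  refine cnt_bk_add hTab (reduced_cut hE) (reduced_above hE) (mu.rowLen + staircase n) ?_ k
  have h1 := hv.eq
  rw [cntFrom_eq hTab, cntFrom_eq hTab, if_pos hj, if_neg (reduced_not_both hE hj)]
  simp only [Pi.add_apply, staircase]
  omega

/-- The tableaux with a given last violation cancel in the product with an alternant. -/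
theorem sum_violators (t : ℕ × ℕ × ℕ) :
    alternate ((∑ E ∈ violators lam mu n t, signedMonomial n (cnt lam E)) *
      (signedMonomial n (mu.rowLen + staircase n) * baseFactor n)) = 0 := by
  classical
  obtain ⟨r, j, v⟩ := t
  rcases (violators lam mu n (r, j, v)).eq_empty_or_nonempty with h0 | ⟨E₀, hE₀⟩
  · rw [h0]
    simp [alternate]
  rw [mem_violators, mem_tabs] at hE₀
  have hvn : v + 1 < n := hE₀.1.2 _ _ _ hE₀.2.1
  obtain ⟨a, ha⟩ : ∃ a : Fin n, (a : ℕ) = v := ⟨⟨v, by omega⟩, rfl⟩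
  obtain ⟨b, hb⟩ : ∃ b : Fin n, (b : ℕ) = v + 1 := ⟨⟨v + 1, hvn⟩, rfl⟩
  have hab : (b : ℕ) = a + 1 := by omega
  -- Toggling the letter `v` multiplies the monomials by `-x_v`.
  have hsum : ∑ E ∈ violators lam mu n (r, j, v), signedMonomial n (cnt lam E) =
      (1 - X a) * ∑ E ∈ reduced lam mu n r j v, signedMonomial n (cnt lam E) := by
    rw [← Finset.sum_filter_add_sum_filter_not _ (fun E => v ∉ E r (firstCol v r E)), sub_mul,
      one_mul, sub_eq_add_neg]
    have hred : (violators lam mu n (r, j, v)).filter (fun E => v ∉ E r (firstCol v r E)) =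
        reduced lam mu n r j v := by
      ext E
      rw [mem_reduced, Finset.mem_filter]
    rw [hred]
    congr 1
    rw [← neg_mul, Finset.mul_sum]
    symm
    refine Finset.sum_nbij' (toggle v r) (toggle v r) ?_ ?_ (fun _ _ => toggle_toggle)
      (fun _ _ => toggle_toggle) ?_
    · intro E hE
      rw [mem_reduced] at hE
      refine Finset.mem_filter.2 ⟨toggle_mem_violators hE.1, ?_⟩
      rw [firstCol_toggle, mem_toggle_self]
      exact not_not.2 hE.2
    · intro E hE
      obtain ⟨h1, h2⟩ := Finset.mem_filter.1 hE
      refine mem_reduced.2 ⟨toggle_mem_violators h1, ?_⟩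
      rw [firstCol_toggle, mem_toggle_self]
      exact h2
    · intro E hE
      rw [mem_reduced, mem_violators, mem_tabs] at hE
      rw [cnt_toggle hE.1.1.1 hE.1.2.1 hE.2, signedMonomial_add, mul_comm]
      congr 1
      unfold signedMonomial
      rw [Finset.prod_eq_single a]
      · rw [ha]
        simp
      · intro c _ hc
        rw [Pi.single_eq_of_ne, pow_zero]
        exact fun h => hc (Fin.ext (h.trans ha.symm))
      · simp
  rw [hsum]
  refine alternate_eq_zero (a := a) (b := b) (fun hc => by rw [hc] at hab; omega) ?_
  have hre : (1 - X a) * (∑ E ∈ reduced lam mu n r j v, signedMonomial n (cnt lam E)) *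
      (signedMonomial n (mu.rowLen + staircase n) * baseFactor n) =
      (∑ E ∈ reduced lam mu n r j v,
        signedMonomial n (cnt lam E + (mu.rowLen + staircase n))) *
      ((1 - X a) * baseFactor n) := by
    simp only [signedMonomial_add _ (mu.rowLen + staircase n), ← Finset.sum_mul]
    ring
  rw [hre, map_mul, rename_baseFactor hab, map_sum]
  congr 1
  refine Finset.sum_nbij' (bk lam v r j) (bk lam v r j) (fun E hE => bk_mem_reduced hE)
    (fun E hE => bk_mem_reduced hE) ?_ ?_ ?_
  · intro E hE
    rw [mem_reduced, mem_violators, mem_tabs] at hE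
    exact bk_bk hE.1.1.1
  · intro E hE
    rw [mem_reduced, mem_violators, mem_tabs] at hE
    exact bk_bk hE.1.1.1
  · intro E hE
    rw [rename_signedMonomial, ha, hb]
    congr 1
    funext k
    exact (cnt_bk_reduced hE k).symm

open Classical in
/-- The lattice tableaux of shape `lam` with letters less than `n`. -/
noncomputable def latticeTabs (lam mu : YoungDiagram) (n : ℕ) : Finset Filling :=
  (tabs lam n).filter (IsLattice lam mu)

theorem mem_latticeTabs :
    E ∈ latticeTabs lam mu n ↔ E ∈ tabs lam n ∧ IsLattice lam mu E := by
  classical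
  rw [latticeTabs, Finset.mem_filter]

/-- Multiplication of an alternant by a stable Grothendieck polynomial. -/
theorem grothendieck_mul_alternant (lam mu : YoungDiagram) (n : ℕ) :
    grothendieck n lam * alternant n mu.rowLen =
      ∑ E ∈ latticeTabs lam mu n, alternant n (cnt lam E + mu.rowLen) := by
  classical
  have hviol : alternate ((∑ E ∈ (tabs lam n).filter (fun E => ¬ IsLattice lam mu E),
      signedMonomial n (cnt lam E)) *
      (signedMonomial n (mu.rowLen + staircase n) * baseFactor n)) = 0 := by
    set s := (tabs lam n).filter (fun E => ¬ IsLattice lam mu E)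
    have hex : ∀ E ∈ s, ∃ t, IsViolation lam mu E t := fun E hE =>
      exists_violation (mem_tabs.1 (Finset.mem_filter.1 hE).1).1 (Finset.mem_filter.1 hE).2
    choose! g hg using hex
    rw [← Finset.sum_fiberwise_of_maps_to (t := s.image g)
      (fun E hE => Finset.mem_image_of_mem g hE), Finset.sum_mul, alternate_sum]
    refine Finset.sum_eq_zero fun t ht => ?_
    rw [← sum_violators (lam := lam) (mu := mu) (n := n) t]
    congr 3
    ext E
    rw [Finset.mem_filter, mem_violators]
    constructor
    · rintro ⟨hE, rfl⟩
      exact ⟨(Finset.mem_filter.1 hE).1, hg E hE⟩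
    · rintro ⟨hE, hv⟩
      have hs : E ∈ s := Finset.mem_filter.2 ⟨hE, fun hl => hv.2.1 (hl _ _ _ hv.1)⟩
      exact ⟨hs, (hg E hs).unique hv⟩
  rw [alternant, ← alternate_mul (rename_grothendieck lam), grothendieck,
    ← Finset.sum_filter_add_sum_filter_not _ (IsLattice lam mu), add_mul]
  have hadd : ∀ f g : MvPolynomial (Fin n) ℤ, alternate (f + g) = alternate f + alternate g := by
    intro f g
    simp only [alternate, map_add, smul_add, Finset.sum_add_distrib]
  rw [hadd, hviol, add_zero, Finset.sum_mul, alternate_sum]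
  refine Finset.sum_congr ?_ fun E _ => ?_
  · ext E
    rw [Finset.mem_filter, mem_latticeTabs]
  · rw [alternant, add_assoc, signedMonomial_add _ (mu.rowLen + staircase n), mul_assoc]

end Cancellation

/-! ### Partitions and their row lengths -/

theorem eq_of_rowLen_eq {lam mu : YoungDiagram} (h : lam.rowLen = mu.rowLen) : lam = mu := by
  refine YoungDiagram.ext (Finset.ext ?_)
  rintro ⟨i, j⟩
  rw [YoungDiagram.mem_cells, YoungDiagram.mem_cells, YoungDiagram.mem_iff_lt_rowLen,
    YoungDiagram.mem_iff_lt_rowLen, h]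

theorem rowLen_eq_iff {lam : YoungDiagram} {i m : ℕ} :
    lam.rowLen i = m ↔ ∀ j, (i, j) ∈ lam ↔ j < m := by
  simp only [YoungDiagram.mem_iff_lt_rowLen]
  constructor
  · rintro rfl j
    rfl
  · intro h
    exact le_antisymm (not_lt.1 fun hc => absurd ((h m).1 hc) (lt_irrefl _))
      (not_lt.1 fun hc => absurd ((h _).2 hc) (lt_irrefl _))

theorem rowLen_eq_zero_of_le {lam : YoungDiagram} {i : ℕ} (h : lam.colLen 0 ≤ i) :
    lam.rowLen i = 0 := by
  rw [rowLen_eq_iff]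
  intro j
  refine iff_of_false (fun hc => ?_) (by omega)
  have := YoungDiagram.mem_iff_lt_colLen.1 (lam.up_left_mem le_rfl (Nat.zero_le j) hc)
  omega

theorem colLen_zero_le {lam : YoungDiagram} {i : ℕ} (h : lam.rowLen i = 0) :
    lam.colLen 0 ≤ i := by
  by_contra hc
  have := YoungDiagram.mem_iff_lt_rowLen.1 (YoungDiagram.mem_iff_lt_colLen.2 (not_le.1 hc))
  omega

theorem exists_rowLen_eq {g : ℕ → ℕ} (hg : Antitone g) {N : ℕ} (hN : g N = 0) :
    ∃ nu : YoungDiagram, nu.rowLen = g := by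
  refine ⟨⟨(Finset.range N ×ˢ Finset.range (g 0)).filter fun c => c.2 < g c.1, ?_⟩, ?_⟩
  · rintro ⟨i, j⟩ ⟨i', j'⟩ ⟨h1, h2⟩ hm
    simp only [Finset.mem_coe, Finset.mem_filter, Finset.mem_product,
      Finset.mem_range] at hm h1 h2 ⊢
    have := hg h1
    omega
  · funext i
    rw [rowLen_eq_iff]
    intro j
    rw [← YoungDiagram.mem_cells]
    simp only [Finset.mem_filter, Finset.mem_product, Finset.mem_range]
    have h0 := hg (Nat.zero_le i)
    refine ⟨fun h => h.2, fun h => ⟨⟨?_, by omega⟩, h⟩⟩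
    by_contra hc
    have := hg (not_lt.1 hc)
    omega

theorem card_eq_sum_rowLen (lam : YoungDiagram) {n : ℕ} (hn : lam.colLen 0 ≤ n) :
    lam.card = ∑ i ∈ Finset.range n, lam.rowLen i := by
  have : ∀ c ∈ lam.cells, c.1 ∈ Finset.range n := by
    rintro ⟨i, j⟩ hc
    have := YoungDiagram.mem_iff_lt_colLen.1
      (lam.up_left_mem le_rfl (Nat.zero_le j) ((YoungDiagram.mem_cells _).1 hc))
    rw [Finset.mem_range]
    simp only
    omega
  rw [YoungDiagram.card, Finset.card_eq_sum_card_fiberwise this]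
  exact Finset.sum_congr rfl fun i _ => (YoungDiagram.rowLen_eq_card lam).symm

theorem rowLen_bot : (⊥ : YoungDiagram).rowLen = 0 := by
  funext i
  rw [rowLen_eq_iff]
  simp

theorem colLen_bot : (⊥ : YoungDiagram).colLen 0 = 0 :=
  Nat.le_zero.1 (colLen_zero_le (by rw [rowLen_bot]; rfl))

/-! ### Lattice tableaux -/

section Lattice

variable {lam mu : YoungDiagram} {E : Filling}

/-- In a lattice tableau the letters of row `i` are bounded, since a new letter `v + 1` needs an
earlier row or `u(mu)` to supply a `v`. -/
theorem IsLattice.letter_le (h : IsTableau lam E) (hl : IsLattice lam mu E) {i j k : ℕ}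
    (hk : k ∈ E i j) : k ≤ mu.colLen 0 + i := by
  induction i using Nat.strong_induction_on generalizing j k with
  | _ i ih =>
    cases k with
    | zero => exact Nat.zero_le _
    | succ v =>
      have h1 := hl i j v hk
      unfold LatticeAt at h1
      by_cases h2 : mu.rowLen v = 0
      · have h3 : 0 < cntAfter lam E i j v := by omega
        obtain ⟨x, hx⟩ := Finset.card_pos.1 h3
        obtain ⟨-, hx1, hx2⟩ := Finset.mem_filter.1 hx
        rcases hx2 with hx2 | ⟨hx2, hx3⟩
        · have := ih _ hx2 hx1
          omega
        · rw [hx2] at hx1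
          have := h.row_le hx3 hk hx1
          omega
      · by_contra hc
        exact h2 (rowLen_eq_zero_of_le (by omega))

theorem cntAfter_colLen (E : Filling) (k : ℕ) :
    cntAfter lam E (lam.colLen 0) 0 k = cnt lam E k := by
  unfold cntAfter cnt
  congr 1
  refine Finset.filter_congr fun x hx => ⟨fun h => h.1, fun h => ⟨h, Or.inl ?_⟩⟩
  exact YoungDiagram.mem_iff_lt_colLen.1
    (lam.up_left_mem le_rfl (Nat.zero_le x.2) ((YoungDiagram.mem_cells _).1 hx))

theorem IsLattice.antitone (hl : IsLattice lam mu E) :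
    Antitone (cnt lam E + mu.rowLen) := by
  refine antitone_nat_of_succ_le fun v => ?_
  have := balance (lam := lam) (mu := mu) (E := E) (r := lam.colLen 0) (j := 0) (v := v)
    fun r' j' _ hv => hl r' j' v hv
  rw [cntAfter_colLen, cntAfter_colLen] at this
  simp only [Pi.add_apply]
  omega

theorem cnt_eq_zero {n : ℕ} (hE : E ∈ tabs lam n) {k : ℕ} (hk : n ≤ k) : cnt lam E k = 0 := by
  rw [cnt, Finset.card_eq_zero, Finset.filter_eq_empty_iff]
  intro x _ hx
  have := (mem_tabs.1 hE).2 _ _ _ hx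
  omega

/-- The content of the word of a lattice tableau, followed by `u(mu)`, is a partition. -/
theorem exists_content {n : ℕ} (hE : E ∈ latticeTabs lam mu n) (hn : mu.colLen 0 ≤ n) :
    ∃ nu : YoungDiagram, nu.rowLen = cnt lam E + mu.rowLen ∧ nu.colLen 0 ≤ n := by
  rw [mem_latticeTabs] at hE
  have h0 : (cnt lam E + mu.rowLen) n = 0 := by
    rw [Pi.add_apply, cnt_eq_zero hE.1 le_rfl, rowLen_eq_zero_of_le hn]
  obtain ⟨nu, hnu⟩ := exists_rowLen_eq (hE.2.antitone) h0
  exact ⟨nu, hnu, colLen_zero_le (hnu ▸ h0)⟩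

theorem latticeTabs_eq_of_le (lam mu : YoungDiagram) {n : ℕ}
    (hn : lam.colLen 0 + mu.colLen 0 ≤ n) :
    latticeTabs lam mu n = latticeTabs lam mu (lam.colLen 0 + mu.colLen 0) := by
  ext E
  rw [mem_latticeTabs, mem_latticeTabs, mem_tabs, mem_tabs]
  constructor
  · rintro ⟨⟨hT, -⟩, hl⟩
    refine ⟨⟨hT, fun i j k hk => ?_⟩, hl⟩
    have h1 := hl.letter_le hT hk
    have h2 := YoungDiagram.mem_iff_lt_colLen.1
      (lam.up_left_mem le_rfl (Nat.zero_le j) (hT.mem_shape hk))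
    omega
  · rintro ⟨⟨hT, hlt⟩, hl⟩
    exact ⟨⟨hT, fun i j k hk => (hlt i j k hk).trans_le hn⟩, hl⟩

/-- The tableau of shape `lam` with the letter `i` in all boxes of row `i`. -/
def rowFilling (lam : YoungDiagram) : Filling := fun i j => if (i, j) ∈ lam then {i} else ∅

theorem mem_rowFilling {i j k : ℕ} : k ∈ rowFilling lam i j ↔ (i, j) ∈ lam ∧ k = i := by
  unfold rowFilling
  split_ifs with h <;> simp [h]

theorem rowFilling_isTableau (lam : YoungDiagram) : IsTableau lam (rowFilling lam) := by
  refine ⟨fun h => ⟨_, mem_rowFilling.2 ⟨h, rfl⟩⟩, ?_, ?_, fun h => by simp [rowFilling, h]⟩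
  · intro i j _ a ha b hb
    rw [mem_rowFilling] at ha hb
    omega
  · intro i j _ a ha b hb
    rw [mem_rowFilling] at ha hb
    omega

theorem cnt_rowFilling (lam : YoungDiagram) : cnt lam (rowFilling lam) = lam.rowLen := by
  funext k
  rw [YoungDiagram.rowLen_eq_card, YoungDiagram.row, cnt]
  congr 1
  refine Finset.filter_congr ?_
  rintro ⟨i, j⟩ hx
  rw [mem_rowFilling]
  exact ⟨fun h => h.2.symm, fun h => ⟨(YoungDiagram.mem_cells _).1 hx, h.symm⟩⟩

theorem rowFilling_isLattice (lam : YoungDiagram) : IsLattice lam ⊥ (rowFilling lam) := by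
  intro r j v hv
  obtain ⟨hmem, rfl⟩ := mem_rowFilling.1 hv
  have h1 : cntAfter lam (rowFilling lam) (v + 1) j (v + 1) < lam.rowLen (v + 1) := by
    rw [← cnt_rowFilling, cnt, cntAfter]
    refine Finset.card_lt_card (Finset.ssubset_iff_of_subset ?_ |>.2 ⟨(v + 1, j), ?_, ?_⟩)
    · exact Finset.monotone_filter_right _ fun x _ hx => hx.1
    · exact Finset.mem_filter.2 ⟨hmem, hv⟩
    · intro hc
      have := (Finset.mem_filter.1 hc).2.2
      simp only at this
      omega
  have h2 : cntAfter lam (rowFilling lam) (v + 1) j v = lam.rowLen v := by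
    rw [← cnt_rowFilling, cnt, cntAfter]
    congr 1
    refine Finset.filter_congr fun x _ => ⟨fun h => h.1, fun h => ⟨h, Or.inl ?_⟩⟩
    have := (mem_rowFilling.1 h).2
    omega
  have h3 := lam.rowLen_anti v (v + 1) (Nat.le_succ v)
  rw [LatticeAt, h2, rowLen_bot]
  simp only [Pi.zero_apply]
  omega

theorem latticeTabs_bot {lam : YoungDiagram} {n : ℕ} (hn : lam.colLen 0 ≤ n) :
    latticeTabs lam ⊥ n = {rowFilling lam} := by
  ext E
  rw [mem_latticeTabs, mem_tabs, Finset.mem_singleton]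
  constructor
  · rintro ⟨⟨hT, -⟩, hl⟩
    have key : ∀ {i j k}, k ∈ E i j → k = i := by
      intro i j k hk
      have h1 := hl.letter_le hT hk
      have h2 := hT.row_index_le hk
      rw [colLen_bot] at h1
      omega
    funext i j
    ext k
    rw [mem_rowFilling]
    refine ⟨fun hk => ⟨hT.mem_shape hk, key hk⟩, ?_⟩
    rintro ⟨hij, rfl⟩
    obtain ⟨a, ha⟩ := hT.nonempty hij
    have := key ha
    rwa [this] at ha
  · rintro rfl
    refine ⟨⟨rowFilling_isTableau lam, fun i j k hk => ?_⟩, rowFilling_isLattice lam⟩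
    obtain ⟨hij, rfl⟩ := mem_rowFilling.1 hk
    have := YoungDiagram.mem_iff_lt_colLen.1 (lam.up_left_mem le_rfl (Nat.zero_le j) hij)
    omega

/-- The bialternant formula for stable Grothendieck polynomials. -/
theorem grothendieck_mul_alternant_zero {lam : YoungDiagram} {n : ℕ} (hn : lam.colLen 0 ≤ n) :
    grothendieck n lam * alternant n 0 = alternant n lam.rowLen := by
  have := grothendieck_mul_alternant lam ⊥ n
  rwa [latticeTabs_bot hn, Finset.sum_singleton, cnt_rowFilling, rowLen_bot, add_zero] at this

end Lattice

/-! ### Linear independence -/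

section Independence

variable {n : ℕ}

/-- The exponent vector in `n` variables with entries `f k`. -/
noncomputable def expo (n : ℕ) (f : ℕ → ℕ) : Fin n →₀ ℕ :=
  Finsupp.equivFunOnFinite.symm fun k => f k

theorem prod_neg_X_pow (f : Fin n → ℕ) :
    ∏ k : Fin n, (-X k : MvPolynomial (Fin n) ℤ) ^ f k =
      monomial (Finsupp.equivFunOnFinite.symm f) ((-1) ^ ∑ k, f k) := by
  have h : ∀ k : Fin n, (-X k : MvPolynomial (Fin n) ℤ) ^ f k = C ((-1) ^ f k) * X k ^ f k := by
    intro k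
    rw [neg_pow, map_pow, map_neg, map_one]
  simp only [h, Finset.prod_mul_distrib]
  rw [monomial_eq, Finsupp.prod_fintype _ _ (by simp), ← Finset.prod_pow_eq_pow_sum, map_prod]
  rfl

theorem signedMonomial_eq (f : ℕ → ℕ) :
    signedMonomial n f = monomial (expo n f) ((-1) ^ ∑ k : Fin n, f k) :=
  prod_neg_X_pow fun k => f k

theorem perm_eq_one {f e : Fin n → ℕ} (hf : StrictAnti f) (he : StrictAnti e)
    {w : Equiv.Perm (Fin n)} (h : ∀ k, f (w k) = e k) : w = 1 := by
  have hw : StrictMono w := by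
    intro i j hij
    have := he hij
    rw [← h, ← h] at this
    exact hf.lt_iff_gt.1 this
  exact Equiv.ext fun k => congrFun hw.eq_id k

theorem strictAnti_add_staircase {f : ℕ → ℕ} (hf : Antitone f) :
    StrictAnti fun k : Fin n => (f + staircase n) k := by
  intro i j hij
  have h1 : f j ≤ f i := hf (Fin.lt_def.1 hij).le
  have h2 := Fin.lt_def.1 hij
  have h3 := j.2
  simp only [Pi.add_apply, staircase]
  omega

/-- The coefficient of the leading monomial of one alternant in another. -/
theorem coeff_alternant {f e : ℕ → ℕ} (hf : Antitone f) (he : Antitone e)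
    (hsum : ∑ k : Fin n, e k ≤ ∑ k : Fin n, f k) :
    coeff (expo n (e + staircase n)) (alternant n f) =
      if ∀ k < n, f k = e k then (-1) ^ ∑ k : Fin n, (f + staircase n) k else 0 := by
  have hbase : constantCoeff (baseFactor n) = 1 := by
    simp [baseFactor]
  have hsum' : ∑ k : Fin n, (e + staircase n) k ≤ ∑ k : Fin n, (f + staircase n) k := by
    simp only [Pi.add_apply, Finset.sum_add_distrib]
    omega
  set F : Fin n → ℕ := fun k => (f + staircase n) k with hF
  have hexpo : ∀ k : Fin n, expo n (e + staircase n) k = (e + staircase n) k := fun _ => rfl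
  -- the summand of a permutation `w`
  have hren : ∀ w : Equiv.Perm (Fin n),
      rename w (signedMonomial n (f + staircase n) * baseFactor n) =
        monomial (Finsupp.equivFunOnFinite.symm fun k => F (w.symm k)) ((-1) ^ ∑ k, F k) *
          rename w (baseFactor n) := by
    intro w
    rw [map_mul]
    congr 1
    simp only [signedMonomial, map_prod, map_pow, map_neg, rename_X]
    rw [← Equiv.sum_comp w.symm F, ← prod_neg_X_pow,
      ← Equiv.prod_comp w fun k => (-X k : MvPolynomial (Fin n) ℤ) ^ F (w.symm k)]
    simp only [Equiv.symm_apply_apply]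
    rfl
  have hterm : ∀ w : Equiv.Perm (Fin n),
      coeff (expo n (e + staircase n))
        (rename w (signedMonomial n (f + staircase n) * baseFactor n)) =
      if w = 1 ∧ ∀ k < n, f k = e k then (-1) ^ ∑ k, F k else 0 := by
    intro w
    rw [hren, coeff_monomial_mul']
    by_cases hle : Finsupp.equivFunOnFinite.symm (fun k => F (w.symm k)) ≤
        expo n (e + staircase n)
    · have hle' : ∀ k, F (w.symm k) ≤ (e + staircase n) k := fun k => hle k
      have heq : ∀ k ∈ Finset.univ, F (w.symm k) = (e + staircase n) ((k : Fin n) : ℕ) := by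
        refine (Finset.sum_eq_sum_iff_of_le fun k _ => hle' k).1 ?_
        refine le_antisymm (Finset.sum_le_sum fun k _ => hle' k) ?_
        rw [Equiv.sum_comp w.symm F]
        exact hsum'
      have hw : w.symm = 1 := perm_eq_one (strictAnti_add_staircase hf)
        (strictAnti_add_staircase he) fun k => heq k (Finset.mem_univ k)
      have hw' : w = 1 := by
        rw [← Equiv.symm_symm w, hw]
        rfl
      have hfe : ∀ k < n, f k = e k := by
        intro k hk
        have := heq ⟨k, hk⟩ (Finset.mem_univ _)
        rw [hw] at this
        simpa [hF] using this
      rw [if_pos hle, if_pos ⟨hw', hfe⟩]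
      have h0 : expo n (e + staircase n) - Finsupp.equivFunOnFinite.symm (fun k => F (w.symm k)) =
          0 := by
        ext k
        rw [Finsupp.tsub_apply, hexpo, ← heq k (Finset.mem_univ k)]
        simp
      rw [h0, ← constantCoeff_eq, constantCoeff_rename, hbase, mul_one]
    · rw [if_neg hle, if_neg]
      rintro ⟨rfl, hfe⟩
      refine hle fun k => ?_
      rw [hexpo]
      change (f + staircase n) k ≤ _
      rw [Pi.add_apply, Pi.add_apply, hfe k k.2]
  rw [alternant, alternate, coeff_sum]
  simp only [coeff_smul, hterm]
  rw [Finset.sum_eq_single 1]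
  · simp [hF]
  · intro w _ hw
    rw [if_neg fun h => hw h.1, smul_zero]
  · simp

theorem alternant_zero_ne_zero (n : ℕ) : alternant n 0 ≠ 0 := by
  intro h
  have := coeff_alternant (n := n) (f := 0) (e := 0) antitone_const antitone_const le_rfl
  rw [h, coeff_zero, if_pos fun _ _ => rfl] at this
  exact pow_ne_zero _ (by norm_num) this.symm

theorem rowLen_antitone (lam : YoungDiagram) : Antitone lam.rowLen :=
  fun i j hij => lam.rowLen_anti i j hij

theorem grothendieck_independent (s : Finset YoungDiagram) (g : YoungDiagram → ℤ)
    (hn : ∀ nu ∈ s, nu.colLen 0 ≤ n) (h : ∑ nu ∈ s, g nu • grothendieck n nu = 0) :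
    ∀ nu ∈ s, g nu = 0 := by
  by_contra! hg
  obtain ⟨nu₀, hnu₀, hg₀⟩ := hg
  obtain ⟨lam, hlam, hmin⟩ := Finset.exists_min_image (s.filter fun nu => g nu ≠ 0)
    YoungDiagram.card ⟨nu₀, Finset.mem_filter.2 ⟨hnu₀, hg₀⟩⟩
  obtain ⟨hlam, hglam⟩ := Finset.mem_filter.1 hlam
  have h1 : ∑ nu ∈ s, g nu • alternant n nu.rowLen = 0 := by
    rw [← zero_mul (alternant n 0), ← h, Finset.sum_mul]
    refine Finset.sum_congr rfl fun nu hnu => ?_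
    rw [smul_mul_assoc, grothendieck_mul_alternant_zero (hn nu hnu)]
  have h2 := congrArg (coeff (expo n (lam.rowLen + staircase n))) h1
  rw [coeff_sum, coeff_zero, Finset.sum_eq_single lam] at h2
  · rw [coeff_smul, coeff_alternant (rowLen_antitone _) (rowLen_antitone _) le_rfl,
      if_pos fun _ _ => rfl] at h2
    rcases mul_eq_zero.1 h2 with h3 | h3
    · exact hglam h3
    · exact pow_ne_zero _ (by norm_num) h3
  · intro nu hnu hne
    by_cases hgnu : g nu = 0
    · rw [hgnu, zero_smul, coeff_zero]
    have hcard := hmin nu (Finset.mem_filter.2 ⟨hnu, hgnu⟩)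
    rw [card_eq_sum_rowLen lam (hn lam hlam), card_eq_sum_rowLen nu (hn nu hnu)] at hcard
    rw [coeff_smul, coeff_alternant (rowLen_antitone _) (rowLen_antitone _), if_neg, smul_zero]
    · intro hc
      refine hne (eq_of_rowLen_eq (funext fun k => ?_))
      rcases lt_or_ge k n with hk | hk
      · exact hc k hk
      · rw [rowLen_eq_zero_of_le ((hn nu hnu).trans hk),
          rowLen_eq_zero_of_le ((hn lam hlam).trans hk)]
    · rwa [Fin.sum_univ_eq_sum_range lam.rowLen n, Fin.sum_univ_eq_sum_range nu.rowLen n]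
  · exact fun hc => absurd hlam hc

end Independence

/-- The product of two stable Grothendieck polynomials, in sufficiently many variables. -/
theorem grothendieck_mul {lam mu : YoungDiagram} {n : ℕ} (hn : mu.colLen 0 ≤ n)
    (content : Filling → YoungDiagram)
    (hc : ∀ E ∈ latticeTabs lam mu n, (content E).rowLen = cnt lam E + mu.rowLen) :
    grothendieck n lam * grothendieck n mu =
      ∑ E ∈ latticeTabs lam mu n, grothendieck n (content E) := by
  refine mul_right_cancel₀ (alternant_zero_ne_zero n) ?_
  rw [mul_assoc, grothendieck_mul_alternant_zero hn, grothendieck_mul_alternant, Finset.sum_mul]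
  refine Finset.sum_congr rfl fun E hE => ?_
  obtain ⟨nu, h1, h2⟩ := exists_content hE hn
  rw [eq_of_rowLen_eq ((hc E hE).trans h1.symm), grothendieck_mul_alternant_zero h2, h1]

/-! ### The structure constants -/

section Correspondence

variable {lam : YoungDiagram}

/-- The filling with letters counted from zero that corresponds to a set-valued tableau. -/
def SetValuedTableau.toFilling (T : SetValuedTableau lam) : Filling := fun i j =>
  (T.entry i j).map Equiv.pnatEquivNat.toEmbedding

theorem SetValuedTableau.mem_toFilling {T : SetValuedTableau lam} {i j k : ℕ} :
    k ∈ T.toFilling i j ↔ k.succPNat ∈ T.entry i j := by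
  simp only [toFilling, Finset.mem_map_equiv]
  rfl

theorem SetValuedTableau.toFilling_isTableau (T : SetValuedTableau lam) :
    IsTableau lam T.toFilling := by
  refine ⟨fun h => (T.nonempty h).map, ?_, ?_, fun h => by simp [toFilling, T.outside h]⟩
  · intro i j h a ha b hb
    exact Nat.succPNat_le_succPNat.1 (T.row_weak h _ (mem_toFilling.1 ha) _ (mem_toFilling.1 hb))
  · intro i j h a ha b hb
    exact Nat.succPNat_lt_succPNat.1 (T.col_strict h _ (mem_toFilling.1 ha) _ (mem_toFilling.1 hb))

theorem SetValuedTableau.toFilling_injective :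
    Function.Injective (SetValuedTableau.toFilling (lam := lam)) := by
  intro T T' h
  refine SetValuedTableau.ext (funext fun i => funext fun j => ?_)
  exact Finset.map_injective _ (congrFun (congrFun h i) j)

theorem exists_toFilling_eq {E : Filling} (h : IsTableau lam E) :
    ∃ T : SetValuedTableau lam, T.toFilling = E := by
  refine ⟨⟨fun i j => (E i j).map Equiv.pnatEquivNat.symm.toEmbedding, fun h' =>
    (h.nonempty h').map, ?_, ?_, fun h' => by simp [h.outside h']⟩, ?_⟩
  · intro i j h' a ha b hb
    rw [Finset.mem_map_equiv] at ha hb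
    exact PNat.natPred_le_natPred.1 (h.row_weak h' _ ha _ hb)
  · intro i j h' a ha b hb
    rw [Finset.mem_map_equiv] at ha hb
    exact PNat.natPred_lt_natPred.1 (h.col_strict h' _ ha _ hb)
  · funext i j
    ext k
    rw [SetValuedTableau.mem_toFilling]
    simp only [Finset.mem_map_equiv]
    rfl

theorem weight_apply (T : SetValuedTableau lam) (k : ℕ) :
    T.weight k.succPNat = cnt lam T.toFilling k := by
  rw [SetValuedTableau.weight, Finsupp.finsetSum_apply, cnt, Finset.card_filter]
  refine Finset.sum_congr rfl fun c _ => ?_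
  rw [Finsupp.finsetSum_apply]
  simp only [Finsupp.single_apply]
  rw [Finset.sum_ite_eq' (T.entry c.1 c.2) k.succPNat fun _ => 1]
  simp only [SetValuedTableau.mem_toFilling]

/-- The first `n` variables. -/
def letters (n : ℕ) : Fin n ↪ ℕ+ :=
  ⟨fun k => Nat.succPNat k, fun _ _ h => Fin.ext (Nat.succPNat_injective h)⟩

theorem weight_eq_iff {n : ℕ} (T : SetValuedTableau lam) (e : Fin n →₀ ℕ) :
    T.weight = Finsupp.embDomain (letters n) e ↔
      T.toFilling ∈ tabs lam n ∧ expo n (cnt lam T.toFilling) = e := by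
  constructor
  · intro h
    have hk : ∀ k, cnt lam T.toFilling k = Finsupp.embDomain (letters n) e k.succPNat := by
      intro k
      rw [← weight_apply, h]
    refine ⟨mem_tabs.2 ⟨T.toFilling_isTableau, fun i j k hmem => ?_⟩, ?_⟩
    · by_contra hc
      have h0 : cnt lam T.toFilling k = 0 := by
        rw [hk]
        refine Finsupp.embDomain_of_notMem_range _ _ _ ?_
        rintro ⟨x, hx⟩
        have : (x : ℕ) = k := Nat.succPNat_injective hx
        omega
      rw [cnt, Finset.card_eq_zero, Finset.filter_eq_empty_iff] at h0
      exact h0 ((YoungDiagram.mem_cells (i, j)).2 (T.toFilling_isTableau.mem_shape hmem)) hmem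
    · ext k
      exact (hk k).trans (Finsupp.embDomain_apply_self (letters n) e k)
  · rintro ⟨h1, rfl⟩
    ext a
    obtain ⟨k, rfl⟩ : ∃ k : ℕ, k.succPNat = a := ⟨a.natPred, PNat.succPNat_natPred a⟩
    rw [weight_apply]
    by_cases hk : k < n
    · exact (Finsupp.embDomain_apply_self (letters n) (expo n (cnt lam T.toFilling)) ⟨k, hk⟩).symm
    · rw [cnt_eq_zero h1 (not_lt.1 hk), Finsupp.embDomain_of_notMem_range]
      rintro ⟨x, hx⟩
      have : (x : ℕ) = k := Nat.succPNat_injective hx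
      omega

theorem card_weight_eq {n : ℕ} (e : Fin n →₀ ℕ) :
    Nat.card {T : SetValuedTableau lam // T.weight = Finsupp.embDomain (letters n) e} =
      ((tabs lam n).filter fun E => expo n (cnt lam E) = e).card := by
  rw [← Fintype.card_coe, ← Nat.card_eq_fintype_card]
  refine Nat.card_congr (Equiv.ofBijective (fun T => ⟨T.1.toFilling,
    Finset.mem_filter.2 ((weight_eq_iff T.1 e).1 T.2)⟩) ⟨?_, ?_⟩)
  · intro T T' h
    exact Subtype.ext (SetValuedTableau.toFilling_injective (congrArg Subtype.val h))
  · rintro ⟨E, hE⟩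
    have hE' := Finset.mem_filter.1 hE
    obtain ⟨T, rfl⟩ := exists_toFilling_eq (mem_tabs.1 hE'.1).1
    exact ⟨⟨T, (weight_eq_iff T e).2 hE'⟩, rfl⟩

/-- Setting all variables except the first `n` to zero. -/
theorem killCompl_stableG (lam : YoungDiagram) (n : ℕ) :
    MvPowerSeries.killCompl (letters n) (stableG lam) =
      (((-1 : ℤ) ^ lam.card • grothendieck n lam : MvPolynomial (Fin n) ℤ) :
        MvPowerSeries (Fin n) ℤ) := by
  classical
  ext e
  have hdeg : (Finsupp.embDomain (letters n) e).degree = ∑ k, e k := by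
    rw [Finsupp.degree_apply, Finsupp.support_embDomain, Finset.sum_map]
    simp only [Finsupp.embDomain_apply_self]
    exact Finset.sum_subset (Finset.subset_univ _) fun x _ hx => Finsupp.notMem_support_iff.1 hx
  have hcoeff : coeff e (grothendieck n lam) = (-1) ^ (∑ k, e k) *
      (((tabs lam n).filter fun E => expo n (cnt lam E) = e).card : ℤ) := by
    rw [grothendieck, coeff_sum]
    simp only [signedMonomial_eq, coeff_monomial]
    rw [← Finset.sum_filter, Finset.sum_congr rfl
      (g := fun _ => (-1 : ℤ) ^ (∑ k, e k)), Finset.sum_const, nsmul_eq_mul, mul_comm]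
    intro E hE
    rw [← (Finset.mem_filter.1 hE).2]
    rfl
  rw [MvPowerSeries.coeff_killCompl, MvPolynomial.coeff_coe, coeff_smul, hcoeff]
  change stableG lam _ = _
  rw [stableG, card_weight_eq, hdeg, Int.negOnePow_sub, Units.val_mul,
    Int.coe_negOnePow_natCast, Int.coe_negOnePow_natCast, smul_eq_mul]
  ring

end Correspondence

/-- Every monomial involves only the first `n` variables for some large `n`. -/
theorem exists_letters (a : ℕ+ →₀ ℕ) (N : ℕ) :
    ∃ n, N ≤ n ∧ ∃ e : Fin n →₀ ℕ, Finsupp.embDomain (letters n) e = a := by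
  refine ⟨N + a.support.sup fun k => (k : ℕ), Nat.le_add_right _ _, ?_⟩
  change a ∈ Set.range (Finsupp.embDomain _)
  rw [Finsupp.mem_range_embDomain_iff]
  intro k hk
  have h1 : (k : ℕ) ≤ a.support.sup fun k => (k : ℕ) :=
    Finset.le_sup (f := fun k : ℕ+ => (k : ℕ)) hk
  refine ⟨⟨k.natPred, ?_⟩, PNat.succPNat_natPred k⟩
  have := PNat.natPred_add_one k
  omega

/-- The stable Grothendieck polynomials are linearly independent, so product expansions are
unique. -/
theorem expansion_unique {lam mu : YoungDiagram} {f g : YoungDiagram →₀ ℤ}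
    (hf : IsProductExpansion lam mu f) (hg : IsProductExpansion lam mu g) : f = g := by
  classical
  rw [← sub_eq_zero]
  set d := f - g with hd
  have h0 : d.sum (fun nu a => a • stableG nu) = 0 := by
    rw [hd, Finsupp.sum_sub_index fun _ _ _ => sub_smul _ _ _, ← hf, ← hg, sub_self]
  set n := d.support.sup fun nu => nu.colLen 0
  have h1 := congrArg (MvPowerSeries.killCompl (letters n)) h0
  rw [Finsupp.sum, map_sum, map_zero] at h1
  simp only [map_zsmul, killCompl_stableG] at h1
  have h2 : ∑ nu ∈ d.support, (d nu * (-1) ^ nu.card) • grothendieck n nu = 0 := by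
    refine MvPolynomial.coe_injective _ _ ?_
    rw [MvPolynomial.coe_zero, ← h1, ← MvPolynomial.coeToMvPowerSeries.ringHom_apply, map_sum]
    refine Finset.sum_congr rfl fun nu _ => ?_
    rw [mul_smul, map_zsmul, MvPolynomial.coeToMvPowerSeries.ringHom_apply]
  have h3 := grothendieck_independent d.support (fun nu => d nu * (-1) ^ nu.card)
    (fun nu hnu => Finset.le_sup (f := fun nu : YoungDiagram => nu.colLen 0) hnu) h2
  ext nu
  by_contra hc
  have := h3 nu (Finsupp.mem_support_iff.2 hc)
  exact (mul_ne_zero hc (pow_ne_zero _ (by norm_num))) this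

open Classical in
/-- The lattice tableaux of shape `lam` for which the content of the word, followed by `u(mu)`,
is `nu`. -/
noncomputable def contentTabs (lam mu nu : YoungDiagram) : Finset Filling :=
  (latticeTabs lam mu (lam.colLen 0 + mu.colLen 0)).filter
    fun E => cnt lam E + mu.rowLen = nu.rowLen

theorem mem_contentTabs {lam mu nu : YoungDiagram} {E : Filling} :
    E ∈ contentTabs lam mu nu ↔
      IsTableau lam E ∧ IsLattice lam mu E ∧ cnt lam E + mu.rowLen = nu.rowLen := by
  classical
  rw [contentTabs, Finset.mem_filter, mem_latticeTabs, mem_tabs]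
  constructor
  · rintro ⟨⟨⟨h1, -⟩, h2⟩, h3⟩
    exact ⟨h1, h2, h3⟩
  · rintro ⟨h1, h2, h3⟩
    refine ⟨⟨⟨h1, fun i j k hk => ?_⟩, h2⟩, h3⟩
    have h4 := h2.letter_le h1 hk
    have h5 := YoungDiagram.mem_iff_lt_colLen.1
      (lam.up_left_mem le_rfl (Nat.zero_le j) (h1.mem_shape hk))
    omega

/-- The Littlewood-Richardson rule for stable Grothendieck polynomials. -/
theorem mulCoeff_eq (lam mu nu : YoungDiagram) :
    mulCoeff lam mu nu =
      (-1) ^ (lam.card + mu.card + nu.card) * ((contentTabs lam mu nu).card : ℤ) := by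
  classical
  set N := lam.colLen 0 + mu.colLen 0 with hN
  set s := latticeTabs lam mu N with hs
  have hex : ∀ E ∈ s, ∃ nu : YoungDiagram, nu.rowLen = cnt lam E + mu.rowLen := fun E hE =>
    (exists_content hE (by omega)).imp fun _ h => h.1
  choose! content hcontent using hex
  set f : YoungDiagram →₀ ℤ := ∑ E ∈ s, Finsupp.single (content E)
    ((-1) ^ (lam.card + mu.card + (content E).card)) with hf
  have hexp : IsProductExpansion lam mu f := by
    have hsum : f.sum (fun nu a => a • stableG nu) =
        ∑ E ∈ s, (-1 : ℤ) ^ (lam.card + mu.card + (content E).card) • stableG (content E) := by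
      rw [hf, ← Finsupp.sum_finsetSum_index (h := fun nu a => a • stableG nu)
        (fun _ => zero_smul _ _) fun _ _ _ => add_smul _ _ _]
      exact Finset.sum_congr rfl fun E _ => Finsupp.sum_single_index (zero_smul _ _)
    rw [IsProductExpansion, hsum]
    ext a
    obtain ⟨n, hn, e, rfl⟩ := exists_letters a N
    rw [← MvPowerSeries.coeff_killCompl, ← MvPowerSeries.coeff_killCompl]
    congr 1
    have hs' : latticeTabs lam mu n = s := latticeTabs_eq_of_le lam mu hn
    have hmul := grothendieck_mul (lam := lam) (mu := mu) (n := n) (by omega) content (by rwa [hs'])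
    rw [map_mul, map_sum, killCompl_stableG, killCompl_stableG, ← MvPolynomial.coe_mul,
      smul_mul_smul_comm, hmul, hs']
    simp only [map_zsmul, killCompl_stableG]
    rw [← MvPolynomial.coeToMvPowerSeries.ringHom_apply, map_zsmul, map_sum, Finset.smul_sum]
    refine Finset.sum_congr rfl fun E _ => ?_
    rw [← MvPolynomial.coeToMvPowerSeries.ringHom_apply, map_zsmul, smul_smul, pow_add, pow_add,
      mul_assoc _ ((-1 : ℤ) ^ (content E).card), ← mul_pow]
    norm_num
  have h : ∃ f, IsProductExpansion lam mu f := ⟨f, hexp⟩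
  rw [mulCoeff, dif_pos h, expansion_unique h.choose_spec hexp, hf, Finsupp.finsetSum_apply]
  simp only [Finsupp.single_apply]
  rw [← Finset.sum_filter, Finset.sum_congr rfl
    (g := fun _ => (-1 : ℤ) ^ (lam.card + mu.card + nu.card)), Finset.sum_const, nsmul_eq_mul,
    mul_comm]
  · congr 3
    ext E
    rw [contentTabs, Finset.mem_filter, Finset.mem_filter]
    refine and_congr_right fun hE => ?_
    rw [← hcontent E hE]
    exact ⟨fun h => congrArg _ h, eq_of_rowLen_eq⟩
  · intro E hE
    rw [(Finset.mem_filter.1 hE).2]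

theorem mulCoeff_comm (lam mu nu : YoungDiagram) : mulCoeff lam mu nu = mulCoeff mu lam nu := by
  have : IsProductExpansion lam mu = IsProductExpansion mu lam := by
    funext f
    rw [IsProductExpansion, IsProductExpansion, mul_comm]
  unfold mulCoeff
  rw [this]

/-! ### Reading words -/

/-- The word `w`, followed by a word that contains each letter `k` exactly `c k` times, satisfies
the reverse lattice condition at all letters of `w`. -/
def LatticeRel (c : ℕ → ℕ) (w : List ℕ+) : Prop :=
  ∀ (v : ℕ) (u x : List ℕ+), w = u ++ (v + 1).succPNat :: x →
    c (v + 1) + x.count (v + 1).succPNat < c v + x.count v.succPNat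

theorem isReverseLattice_iff {w : List ℕ+} : IsReverseLattice w ↔ LatticeRel 0 w := by
  simp only [LatticeRel, Pi.zero_apply, Nat.zero_add]
  constructor
  · intro h v u x hw
    exact h v.succPNat u x hw
  · intro h i u x hw
    obtain ⟨v, rfl⟩ : ∃ v : ℕ, v.succPNat = i := ⟨i.natPred, PNat.succPNat_natPred i⟩
    exact h v u x hw

theorem latticeRel_nil (c : ℕ → ℕ) : LatticeRel c [] := by
  intro v u x h
  simp at h

theorem latticeRel_append {c : ℕ → ℕ} {w w' : List ℕ+} :
    LatticeRel c (w ++ w') ↔ LatticeRel (fun k => c k + w'.count k.succPNat) w ∧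
      LatticeRel c w' := by
  constructor
  · intro h
    constructor
    · rintro v u x rfl
      have := h v u (x ++ w') (by simp)
      simp only [List.count_append] at this
      simp only
      omega
    · rintro v u x rfl
      exact h v (w ++ u) x (by simp)
  · rintro ⟨h1, h2⟩ v u x hw
    rcases List.append_eq_append_iff.1 hw with ⟨a, rfl, ha⟩ | ⟨a, rfl, ha⟩
    · exact h2 v a x ha
    · cases a with
      | nil => exact h2 v [] x ha.symm
      | cons b a =>
        rw [List.cons_append, List.cons.injEq] at ha
        obtain ⟨rfl, rfl⟩ := ha
        have := h1 v u a rfl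
        simp only [List.count_append] at this ⊢
        omega

theorem latticeRel_sort {c : ℕ → ℕ} {s : Finset ℕ+} :
    LatticeRel c (s.sort (· ≤ ·)) ↔ ∀ v : ℕ, (v + 1).succPNat ∈ s → c (v + 1) < c v := by
  have hsplit : ∀ (v : ℕ) (u x : List ℕ+), s.sort (· ≤ ·) = u ++ (v + 1).succPNat :: x →
      x.count (v + 1).succPNat = 0 ∧ x.count v.succPNat = 0 := by
    intro v u x h
    have h1 := (Finset.sortedLT_sort s).pairwise
    rw [h, List.pairwise_append, List.pairwise_cons] at h1
    have h2 := h1.2.1.1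
    rw [List.count_eq_zero, List.count_eq_zero]
    refine ⟨fun hc => lt_irrefl _ (h2 _ hc), fun hc => ?_⟩
    have := Nat.succPNat_lt_succPNat.1 (h2 _ hc)
    omega
  constructor
  · intro h v hv
    obtain ⟨u, x, hx⟩ := List.append_of_mem ((Finset.mem_sort (· ≤ ·)).2 hv)
    have := h v u x hx
    rwa [(hsplit v u x hx).1, (hsplit v u x hx).2] at this
  · intro h v u x hx
    rw [(hsplit v u x hx).1, (hsplit v u x hx).2]
    refine h v ((Finset.mem_sort (· ≤ ·)).1 ?_)
    rw [hx]
    simp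

theorem count_range_reverse_flatMap (R : ℕ) (f : ℕ → List ℕ+) (a : ℕ+) :
    ((List.range R).reverse.flatMap f).count a = ∑ i ∈ Finset.range R, (f i).count a := by
  induction R with
  | zero => simp
  | succ R ih =>
    rw [List.range_succ, List.reverse_append, List.flatMap_append, List.count_append, ih,
      Finset.sum_range_succ]
    simp [Nat.add_comm]

theorem latticeRel_range_reverse_flatMap {c : ℕ → ℕ} (R : ℕ) (f : ℕ → List ℕ+) :
    LatticeRel c ((List.range R).reverse.flatMap f) ↔
      ∀ i < R,
        LatticeRel (fun k => c k + ∑ i' ∈ Finset.range i, (f i').count k.succPNat) (f i) := by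
  induction R with
  | zero => simp [latticeRel_nil]
  | succ R ih =>
    rw [List.range_succ, List.reverse_append, List.flatMap_append, latticeRel_append, ih]
    simp only [count_range_reverse_flatMap, List.reverse_singleton, List.flatMap_cons,
      List.flatMap_nil, List.append_nil]
    constructor
    · rintro ⟨h1, h2⟩ i hi
      rcases Nat.lt_succ_iff_lt_or_eq.1 hi with hi | rfl
      · exact h2 i hi
      · exact h1
    · exact fun h => ⟨h R (Nat.lt_succ_self R), fun i hi => h i (by omega)⟩

theorem count_sort (s : Finset ℕ+) (a : ℕ+) :
    (s.sort (· ≤ ·)).count a = if a ∈ s then 1 else 0 := by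
  rw [List.Nodup.count (Finset.sort_nodup s _)]
  simp

section Row

variable {lam : YoungDiagram} (T : SetValuedTableau lam)

theorem count_row (i m k : ℕ) :
    ((List.range m).flatMap fun j => (T.entry i j).sort (· ≤ ·)).count k.succPNat =
      ((Finset.range m).filter fun j => k ∈ T.toFilling i j).card := by
  induction m with
  | zero => simp
  | succ m ih =>
    rw [List.range_succ, List.flatMap_append, List.count_append, ih, List.flatMap_singleton,
      count_sort, Finset.range_add_one, Finset.filter_insert]
    simp only [SetValuedTableau.mem_toFilling]
    split_ifs with h
    · rw [Finset.card_insert_of_notMem (by simp)]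
    · rfl

theorem latticeRel_row {c : ℕ → ℕ} (i m : ℕ) :
    LatticeRel c ((List.range m).flatMap fun j => (T.entry i j).sort (· ≤ ·)) ↔
      ∀ j < m, ∀ v, v + 1 ∈ T.toFilling i j →
        c (v + 1) + ((Finset.range m).filter fun j' => v + 1 ∈ T.toFilling i j' ∧ j < j').card <
          c v + ((Finset.range m).filter fun j' => v ∈ T.toFilling i j' ∧ j < j').card := by
  induction m generalizing c with
  | zero => simp [latticeRel_nil]
  | succ m ih =>
    rw [List.range_succ, List.flatMap_append, latticeRel_append, ih, List.flatMap_singleton,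
      latticeRel_sort]
    have hstep : ∀ j k, j < m →
        ((Finset.range (m + 1)).filter fun j' => k ∈ T.toFilling i j' ∧ j < j').card =
        (if k.succPNat ∈ T.entry i m then 1 else 0) +
          ((Finset.range m).filter fun j' => k ∈ T.toFilling i j' ∧ j < j').card := by
      intro j k hj
      rw [Finset.range_add_one, Finset.filter_insert]
      simp only [SetValuedTableau.mem_toFilling, hj, and_true]
      split_ifs with h
      · rw [Finset.card_insert_of_notMem (by simp), Nat.add_comm]
      · rw [Nat.zero_add]
    have hlast : ∀ k,
        ((Finset.range (m + 1)).filter fun j' => k ∈ T.toFilling i j' ∧ m < j').card = 0 := by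
      intro k
      rw [Finset.card_eq_zero, Finset.filter_eq_empty_iff]
      intro x hx hc
      have := Finset.mem_range.1 hx
      omega
    simp only [count_sort, Nat.add_assoc]
    constructor
    · rintro ⟨h1, h2⟩ j hj v hv
      rcases Nat.lt_succ_iff_lt_or_eq.1 hj with hj | rfl
      · rw [hstep j _ hj, hstep j _ hj]
        exact h1 j hj v hv
      · rw [hlast, hlast]
        exact h2 v (SetValuedTableau.mem_toFilling.1 hv)
    · intro h
      refine ⟨fun j hj v hv => ?_, fun v hv => ?_⟩
      · have := h j (by omega) v hv
        rwa [hstep j _ hj, hstep j _ hj] at this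
      · have := h m (Nat.lt_succ_self m) v (SetValuedTableau.mem_toFilling.2 hv)
        rwa [hlast, hlast] at this

end Row

/-- Counting boxes row by row. -/
theorem card_filter_cells (lam : YoungDiagram) (p : ℕ → ℕ → Prop) [∀ i, DecidablePred (p i)] :
    (lam.cells.filter fun x => p x.1 x.2).card =
      ∑ i ∈ Finset.range (lam.colLen 0),
        ((Finset.range (lam.rowLen i)).filter fun j => p i j).card := by
  have hmaps : ∀ x ∈ lam.cells.filter (fun x => p x.1 x.2), x.1 ∈ Finset.range (lam.colLen 0) := by
    rintro ⟨i, j⟩ hx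
    exact Finset.mem_range.2 (YoungDiagram.mem_iff_lt_colLen.1 (lam.up_left_mem le_rfl
      (Nat.zero_le j) ((YoungDiagram.mem_cells _).1 (Finset.mem_filter.1 hx).1)))
  rw [Finset.card_eq_sum_card_fiberwise hmaps]
  refine Finset.sum_congr rfl fun i _ => ?_
  refine Finset.card_bij' (fun x _ => x.2) (fun j _ => (i, j)) ?_ ?_ ?_ ?_
  · rintro ⟨i', j⟩ hx
    obtain ⟨hx', rfl⟩ := Finset.mem_filter.1 hx
    obtain ⟨hc, hp⟩ := Finset.mem_filter.1 hx'
    exact Finset.mem_filter.2 ⟨Finset.mem_range.2 (YoungDiagram.mem_iff_lt_rowLen.1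
      ((YoungDiagram.mem_cells _).1 hc)), hp⟩
  · intro j hj
    obtain ⟨hj, hp⟩ := Finset.mem_filter.1 hj
    exact Finset.mem_filter.2 ⟨Finset.mem_filter.2 ⟨(YoungDiagram.mem_cells _).2
      (YoungDiagram.mem_iff_lt_rowLen.2 (Finset.mem_range.1 hj)), hp⟩, rfl⟩
  · rintro ⟨i', j⟩ hx
    obtain ⟨-, rfl⟩ := Finset.mem_filter.1 hx
    rfl
  · intro j _
    rfl

theorem cnt_eq_sum (lam : YoungDiagram) (E : Filling) (k : ℕ) :
    cnt lam E k = ∑ i ∈ Finset.range (lam.colLen 0),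
      ((Finset.range (lam.rowLen i)).filter fun j => k ∈ E i j).card :=
  card_filter_cells lam fun i j => k ∈ E i j

theorem cntAfter_eq_sum (lam : YoungDiagram) (E : Filling) {r : ℕ} (hr : r < lam.colLen 0)
    (j k : ℕ) :
    cntAfter lam E r j k = ∑ i ∈ Finset.range r,
      ((Finset.range (lam.rowLen i)).filter fun j => k ∈ E i j).card +
        ((Finset.range (lam.rowLen r)).filter fun j' => k ∈ E r j' ∧ j < j').card := by
  have h := card_filter_cells lam fun i j' => k ∈ E i j' ∧ (i < r ∨ i = r ∧ j < j')
  rw [cntAfter, h, ← Finset.sum_subset (Finset.range_subset_range.2 (Nat.succ_le_of_lt hr)),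
    Finset.sum_range_succ]
  · congr 1
    · refine Finset.sum_congr rfl fun i hi => ?_
      have hi := Finset.mem_range.1 hi
      simp [hi]
    · simp
  · intro i _ hi
    rw [Finset.mem_range, not_lt] at hi
    rw [Finset.card_eq_zero, Finset.filter_eq_empty_iff]
    intro x _ hc
    omega

theorem count_word {lam : YoungDiagram} (T : SetValuedTableau lam) (k : ℕ) :
    T.word.count k.succPNat = cnt lam T.toFilling k := by
  rw [SetValuedTableau.word, count_range_reverse_flatMap, cnt_eq_sum]
  simp only [count_row]

theorem count_rowWord (mu : YoungDiagram) (k : ℕ) :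
    (rowWord mu).count k.succPNat = mu.rowLen k := by
  rw [rowWord, count_range_reverse_flatMap]
  simp only [List.count_replicate, beq_iff_eq, Nat.succPNat_injective.eq_iff]
  rw [Finset.sum_ite_eq' (Finset.range (mu.colLen 0)) k]
  split_ifs with h
  · rfl
  · exact (rowLen_eq_zero_of_le (not_lt.1 fun hc => h (Finset.mem_range.2 hc))).symm

theorem latticeRel_rowWord (mu : YoungDiagram) : LatticeRel 0 (rowWord mu) := by
  rw [rowWord, latticeRel_range_reverse_flatMap]
  intro i hi v u x hx
  have hmem : (v + 1).succPNat ∈ List.replicate (mu.rowLen i) i.succPNat := by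
    rw [hx]
    simp
  obtain rfl : v + 1 = i := Nat.succPNat_injective (List.eq_of_mem_replicate hmem)
  have hlen : u.length + x.length + 1 = mu.rowLen (v + 1) := by
    have := congrArg List.length hx
    simp only [List.length_replicate, List.length_append, List.length_cons] at this
    omega
  have hcount : x.count (v + 1).succPNat ≤ x.length := List.count_le_length
  have hanti := mu.rowLen_anti v (v + 1) (Nat.le_succ v)
  simp only [List.count_replicate, beq_iff_eq, Nat.succPNat_injective.eq_iff, Pi.zero_apply,
    Finset.sum_ite_eq', Finset.mem_range, lt_irrefl, if_false, Nat.lt_succ_self, if_true]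
  omega

theorem isReverseLattice_word_iff {lam : YoungDiagram} (T : SetValuedTableau lam)
    (mu : YoungDiagram) :
    IsReverseLattice (T.word ++ rowWord mu) ↔ IsLattice lam mu T.toFilling := by
  rw [isReverseLattice_iff, latticeRel_append, and_iff_left (latticeRel_rowWord mu),
    SetValuedTableau.word, latticeRel_range_reverse_flatMap]
  simp only [latticeRel_row, count_rowWord, count_row, Pi.zero_apply, Nat.zero_add, IsLattice]
  constructor
  · intro h r j v hv
    have hmem := T.toFilling_isTableau.mem_shape hv
    have hr := YoungDiagram.mem_iff_lt_colLen.1 (lam.up_left_mem le_rfl (Nat.zero_le j) hmem)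
    have := h r hr j (YoungDiagram.mem_iff_lt_rowLen.1 hmem) v hv
    rw [LatticeAt, cntAfter_eq_sum _ _ hr, cntAfter_eq_sum _ _ hr]
    omega
  · intro h r hr j _ v hv
    have := h r j v hv
    rw [LatticeAt, cntAfter_eq_sum _ _ hr, cntAfter_eq_sum _ _ hr] at this
    omega

theorem hasContent_word_iff {lam : YoungDiagram} (T : SetValuedTableau lam)
    (mu nu : YoungDiagram) :
    HasContent (T.word ++ rowWord mu) nu ↔ cnt lam T.toFilling + mu.rowLen = nu.rowLen := by
  rw [HasContent, funext_iff]
  simp only [List.count_append, count_word, count_rowWord, Pi.add_apply]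

/-- The set-valued tableaux counted by the Littlewood-Richardson rule, as fillings. -/
theorem mem_contentTabs_iff {lam : YoungDiagram} (T : SetValuedTableau lam)
    (mu nu : YoungDiagram) :
    T.toFilling ∈ contentTabs lam mu nu ↔
      IsReverseLattice (T.word ++ rowWord mu) ∧ HasContent (T.word ++ rowWord mu) nu := by
  rw [mem_contentTabs, isReverseLattice_word_iff, hasContent_word_iff,
    and_iff_right T.toFilling_isTableau]

/-! ### Coproduct coefficients of rectangles -/

theorem mem_rect {a b i j : ℕ} : (i, j) ∈ rect a b ↔ i < a ∧ j < b := by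
  rw [← YoungDiagram.mem_cells]
  simp [rect]

theorem rowLen_rect (a b i : ℕ) : (rect a b).rowLen i = if i < a then b else 0 := by
  rw [rowLen_eq_iff]
  intro j
  rw [mem_rect]
  split_ifs with h <;> simp [h]

theorem card_rect (a b : ℕ) : (rect a b).card = a * b := by
  simp [rect, YoungDiagram.card]

theorem rowLen_attach {p q : ℕ} {lam sigma : YoungDiagram} (hl : lam ≤ rect p q)
    (hs : sigma ≤ rect p q) (i : ℕ) :
    (attach p q lam sigma hl hs).rowLen i =
      if i < p then q + sigma.rowLen i else lam.rowLen (i - p) := by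
  rw [rowLen_eq_iff]
  intro j
  have hl' : ∀ x y, (x, y) ∈ lam → x < p ∧ y < q := fun x y h => mem_rect.1 (hl h)
  have hs' : ∀ x y, (x, y) ∈ sigma → x < p ∧ y < q := fun x y h => mem_rect.1 (hs h)
  rw [← YoungDiagram.mem_cells]
  simp only [attach, rect, Finset.mem_union, Finset.mem_product, Finset.mem_range,
    Finset.mem_image, YoungDiagram.mem_cells, Prod.mk.injEq, Prod.exists]
  split_ifs with hi
  · constructor
    · rintro ((h | ⟨x, y, h, rfl, rfl⟩) | ⟨x, y, h, rfl, rfl⟩)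
      · omega
      · have := YoungDiagram.mem_iff_lt_rowLen.1 h
        omega
      · omega
    · intro h
      by_cases hj : j < q
      · exact Or.inl (Or.inl ⟨hi, hj⟩)
      · refine Or.inl (Or.inr ⟨i, j - q, YoungDiagram.mem_iff_lt_rowLen.2 ?_, rfl, ?_⟩) <;> omega
  · constructor
    · rintro ((h | ⟨x, y, h, rfl, rfl⟩) | ⟨x, y, h, rfl, rfl⟩)
      · omega
      · have := (hs' _ _ h).1
        omega
      · rw [Nat.add_sub_cancel_left]
        exact YoungDiagram.mem_iff_lt_rowLen.1 h
    · intro h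
      exact Or.inr ⟨i - p, j, YoungDiagram.mem_iff_lt_rowLen.2 h, by omega, rfl⟩

theorem colLen_le_of_le_rect {a b : ℕ} {lam : YoungDiagram} (h : lam ≤ rect a b) (j : ℕ) :
    lam.colLen j ≤ a := by
  by_contra hc
  have := mem_rect.1 (h (YoungDiagram.mem_iff_lt_colLen.2 (not_le.1 hc)))
  omega

theorem rowLen_le_of_le_rect {a b : ℕ} {lam : YoungDiagram} (h : lam ≤ rect a b) (i : ℕ) :
    lam.rowLen i ≤ b := by
  by_contra hc
  have := mem_rect.1 (h (YoungDiagram.mem_iff_lt_rowLen.2 (not_le.1 hc)))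
  omega

theorem card_attach {p q : ℕ} {lam sigma : YoungDiagram} (hl : lam ≤ rect p q)
    (hs : sigma ≤ rect p q) :
    (attach p q lam sigma hl hs).card = p * q + sigma.card + lam.card := by
  have h0 : (attach p q lam sigma hl hs).colLen 0 ≤ p + p := by
    refine colLen_zero_le ?_
    rw [rowLen_attach, if_neg (by omega), Nat.add_sub_cancel]
    exact rowLen_eq_zero_of_le (colLen_le_of_le_rect hl 0)
  rw [card_eq_sum_rowLen _ h0, Finset.sum_range_add,
    card_eq_sum_rowLen lam (colLen_le_of_le_rect hl 0),
    card_eq_sum_rowLen sigma (colLen_le_of_le_rect hs 0)]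
  congr 1
  · rw [show p * q = ∑ _i ∈ Finset.range p, q by simp, ← Finset.sum_add_distrib]
    refine Finset.sum_congr rfl fun i hi => ?_
    rw [rowLen_attach, if_pos (Finset.mem_range.1 hi)]
  · refine Finset.sum_congr rfl fun i _ => ?_
    rw [rowLen_attach, if_neg (by omega), Nat.add_sub_cancel_left]

theorem mem_rotated {a b : ℕ} {lam : YoungDiagram} (h : lam ≤ rect a b) {i j : ℕ} :
    (i, j) ∈ rotated a b lam ↔ i < a ∧ j < b ∧ (a - 1 - i, b - 1 - j) ∈ lam := by
  simp only [rotated, Finset.mem_image, YoungDiagram.mem_cells, Prod.exists, Prod.mk.injEq]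
  constructor
  · rintro ⟨x, y, hxy, rfl, rfl⟩
    obtain ⟨hx, hy⟩ := mem_rect.1 (h hxy)
    refine ⟨by omega, by omega, ?_⟩
    rwa [show a - 1 - (a - 1 - x) = x by omega, show b - 1 - (b - 1 - y) = y by omega]
  · rintro ⟨hi, hj, hmem⟩
    exact ⟨_, _, hmem, by omega, by omega⟩

theorem mem_rotated' {a b : ℕ} {lam : YoungDiagram} (h : lam ≤ rect a b) {i j : ℕ} :
    (i, j) ∈ rotated a b lam ↔ i < a ∧ j < b ∧ a ≤ i + lam.colLen (b - 1 - j) := by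
  rw [mem_rotated h, YoungDiagram.mem_iff_lt_colLen]
  refine and_congr_right fun hi => and_congr_right fun _ => ?_
  omega

theorem mem_iff_lt_card {s : Finset ℕ} (hs : ∀ j ∈ s, ∀ j' < j, j' ∈ s) {j : ℕ} :
    j ∈ s ↔ j < s.card := by
  constructor
  · intro hj
    have : Finset.range (j + 1) ⊆ s := by
      intro x hx
      rcases Nat.lt_succ_iff_lt_or_eq.1 (Finset.mem_range.1 hx) with h | rfl
      · exact hs j hj x h
      · exact hj
    simpa using Finset.card_le_card this
  · intro hj
    by_contra hc
    have : s ⊆ Finset.range j := by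
      intro x hx
      rw [Finset.mem_range]
      by_contra hxj
      rcases Nat.eq_or_lt_of_le (not_lt.1 hxj) with rfl | h
      · exact hc hx
      · exact hc (hs x hx j h)
    have := Finset.card_le_card this
    rw [Finset.card_range] at this
    omega

theorem mem_iff_le_add_card {s : Finset ℕ} {b : ℕ} (hb : ∀ j ∈ s, j < b)
    (hs : ∀ j ∈ s, ∀ j', j < j' → j' < b → j' ∈ s) {j : ℕ} (hj : j < b) :
    j ∈ s ↔ b ≤ j + s.card := by
  constructor
  · intro hmem
    have : Finset.Ico j b ⊆ s := by
      intro x hx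
      obtain ⟨h1, h2⟩ := Finset.mem_Ico.1 hx
      rcases Nat.eq_or_lt_of_le h1 with rfl | h
      · exact hmem
      · exact hs j hmem x h h2
    have := Finset.card_le_card this
    rw [Nat.card_Ico] at this
    omega
  · intro hle
    by_contra hc
    have : s ⊆ Finset.Ioo j b := by
      intro x hx
      refine Finset.mem_Ioo.2 ⟨?_, hb x hx⟩
      by_contra hxj
      rcases Nat.eq_or_lt_of_le (not_lt.1 hxj) with rfl | h
      · exact hc hx
      · exact hc (hs x hx j h hj)
    have := Finset.card_le_card this
    rw [Nat.card_Ioo] at this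
    omega

/-- The only possible lattice tableau of rectangular shape `rect a b`, relative to the rectangle
with `p` rows: the boxes of `sigma` contain their row index, and the boxes of the rotation of `lam`
contain `p` plus the height above them in this rotation. -/
def rectFilling (a b p : ℕ) (lam sigma : YoungDiagram) : Filling := fun i j =>
  (if (i, j) ∈ sigma then {i} else ∅) ∪
    if (i, j) ∈ rotated a b lam then {p + (i + lam.colLen (b - 1 - j) - a)} else ∅

theorem mem_rectFilling {a b p : ℕ} {lam sigma : YoungDiagram} (h : lam ≤ rect a b) {i j k : ℕ} :
    k ∈ rectFilling a b p lam sigma i j ↔ (i, j) ∈ sigma ∧ k = i ∨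
      (i, j) ∈ rotated a b lam ∧ k + a = p + i + lam.colLen (b - 1 - j) := by
  unfold rectFilling
  rw [Finset.mem_union]
  refine or_congr ?_ ?_
  · split_ifs with h1 <;> simp [h1]
  · split_ifs with h1
    · have := ((mem_rotated' h).1 h1).2.2
      rw [Finset.mem_singleton]
      simp only [h1, true_and]
      omega
    · simp [h1]

section Unique

variable {a b p q : ℕ} {lam sigma : YoungDiagram} {E : Filling}

theorem eq_row_of_lt (hT : IsTableau (rect a b) E) (hL : IsLattice (rect a b) (rect p q) E)
    {i j k : ℕ} (hk : k ∈ E i j) (hkp : k < p) : k = i := by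
  induction i using Nat.strong_induction_on generalizing j k with
  | _ i ih =>
    refine le_antisymm ?_ (hT.row_index_le hk)
    cases k with
    | zero => exact Nat.zero_le _
    | succ v =>
      have h1 := hL i j v hk
      rw [LatticeAt, rowLen_rect, rowLen_rect, if_pos hkp, if_pos (by omega)] at h1
      have h3 : 0 < cntAfter (rect a b) E i j v := by omega
      obtain ⟨x, hx⟩ := Finset.card_pos.1 h3
      obtain ⟨-, hx1, hx2⟩ := Finset.mem_filter.1 hx
      rcases hx2 with hx2 | ⟨hx2, hx3⟩
      · have := ih _ hx2 hx1 (by omega)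
        omega
      · rw [hx2] at hx1
        have := hT.row_le hx3 hk hx1
        omega

theorem mem_iff_of_lt (hT : IsTableau (rect a b) E) (hL : IsLattice (rect a b) (rect p q) E)
    (hcs : ∀ k < p, cnt (rect a b) E k = sigma.rowLen k)
    {i j k : ℕ} (hkp : k < p) : k ∈ E i j ↔ (i, j) ∈ sigma ∧ k = i := by
  have key : ∀ i < p, ∀ j, i ∈ E i j ↔ (i, j) ∈ sigma := by
    intro i hi j
    set s := (Finset.range b).filter fun j => i ∈ E i j with hsdef
    have hmem : ∀ j, j ∈ s ↔ i ∈ E i j := by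
      intro j
      rw [hsdef, Finset.mem_filter, and_iff_right_iff_imp, Finset.mem_range]
      exact fun h => (mem_rect.1 (hT.mem_shape h)).2
    have hlow : ∀ j ∈ s, ∀ j' < j, j' ∈ s := by
      intro j hj j' hj'
      rw [hmem] at hj ⊢
      obtain ⟨c, hc⟩ := hT.nonempty ((rect a b).up_left_mem le_rfl hj'.le (hT.mem_shape hj))
      have := hT.row_le hj' hc hj
      have := eq_row_of_lt hT hL hc (by omega)
      rwa [this] at hc
    have hcard : s.card = sigma.rowLen i := by
      rw [← hcs i hi, cnt]
      refine Finset.card_bij' (fun j _ => (i, j)) (fun x _ => x.2) ?_ ?_ ?_ ?_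
      · intro j hj
        have := (hmem j).1 hj
        exact Finset.mem_filter.2 ⟨hT.mem_shape this, this⟩
      · rintro ⟨x, y⟩ hx
        have hx' := (Finset.mem_filter.1 hx).2
        have := eq_row_of_lt hT hL hx' hi
        simp only at this hx'
        rw [← this] at hx'
        exact (hmem y).2 hx'
      · intro j _
        rfl
      · rintro ⟨x, y⟩ hx
        have := eq_row_of_lt hT hL (Finset.mem_filter.1 hx).2 hi
        simp only at this
        rw [this]
    rw [← hmem, mem_iff_lt_card hlow, hcard, YoungDiagram.mem_iff_lt_rowLen]
  constructor
  · intro h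
    have := eq_row_of_lt hT hL h hkp
    subst this
    exact ⟨(key k hkp j).1 h, rfl⟩
  · rintro ⟨h, rfl⟩
    exact (key k hkp j).2 h

/-- The box `(i, j)` contains a letter that is at least `p`. -/
def IsLarge (p : ℕ) (E : Filling) (i j : ℕ) : Prop := ∃ k, p + k ∈ E i j

/-- The row of the first box of column `j` with a letter that is at least `p` (or `a`, if there is
no such box in the first `a` rows). -/
noncomputable def largeRow (a p : ℕ) (E : Filling) (j : ℕ) : ℕ :=
  sInf {i | IsLarge p E i j ∨ a ≤ i}

theorem largeRow_le_bound (j : ℕ) : largeRow a p E j ≤ a :=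
  Nat.sInf_le (s := {i | IsLarge p E i j ∨ a ≤ i}) (Or.inr le_rfl)

theorem largeRow_le {i j : ℕ} (h : IsLarge p E i j) : largeRow a p E j ≤ i :=
  Nat.sInf_le (s := {i | IsLarge p E i j ∨ a ≤ i}) (Or.inl h)

theorem isLarge_of_le (hT : IsTableau (rect a b) E) {i j : ℕ} (hi : largeRow a p E j ≤ i)
    (hia : i < a) (hj : j < b) : IsLarge p E i j := by
  have h0 : IsLarge p E (largeRow a p E j) j ∨ a ≤ largeRow a p E j :=
    Nat.sInf_mem (s := {i | IsLarge p E i j ∨ a ≤ i}) ⟨a, Or.inr le_rfl⟩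
  rcases h0 with ⟨k, hk⟩ | h0
  · rcases Nat.eq_or_lt_of_le hi with heq | hlt
    · exact ⟨k, heq ▸ hk⟩
    · obtain ⟨c, hc⟩ := hT.nonempty (mem_rect.2 ⟨hia, hj⟩)
      have := hT.col_lt hlt hk hc
      exact ⟨c - p, by rwa [show p + (c - p) = c by omega]⟩
  · omega

theorem largeRow_anti (hT : IsTableau (rect a b) E) {j j' : ℕ} (hjj : j ≤ j') (hj : j' < b) :
    largeRow a p E j' ≤ largeRow a p E j := by
  rcases Nat.eq_or_lt_of_le hjj with rfl | hlt
  · exact le_rfl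
  have hle := largeRow_le_bound (a := a) (p := p) (E := E) j
  have hle' := largeRow_le_bound (a := a) (p := p) (E := E) j'
  by_cases h : largeRow a p E j < a
  · obtain ⟨k, hk⟩ := isLarge_of_le (p := p) hT le_rfl h (hlt.trans hj)
    obtain ⟨c, hc⟩ := hT.nonempty (mem_rect.2 ⟨h, hj⟩)
    have := hT.row_le hlt hk hc
    exact largeRow_le ⟨c - p, by rwa [show p + (c - p) = c by omega]⟩
  · omega

theorem le_add_of_large (hT : IsTableau (rect a b) E) {i j k : ℕ} (hk : p + k ∈ E i j) :
    i ≤ k + largeRow a p E j := by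
  induction i generalizing k with
  | zero => exact Nat.zero_le _
  | succ i ih =>
    have hmem := mem_rect.1 (hT.mem_shape hk)
    by_cases h : largeRow a p E j ≤ i
    · obtain ⟨k', hk'⟩ := isLarge_of_le (p := p) hT h (by omega) hmem.2
      have := ih hk'
      have := hT.col_lt (Nat.lt_succ_self i) hk' hk
      omega
    · omega

/-- The letters that are at least `p` are determined by the height of their box in its column. -/
theorem add_largeRow_eq (hT : IsTableau (rect a b) E) (hL : IsLattice (rect a b) (rect p q) E)
    {i j k : ℕ} (hk : p + k ∈ E i j) : k + largeRow a p E j = i := by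
  induction i using Nat.strong_induction_on generalizing j k with
  | _ i ihi =>
  obtain ⟨m, hm⟩ : ∃ m, m = b - j := ⟨_, rfl⟩
  induction m using Nat.strong_induction_on generalizing j k with
  | _ m ihm =>
  subst hm
  obtain ⟨hia, hjb⟩ := mem_rect.1 (hT.mem_shape hk)
  have hlater : ∀ x y, (x < i ∨ x = i ∧ j < y) → ∀ l, p + l ∈ E x y →
      l + largeRow a p E y = x := by
    rintro x y (hx | ⟨rfl, hy⟩) l hl
    · exact ihi x hx hl
    · have := (mem_rect.1 (hT.mem_shape hl)).2
      exact ihm (b - y) (by omega) hl rfl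
  have hlow := le_add_of_large hT hk
  have htop : largeRow a p E j ≤ i := largeRow_le ⟨k, hk⟩
  by_contra hne
  obtain ⟨k, rfl⟩ : ∃ k', k = k' + 1 := ⟨k - 1, by omega⟩
  have h1 := hL i j (p + k) hk
  rw [LatticeAt, rowLen_rect, rowLen_rect, if_neg (by omega), if_neg (by omega), Nat.zero_add,
    Nat.zero_add] at h1
  -- The box below a later box with `p + k` contains `p + k + 1` and is also read later.
  refine absurd h1 (not_lt.2 ?_)
  refine Finset.card_le_card_of_injOn (fun x => (x.1 + 1, x.2)) ?_ ?_
  · rintro ⟨x, y⟩ hx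
    obtain ⟨-, hx1, hx2⟩ := Finset.mem_filter.1 (Finset.mem_coe.1 hx)
    simp only at hx1 hx2
    have hyb := (mem_rect.1 (hT.mem_shape hx1)).2
    have h2 := hlater x y hx2 k hx1
    have hlt : x < i := by
      rcases hx2 with hx2 | ⟨rfl, hx2⟩
      · exact hx2
      · have := hT.row_le hx2 hk hx1
        omega
    have hafter : x + 1 < i ∨ x + 1 = i ∧ j < y := by
      by_contra hc
      have hy : y ≤ j := by omega
      have := largeRow_anti (p := p) hT hy hjb
      omega
    obtain ⟨l, hl⟩ := isLarge_of_le (p := p) (i := x + 1) hT (by omega) (by omega) hyb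
    have h3 := hlater _ _ hafter l hl
    obtain rfl : l = k + 1 := by omega
    exact Finset.mem_coe.2 (Finset.mem_filter.2 ⟨hT.mem_shape hl, hl, hafter⟩)
  · rintro ⟨x, y⟩ _ ⟨x', y'⟩ _ h
    simp only [Prod.mk.injEq] at h ⊢
    omega

theorem large_mem_iff (hT : IsTableau (rect a b) E) (hL : IsLattice (rect a b) (rect p q) E)
    {i j k : ℕ} : p + k ∈ E i j ↔ i < a ∧ j < b ∧ k + largeRow a p E j = i := by
  constructor
  · intro h
    exact ⟨(mem_rect.1 (hT.mem_shape h)).1, (mem_rect.1 (hT.mem_shape h)).2,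
      add_largeRow_eq hT hL h⟩
  · rintro ⟨hi, hj, h⟩
    obtain ⟨l, hl⟩ := isLarge_of_le (p := p) (i := i) hT (by omega) hi hj
    have := add_largeRow_eq hT hL hl
    rwa [show k = l by omega]

theorem mem_lam_iff (hT : IsTableau (rect a b) E) (hL : IsLattice (rect a b) (rect p q) E)
    (hcl : ∀ k, cnt (rect a b) E (p + k) = lam.rowLen k) {j k : ℕ} (hj : j < b) :
    (k, b - 1 - j) ∈ lam ↔ k + largeRow a p E j < a := by
  set s := (Finset.range b).filter fun j => k + largeRow a p E j < a with hsdef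
  have hmem : ∀ {j}, j ∈ s ↔ j < b ∧ k + largeRow a p E j < a := by
    intro j
    rw [hsdef, Finset.mem_filter, Finset.mem_range]
  have hcard : s.card = lam.rowLen k := by
    rw [← hcl k, cnt]
    refine Finset.card_bij' (fun j _ => (k + largeRow a p E j, j)) (fun x _ => x.2) ?_ ?_ ?_ ?_
    · intro j hj
      rw [hmem] at hj
      exact Finset.mem_filter.2 ⟨mem_rect.2 ⟨hj.2, hj.1⟩,
        (large_mem_iff hT hL).2 ⟨hj.2, hj.1, rfl⟩⟩
    · rintro ⟨x, y⟩ hx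
      have := (large_mem_iff hT hL).1 (Finset.mem_filter.1 hx).2
      simp only at this
      exact hmem.2 ⟨this.2.1, this.2.2.trans_lt this.1⟩
    · intro j _
      rfl
    · rintro ⟨x, y⟩ hx
      have := (large_mem_iff hT hL).1 (Finset.mem_filter.1 hx).2
      simp only at this
      rw [← this.2.2]
  have hup := mem_iff_le_add_card (s := s) (b := b) (fun j hj => (hmem.1 hj).1)
    (fun j hj j' hjj hj' => hmem.2 ⟨hj', by
      have := largeRow_anti (p := p) hT hjj.le hj'
      have := (hmem.1 hj).2
      omega⟩) hj
  rw [hmem, and_iff_right hj, hcard] at hup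
  rw [hup, YoungDiagram.mem_iff_lt_rowLen]
  omega

theorem lam_le_rect (hT : IsTableau (rect a b) E) (hL : IsLattice (rect a b) (rect p q) E)
    (hcl : ∀ k, cnt (rect a b) E (p + k) = lam.rowLen k) : lam ≤ rect a b := by
  rintro ⟨k, x⟩ hx
  have hx' : (k, x) ∈ lam := hx
  have hlt := YoungDiagram.mem_iff_lt_rowLen.1 hx'
  have hb : lam.rowLen k ≤ b := by
    rw [← hcl k, cnt]
    refine (Finset.card_le_card_of_injOn (t := Finset.range b) Prod.snd ?_ ?_).trans
      (Finset.card_range b).le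
    · rintro ⟨x, y⟩ hx
      have := (large_mem_iff hT hL).1 (Finset.mem_filter.1 (Finset.mem_coe.1 hx)).2
      exact Finset.mem_coe.2 (Finset.mem_range.2 this.2.1)
    · rintro ⟨x, y⟩ hx ⟨x', y'⟩ hx' hyy
      have h1 := (large_mem_iff hT hL).1 (Finset.mem_filter.1 (Finset.mem_coe.1 hx)).2
      have h2 := (large_mem_iff hT hL).1 (Finset.mem_filter.1 (Finset.mem_coe.1 hx')).2
      simp only at h1 h2 hyy
      subst hyy
      rw [Prod.mk.injEq]
      omega
  have := mem_lam_iff hT hL hcl (k := k) (j := b - 1 - x) (by omega)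
  rw [show b - 1 - (b - 1 - x) = x by omega] at this
  have := this.1 hx'
  exact mem_rect.2 ⟨by omega, by omega⟩

theorem colLen_add_largeRow (hT : IsTableau (rect a b) E)
    (hL : IsLattice (rect a b) (rect p q) E)
    (hcl : ∀ k, cnt (rect a b) E (p + k) = lam.rowLen k) {j : ℕ} (hj : j < b) :
    lam.colLen (b - 1 - j) + largeRow a p E j = a := by
  have h : ∀ k, k < lam.colLen (b - 1 - j) ↔ k + largeRow a p E j < a := by
    intro k
    rw [← mem_lam_iff hT hL hcl hj, YoungDiagram.mem_iff_lt_colLen]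
  have h1 := h (lam.colLen (b - 1 - j))
  have h2 := h (a - largeRow a p E j)
  have h3 := largeRow_le_bound (a := a) (p := p) (E := E) j
  have h4 := h (lam.colLen (b - 1 - j) - 1)
  omega

theorem eq_rectFilling (hT : IsTableau (rect a b) E) (hL : IsLattice (rect a b) (rect p q) E)
    (hs : sigma ≤ rect p q) (hcs : ∀ k < p, cnt (rect a b) E k = sigma.rowLen k)
    (hcl : ∀ k, cnt (rect a b) E (p + k) = lam.rowLen k) :
    E = rectFilling a b p lam sigma := by
  have hle := lam_le_rect hT hL hcl
  funext i j
  ext k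
  rw [mem_rectFilling hle]
  by_cases hkp : k < p
  · rw [mem_iff_of_lt hT hL hcs hkp, or_iff_left]
    rintro ⟨h1, h2⟩
    have := ((mem_rotated' hle).1 h1).2.2
    omega
  · obtain ⟨l, rfl⟩ : ∃ l, k = p + l := ⟨k - p, by omega⟩
    rw [large_mem_iff hT hL, or_iff_right, mem_rotated' hle]
    · by_cases hj : j < b
      · have := colLen_add_largeRow hT hL hcl hj
        omega
      · simp [hj]
    · rintro ⟨h1, h2⟩
      have := (mem_rect.1 (hs h1)).1
      omega

theorem rookComplementary_of_lattice (hT : IsTableau (rect a b) E)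
    (hL : IsLattice (rect a b) (rect p q) E) (hs : sigma ≤ rect p q)
    (hcs : ∀ k < p, cnt (rect a b) E k = sigma.rowLen k)
    (hcl : ∀ k, cnt (rect a b) E (p + k) = lam.rowLen k) :
    RookComplementary a b sigma lam := by
  have hle := lam_le_rect hT hL hcl
  have hsmall : ∀ {i j}, (i, j) ∈ sigma → i ∈ E i j ∧ i < p := by
    intro i j h
    have hi := (mem_rect.1 (hs h)).1
    exact ⟨(mem_iff_of_lt hT hL hcs hi).2 ⟨h, rfl⟩, hi⟩
  have hlarge : ∀ {i j}, (i, j) ∈ rotated a b lam ↔ IsLarge p E i j := by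
    intro i j
    rw [mem_rotated' hle]
    constructor
    · rintro ⟨hi, hj, h⟩
      have := colLen_add_largeRow hT hL hcl hj
      exact isLarge_of_le hT (by omega) hi hj
    · rintro ⟨k, hk⟩
      obtain ⟨hi, hj, h⟩ := (large_mem_iff hT hL).1 hk
      have := colLen_add_largeRow hT hL hcl hj
      exact ⟨hi, hj, by omega⟩
  refine ⟨fun x hx => hT.mem_shape (hsmall hx).1, hle, ?_, ?_⟩
  · ext ⟨i, j⟩
    rw [Finset.mem_union, YoungDiagram.mem_cells, YoungDiagram.mem_cells, hlarge]
    constructor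
    · rintro (h | ⟨k, hk⟩)
      · exact hT.mem_shape (hsmall h).1
      · exact hT.mem_shape hk
    · intro h
      obtain ⟨k, hk⟩ := hT.nonempty h
      by_cases hkp : k < p
      · exact Or.inl ((mem_iff_of_lt hT hL hcs hkp).1 hk).1
      · exact Or.inr ⟨k - p, by rwa [show p + (k - p) = k by omega]⟩
  · -- a box with a large letter has no box with a small letter to its right or below it
    have key : ∀ {i j i' j'}, IsLarge p E i j → (i', j') ∈ sigma →
        ¬ (i = i' ∧ j < j') ∧ ¬ (j = j' ∧ i < i') := by
      rintro i j i' j' ⟨k, hk⟩ h'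
      obtain ⟨h1, h2⟩ := hsmall h'
      constructor
      · rintro ⟨rfl, hlt⟩
        have := hT.row_le hlt hk h1
        omega
      · rintro ⟨rfl, hlt⟩
        have := hT.col_lt hlt hk h1
        omega
    rintro ⟨i, j⟩ hc ⟨i', j'⟩ hd h
    rw [Finset.mem_inter, YoungDiagram.mem_cells, hlarge] at hc hd
    have h1 := key hc.2 hd.1
    have h2 := key hd.2 hc.1
    rw [Prod.mk.injEq]
    simp only at h
    omega

end Unique

section Existence

variable {a b p q : ℕ} {lam sigma : YoungDiagram}

theorem rectFilling_isTableau (hs : sigma ≤ rect p q) (h : RookComplementary a b sigma lam) :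
    IsTableau (rect a b) (rectFilling a b p lam sigma) := by
  obtain ⟨hsab, hlab, hunion, hrook⟩ := h
  have hrot : ∀ {i j}, (i, j) ∈ rotated a b lam ↔ i < a ∧ j < b ∧
      a ≤ i + lam.colLen (b - 1 - j) := mem_rotated' hlab
  have hcol : ∀ j, lam.colLen (b - 1 - j) ≤ lam.colLen (b - 1 - (j + 1)) := fun j =>
    lam.colLen_anti _ _ (by omega)
  refine ⟨?_, ?_, ?_, ?_⟩
  · intro i j hij
    have : (i, j) ∈ sigma.cells ∪ rotated a b lam := by
      rw [hunion]
      exact hij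
    rcases Finset.mem_union.1 this with h | h
    · exact ⟨i, (mem_rectFilling hlab).2 (Or.inl ⟨h, rfl⟩)⟩
    · have := (hrot.1 h).2.2
      exact ⟨p + i + lam.colLen (b - 1 - j) - a,
        (mem_rectFilling hlab).2 (Or.inr ⟨h, by omega⟩)⟩
  · intro i j hij x hx y hy
    obtain ⟨hi, hj⟩ := mem_rect.1 hij
    rw [mem_rectFilling hlab] at hx hy
    rcases hx with ⟨hx, rfl⟩ | ⟨hx, hx'⟩ <;> rcases hy with ⟨hy, rfl⟩ | ⟨hy, hy'⟩
    · exact le_rfl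
    · have := (mem_rect.1 (hs hx)).1
      have := (hrot.1 hy).2.2
      omega
    · have h1 : (y, j) ∈ sigma := sigma.up_left_mem le_rfl (Nat.le_succ j) hy
      have h2 : (y, j + 1) ∈ rotated a b lam := by
        rw [hrot] at hx ⊢
        have := hcol j
        exact ⟨hi, hj, by omega⟩
      have := hrook (y, j) (Finset.mem_inter.2 ⟨h1, hx⟩) (y, j + 1)
        (Finset.mem_inter.2 ⟨hy, h2⟩) (Or.inl rfl)
      simp at this
    · have := hcol j
      omega
  · intro i j hij x hx y hy
    obtain ⟨hi, hj⟩ := mem_rect.1 hij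
    rw [mem_rectFilling hlab] at hx hy
    rcases hx with ⟨hx, rfl⟩ | ⟨hx, hx'⟩ <;> rcases hy with ⟨hy, rfl⟩ | ⟨hy, hy'⟩
    · exact Nat.lt_succ_self _
    · have := (mem_rect.1 (hs hx)).1
      have := (hrot.1 hy).2.2
      omega
    · have h1 : (i, j) ∈ sigma := sigma.up_left_mem (Nat.le_succ i) le_rfl hy
      have h2 : (i + 1, j) ∈ rotated a b lam := by
        rw [hrot] at hx ⊢
        exact ⟨hi, hj, by omega⟩
      have := hrook (i, j) (Finset.mem_inter.2 ⟨h1, hx⟩) (i + 1, j)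
        (Finset.mem_inter.2 ⟨hy, h2⟩) (Or.inr rfl)
      simp at this
    · omega
  · intro i j hij
    rw [Finset.eq_empty_iff_forall_notMem]
    intro x hx
    rcases (mem_rectFilling hlab).1 hx with ⟨h1, -⟩ | ⟨h1, -⟩
    · exact hij (hsab h1)
    · rw [hrot] at h1
      exact hij (mem_rect.2 ⟨h1.1, h1.2.1⟩)

theorem cnt_rectFilling_of_lt (h : RookComplementary a b sigma lam)
    {k : ℕ} (hk : k < p) : cnt (rect a b) (rectFilling a b p lam sigma) k = sigma.rowLen k := by
  obtain ⟨hsab, hlab, -, -⟩ := h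
  rw [YoungDiagram.rowLen_eq_card, cnt]
  congr 1
  ext ⟨i, j⟩
  rw [Finset.mem_filter, YoungDiagram.mem_row_iff, mem_rectFilling hlab]
  constructor
  · rintro ⟨-, ⟨h1, rfl⟩ | ⟨h1, h2⟩⟩
    · exact ⟨h1, rfl⟩
    · have := ((mem_rotated' hlab).1 h1).2.2
      simp only at h2 this
      omega
  · rintro ⟨h1, rfl⟩
    exact ⟨hsab h1, Or.inl ⟨h1, rfl⟩⟩

theorem cnt_rectFilling_add (hs : sigma ≤ rect p q) (h : RookComplementary a b sigma lam)
    (k : ℕ) : cnt (rect a b) (rectFilling a b p lam sigma) (p + k) = lam.rowLen k := by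
  obtain ⟨hsab, hlab, -, -⟩ := h
  have hmem : ∀ {i j}, p + k ∈ rectFilling a b p lam sigma i j ↔
      i < a ∧ j < b ∧ k + a = i + lam.colLen (b - 1 - j) := by
    intro i j
    rw [mem_rectFilling hlab, mem_rotated' hlab, or_iff_right]
    · omega
    · rintro ⟨h1, h2⟩
      have := (mem_rect.1 (hs h1)).1
      omega
  rw [← Finset.card_range (lam.rowLen k), cnt]
  have hrow := rowLen_le_of_le_rect hlab k
  have hval : ∀ y < lam.rowLen k, b - 1 - (b - 1 - y) = y := fun y hy => by omega
  refine Finset.card_bij' (fun x _ => b - 1 - x.2)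
    (fun y _ => (k + a - lam.colLen y, b - 1 - y)) ?_ ?_ ?_ ?_
  · rintro ⟨i, j⟩ hx
    obtain ⟨hi, hj, h1⟩ := hmem.1 (Finset.mem_filter.1 hx).2
    rw [Finset.mem_range, ← YoungDiagram.mem_iff_lt_rowLen, YoungDiagram.mem_iff_lt_colLen]
    change i < a at hi
    change k + a = i + lam.colLen (b - 1 - j) at h1
    change k < lam.colLen (b - 1 - j)
    omega
  · intro y hy
    have hy' := Finset.mem_range.1 hy
    have h1 := YoungDiagram.mem_iff_lt_colLen.1 (YoungDiagram.mem_iff_lt_rowLen.2 hy')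
    have h2 := colLen_le_of_le_rect hlab y
    refine Finset.mem_filter.2 ⟨mem_rect.2 ⟨by omega, by omega⟩, hmem.2 ⟨?_, ?_, ?_⟩⟩
    · simp only
      omega
    · simp only
      omega
    · simp only [hval y hy']
      omega
  · rintro ⟨i, j⟩ hx
    obtain ⟨hi, hj, h1⟩ := hmem.1 (Finset.mem_filter.1 hx).2
    simp only at h1 hi hj ⊢
    rw [Prod.mk.injEq]
    omega
  · intro y hy
    exact hval y (Finset.mem_range.1 hy)

theorem rectFilling_isLattice (hl : lam ≤ rect p q) (hs : sigma ≤ rect p q)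
    (h : RookComplementary a b sigma lam) :
    IsLattice (rect a b) (rect p q) (rectFilling a b p lam sigma) := by
  have hT := rectFilling_isTableau hs h
  have hcnt := cnt_rectFilling_add hs h 0
  obtain ⟨hsab, hlab, -, -⟩ := h
  set E := rectFilling a b p lam sigma with hE
  have hrot : ∀ {i j}, (i, j) ∈ rotated a b lam ↔ i < a ∧ j < b ∧
      a ≤ i + lam.colLen (b - 1 - j) := mem_rotated' hlab
  intro i j v hv
  rw [LatticeAt, rowLen_rect, rowLen_rect]
  -- the box itself together with the later boxes that contain `v + 1`
  set s := insert (i, j) ((rect a b).cells.filter fun c => v + 1 ∈ E c.1 c.2 ∧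
    (c.1 < i ∨ c.1 = i ∧ j < c.2)) with hsdef
  have hscard : s.card = cntAfter (rect a b) E i j (v + 1) + 1 := by
    rw [hsdef, Finset.card_insert_of_notMem, cntAfter]
    intro hc
    have := (Finset.mem_filter.1 hc).2.2
    simp only at this
    omega
  have hsmem : ∀ x y, (x, y) ∈ s → v + 1 ∈ E x y ∧ x ≤ i := by
    intro x y hx
    rcases Finset.mem_insert.1 hx with hx | hx
    · rw [Prod.mk.injEq] at hx
      obtain ⟨rfl, rfl⟩ := hx
      exact ⟨hv, le_rfl⟩
    · obtain ⟨-, h1, h2⟩ := Finset.mem_filter.1 hx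
      simp only at h1 h2
      exact ⟨h1, by omega⟩
  by_cases hvp : v + 1 = p
  · have h1 : s.card ≤ cnt (rect a b) E (p + 0) := by
      refine Finset.card_le_card ?_
      rintro ⟨x, y⟩ hx
      have := (hsmem x y hx).1
      exact Finset.mem_filter.2 ⟨hT.mem_shape this, by rwa [Nat.add_zero, ← hvp]⟩
    have h2 := rowLen_le_of_le_rect hl 0
    rw [if_neg (by omega), if_pos (by omega)]
    omega
  · have h1 : s.card ≤ cntAfter (rect a b) E i j v := by
      have hdown : ∀ x y, (x, y) ∈ s → 1 ≤ x ∧ v ∈ E (x - 1) y := by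
        intro x y hx
        have h1 := (hsmem x y hx).1
        rw [hE, mem_rectFilling hlab] at h1
        rw [hE, mem_rectFilling hlab]
        rcases h1 with ⟨h1, rfl⟩ | ⟨h1, h2⟩
        · exact ⟨by omega, Or.inl ⟨sigma.up_left_mem (Nat.sub_le _ _) le_rfl h1, by omega⟩⟩
        · have h3 := colLen_le_of_le_rect hlab (b - 1 - y)
          rw [hrot] at h1 ⊢
          exact ⟨by omega, Or.inr ⟨⟨by omega, h1.2.1, by omega⟩, by omega⟩⟩
      refine Finset.card_le_card_of_injOn (fun x => (x.1 - 1, x.2)) ?_ ?_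
      · rintro ⟨x, y⟩ hx
        have h1 := hdown x y hx
        have h2 := (hsmem x y hx).2
        exact Finset.mem_coe.2 (Finset.mem_filter.2 ⟨hT.mem_shape h1.2, h1.2, by
          simp only
          omega⟩)
      · rintro ⟨x, y⟩ hx ⟨x', y'⟩ hx' hxx
        have h1 := (hdown x y hx).1
        have h2 := (hdown x' y' hx').1
        simp only [Prod.mk.injEq] at hxx ⊢
        omega
    split_ifs <;> omega

end Existence

open Classical in
theorem card_contentTabs_rect {a b p q : ℕ} {lam sigma : YoungDiagram} (hl : lam ≤ rect p q)
    (hs : sigma ≤ rect p q) :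
    (contentTabs (rect a b) (rect p q) (attach p q lam sigma hl hs)).card =
      if RookComplementary a b sigma lam then 1 else 0 := by
  have hcontent : ∀ E, cnt (rect a b) E + (rect p q).rowLen = (attach p q lam sigma hl hs).rowLen ↔
      (∀ k < p, cnt (rect a b) E k = sigma.rowLen k) ∧
        ∀ k, cnt (rect a b) E (p + k) = lam.rowLen k := by
    intro E
    rw [funext_iff]
    simp only [Pi.add_apply, rowLen_rect, rowLen_attach]
    constructor
    · intro h
      refine ⟨fun k hk => ?_, fun k => ?_⟩
      · have := h k
        rw [if_pos hk, if_pos hk] at this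
        omega
      · have := h (p + k)
        rwa [if_neg (by omega), if_neg (by omega), Nat.add_sub_cancel_left, Nat.add_zero] at this
    · rintro ⟨h1, h2⟩ k
      split_ifs with hk
      · rw [h1 k hk, Nat.add_comm]
      · rw [← h2, Nat.add_zero, Nat.add_sub_cancel' (not_lt.1 hk)]
  split_ifs with h
  · rw [Finset.card_eq_one]
    refine ⟨rectFilling a b p lam sigma, ?_⟩
    ext E
    rw [mem_contentTabs, hcontent, Finset.mem_singleton]
    constructor
    · rintro ⟨hT, hL, hcs, hcl⟩
      exact eq_rectFilling hT hL hs hcs hcl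
    · rintro rfl
      exact ⟨rectFilling_isTableau hs h, rectFilling_isLattice hl hs h,
        fun k hk => cnt_rectFilling_of_lt h hk, cnt_rectFilling_add hs h⟩
  · rw [Finset.card_eq_zero, Finset.eq_empty_iff_forall_notMem]
    intro E hE
    rw [mem_contentTabs, hcontent] at hE
    exact h (rookComplementary_of_lattice hE.1 hE.2.1 hs hE.2.2.1 hE.2.2.2)

open Classical in
/-- The coproduct coefficients of a rectangle. -/
theorem coprodCoeff_rect (a b : ℕ) (lam sigma : YoungDiagram) :
    coprodCoeff (rect a b) lam sigma =
      if RookComplementary a b sigma lam then (-1) ^ (a * b + sigma.card + lam.card) else 0 := by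
  rw [coprodCoeff, mulCoeff_comm, mulCoeff_eq, card_contentTabs_rect, card_attach, card_rect,
    card_rect]
  split_ifs
  · rw [show ∀ x y z w : ℕ, x + y + (y + z + w) = x + z + w + 2 * y by intros; ring, pow_add _ _
      (2 * _), pow_mul]
    simp
  · simp

theorem RookComplementary.symm {a b : ℕ} {lam sigma : YoungDiagram}
    (h : RookComplementary a b sigma lam) : RookComplementary a b lam sigma := by
  obtain ⟨hs, hl, hu, hr⟩ := h
  refine ⟨hl, hs, ?_, ?_⟩
  · ext ⟨i, j⟩
    rw [Finset.mem_union, mem_rotated hs, YoungDiagram.mem_cells, YoungDiagram.mem_cells, mem_rect]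
    constructor
    · rintro (h | h)
      · exact mem_rect.1 (hl h)
      · exact ⟨h.1, h.2.1⟩
    · rintro ⟨hi, hj⟩
      have : (a - 1 - i, b - 1 - j) ∈ sigma.cells ∪ rotated a b lam := by
        rw [hu]
        exact (YoungDiagram.mem_cells _).2 (mem_rect.2 ⟨by omega, by omega⟩)
      rw [Finset.mem_union, mem_rotated hl, YoungDiagram.mem_cells,
        show a - 1 - (a - 1 - i) = i by omega, show b - 1 - (b - 1 - j) = j by omega] at this
      tauto
  · rintro ⟨i, j⟩ hc ⟨i', j'⟩ hd h
    rw [Finset.mem_inter, mem_rotated hs, YoungDiagram.mem_cells] at hc hd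
    obtain ⟨hc1, hi, hj, hc2⟩ := hc
    obtain ⟨hd1, hi', hj', hd2⟩ := hd
    have key : ∀ {x y}, x < a → y < b → (x, y) ∈ lam →
        (a - 1 - x, b - 1 - y) ∈ rotated a b lam := by
      intro x y hx hy hxy
      rw [mem_rotated hl, show a - 1 - (a - 1 - x) = x by omega,
        show b - 1 - (b - 1 - y) = y by omega]
      exact ⟨by omega, by omega, hxy⟩
    have := hr _ (Finset.mem_inter.2 ⟨hc2, key hi hj hc1⟩) _
      (Finset.mem_inter.2 ⟨hd2, key hi' hj' hd1⟩)
      (h.imp (fun h => by simp_all) fun h => by simp_all)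
    rw [Prod.mk.injEq] at this ⊢
    omega

theorem rookComplementary_comm {a b : ℕ} {lam sigma : YoungDiagram} :
    RookComplementary a b sigma lam ↔ RookComplementary a b lam sigma :=
  ⟨fun h => h.symm, fun h => h.symm⟩

/-! ### The coefficients of the inbound quiver -/

theorem finite_le_rect (a b : ℕ) : {lam : YoungDiagram | lam ≤ rect a b}.Finite := by
  have h := (Finset.finite_toSet (rect a b).cells.powerset).preimage
    (f := YoungDiagram.cells) fun x _ y _ hxy => YoungDiagram.ext hxy
  refine h.subset fun lam hlam => ?_
  exact Finset.mem_coe.2 (Finset.mem_powerset.2 (YoungDiagram.cells_subset_iff.2 hlam))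

section Inbound

variable (m11 m12 m23 m33 : ℕ) (lam mu nu : YoungDiagram)

theorem finite_rookComplementary_pairs :
    {p : YoungDiagram × YoungDiagram |
      RookComplementary m12 m33 p.1 lam ∧ RookComplementary m23 m11 p.2 nu}.Finite :=
  ((finite_le_rect m12 m33).prod (finite_le_rect m23 m11)).subset fun _ hp => ⟨hp.1.1, hp.2.1⟩

/-- The finite set of pairs of partitions that can contribute to the coefficient. -/
noncomputable def rookPairs : Finset (YoungDiagram × YoungDiagram) :=
  (finite_rookComplementary_pairs m11 m12 m23 m33 lam nu).toFinset

theorem mem_rookPairs {p : YoungDiagram × YoungDiagram} :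
    p ∈ rookPairs m11 m12 m23 m33 lam nu ↔
      RookComplementary m12 m33 p.1 lam ∧ RookComplementary m23 m11 p.2 nu := by
  simp [rookPairs]

theorem inboundTerm_eq_zero {p : YoungDiagram × YoungDiagram}
    (hp : p ∉ rookPairs m11 m12 m23 m33 lam nu) :
    inboundTerm m11 m12 m23 m33 lam mu nu p = 0 := by
  classical
  rw [mem_rookPairs, not_and_or] at hp
  rw [inboundTerm, coprodCoeff_rect, coprodCoeff_rect, rookComplementary_comm (lam := p.2)]
  rcases hp with hp | hp <;> simp [hp]

theorem inboundTerm_eq {p : YoungDiagram × YoungDiagram}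
    (hp : p ∈ rookPairs m11 m12 m23 m33 lam nu) :
    inboundTerm m11 m12 m23 m33 lam mu nu p =
      (-1) ^ (lam.card + mu.card + nu.card + m33 * m12 + m11 * m23) *
        ((contentTabs p.2 p.1 mu).card : ℤ) := by
  classical
  rw [mem_rookPairs] at hp
  rw [inboundTerm, coprodCoeff_rect, coprodCoeff_rect, if_pos hp.1, if_pos hp.2.symm,
    mulCoeff_comm, mulCoeff_eq, ← mul_assoc, ← pow_add, ← pow_add,
    show m12 * m33 + p.1.card + lam.card + (m23 * m11 + nu.card + p.2.card) +
      (p.2.card + p.1.card + mu.card) = (lam.card + mu.card + nu.card + m33 * m12 + m11 * m23) +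
      2 * (p.1.card + p.2.card) by ring, pow_add _ _ (2 * _), pow_mul]
  simp

/-- The pair of shapes and the filling of a pair of a partition and a set-valued tableau. -/
def toShapesFilling (x : YoungDiagram × (tau : YoungDiagram) × SetValuedTableau tau) :
    (_ : YoungDiagram × YoungDiagram) × Filling :=
  ⟨(x.1, x.2.1), x.2.2.toFilling⟩

theorem toShapesFilling_injective : Function.Injective toShapesFilling := by
  rintro ⟨sigma, tau, T⟩ ⟨sigma', tau', T'⟩ h
  simp only [toShapesFilling, Sigma.mk.injEq, Prod.mk.injEq, heq_eq_eq] at h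
  obtain ⟨⟨rfl, rfl⟩, h⟩ := h
  rw [SetValuedTableau.toFilling_injective h]

theorem image_inboundPairs :
    toShapesFilling '' inboundPairs m11 m12 m23 m33 lam mu nu =
      ((rookPairs m11 m12 m23 m33 lam nu).sigma fun p => contentTabs p.2 p.1 mu :
        Finset ((_ : YoungDiagram × YoungDiagram) × Filling)) := by
  ext ⟨⟨sigma, tau⟩, E⟩
  rw [Finset.mem_coe, Finset.mem_sigma, mem_rookPairs]
  constructor
  · rintro ⟨⟨sigma', tau', T⟩, ⟨h1, h2, h3⟩, h⟩
    simp only [toShapesFilling, Sigma.mk.injEq, Prod.mk.injEq, heq_eq_eq] at h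
    obtain ⟨⟨rfl, rfl⟩, rfl⟩ := h
    exact ⟨⟨h1, h2⟩, (mem_contentTabs_iff T _ _).2 h3⟩
  · rintro ⟨⟨h1, h2⟩, h3⟩
    obtain ⟨T, hT⟩ := exists_toFilling_eq (mem_contentTabs.1 h3).1
    refine ⟨⟨sigma, tau, T⟩, ⟨h1, h2, (mem_contentTabs_iff T _ _).1 (hT ▸ h3)⟩, ?_⟩
    rw [toShapesFilling, hT]

theorem finite_inboundPairs : (inboundPairs m11 m12 m23 m33 lam mu nu).Finite := by
  refine Set.Finite.of_finite_image ?_ toShapesFilling_injective.injOn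
  rw [image_inboundPairs]
  exact Finset.finite_toSet _

theorem ncard_inboundPairs :
    (inboundPairs m11 m12 m23 m33 lam mu nu).ncard =
      ∑ p ∈ rookPairs m11 m12 m23 m33 lam nu, (contentTabs p.2 p.1 mu).card := by
  rw [← Set.ncard_image_of_injective _ toShapesFilling_injective, image_inboundPairs,
    Set.ncard_coe_finset, Finset.card_sigma]

theorem support_inboundTerm_subset :
    Function.support (inboundTerm m11 m12 m23 m33 lam mu nu) ⊆
      rookPairs m11 m12 m23 m33 lam nu := by
  intro p hp
  by_contra hc
  exact hp (inboundTerm_eq_zero m11 m12 m23 m33 lam mu nu fun h => hc (Finset.mem_coe.2 h))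

end Inbound

end StableGrothendieck

theorem proposition7p1 (m11 m12 m23 m33 : ℕ) (lam mu nu : YoungDiagram) :
    (Function.support
      (StableGrothendieck.inboundTerm m11 m12 m23 m33 lam mu nu)).Finite ∧
    (StableGrothendieck.inboundPairs m11 m12 m23 m33 lam mu nu).Finite ∧
    StableGrothendieck.inboundCoeff m11 m12 m23 m33 lam mu nu =
      ((((lam.card : ℤ) + (mu.card : ℤ) + (nu.card : ℤ) - (m33 : ℤ) * (m12 : ℤ)
          - (m11 : ℤ) * (m23 : ℤ)).negOnePow : ℤˣ) : ℤ) *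
        ((StableGrothendieck.inboundPairs m11 m12 m23 m33 lam mu nu).ncard : ℤ) := by
  have hsupp := StableGrothendieck.support_inboundTerm_subset m11 m12 m23 m33 lam mu nu
  refine ⟨(Finset.finite_toSet _).subset hsupp,
    StableGrothendieck.finite_inboundPairs m11 m12 m23 m33 lam mu nu, ?_⟩
  have hsign : ((((lam.card : ℤ) + (mu.card : ℤ) + (nu.card : ℤ) - (m33 : ℤ) * (m12 : ℤ)
      - (m11 : ℤ) * (m23 : ℤ)).negOnePow : ℤˣ) : ℤ) =
      (-1) ^ (lam.card + mu.card + nu.card + m33 * m12 + m11 * m23) := by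
    rw [← Int.coe_negOnePow_natCast]
    push_cast
    rw [Int.negOnePow_sub, Int.negOnePow_sub, Int.negOnePow_add _ ((m11 : ℤ) * m23),
      Int.negOnePow_add _ ((m33 : ℤ) * m12)]
  rw [StableGrothendieck.inboundCoeff, finsum_eq_sum_of_support_subset _ hsupp,
    StableGrothendieck.ncard_inboundPairs, hsign, Nat.cast_sum, Finset.mul_sum]
  exact Finset.sum_congr rfl fun p hp =>
    StableGrothendieck.inboundTerm_eq m11 m12 m23 m33 lam mu nu hp
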